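/- Let $k=\mathbb R$ or $\mathbb C$. **Patches and representations.** A coordinate patch of an NQ-manifold is an open set of $\mathbb R^m$ together with finitely many further coordinates of positive integer degrees, $C^\infty$ being the graded commutative algebra of formal power series in these coordinates with smooth coefficients, and with a vector field $Q$ of degree $1$, $Q^2=0$. Let $\zeta_\alpha$ ($\alpha$ in a finite set) be fibre coordinates of a trivial graded vector bundle $\mathcal E$ over a patch; in exponents of $-1$ and in degrees the index $\alpha$ stands for the degree of $\zeta_\alpha$. A representation is a lift $\hat Q=Q+\sum_{\alpha,\beta} R^\beta{}_\alpha\,\zeta_\beta\,\partial/\partial\zeta_\alpha$ of $Q$, of degree $1$ and with $\hat Q^2=0$, where $R^\beta{}_\alpha\in C^\infty$ has degree $1+\alpha-\beta$. Put $T^\beta{}_\alpha=(-1)^{\alpha\beta+\beta}R^\beta{}_\alpha$; then $\hat Q\zeta_\alpha=\sum_\beta(-1)^\beta\zeta_\beta T^\beta{}_\alpha$ and $(-1)^\beta QT^\beta{}_\alpha+\sum_\gamma(-1)^\gamma T^\beta{}_\gamma T^\gamma{}_\alpha=0$. **Super-curves and $\delta_B$.** Let $\mathcal L$ be a graded domain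 (an open set of some $\mathbb R^p$ with finitely many further coordinates of nonzero integer degrees). A super-curve over $[a,b]$ with values in $\mathcal L$ is a morphism $T[1][a,b]\times\mathcal L\to\mathcal M$ of graded manifolds; $(t,\theta)$ are the coordinates on $T[1][a,b]$, $\deg\theta=1$, $D=\theta\,\partial_t$, and $\boldsymbol f=f(\boldsymbol x(t,\theta))$ is the pull-back of a function $f$. The BRST differential is the vector field of degree $1$ on the space of super-curves given by $\delta_B\boldsymbol x^A=-D\boldsymbol x^A+\boldsymbol Q^A$. It displaces a super-curve with values in $\mathcal L$ to one with values in $\mathcal L\times\{\varepsilon\}$, $\deg\varepsilon=-1$, $\boldsymbol f\mapsto\boldsymbol f+\varepsilon(\boldsymbol{Qf}-D\boldsymbol f)$; and $\delta_BF$ is the left coefficient of $\varepsilon$ of $F$ at the displaced super-curve. It is extended to fibre coordinates $\zeta_\alpha$ of $\mathcal E$ over the final point and $\zeta^\alpha$ (of degree $-\alpha$) of $\mathcal E^*$ over the initial point by $$\delta_B\zeta_\alpha=\sum_\beta(-1)^\beta\zeta_\beta T^\beta{}_\alpha(1),\qquad \delta_B\zeta^\alpha=-\sum_\beta T^\alpha{}_\beta(0)\zeta^\beta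 ,$$ where $T(0)$ and $T(1)$ are $T(\boldsymbol x(t,\theta))|_{\theta=0}$ at the initial and at the final time. **Wilson lines.** For a super-curve over $[a,b]$ in one patch, the Wilson line is $$U(b,a)=\mathbb P\exp\Big(-\int_a^b dt\,d\theta\,\boldsymbol T\Big)=\sum_{q\ge0}(-1)^q\int_{b\ge t_1\ge\cdots\ge t_q\ge a}dt_1\cdots dt_q\ \partial_\theta\boldsymbol T(t_1)\cdots\partial_\theta\boldsymbol T(t_q).$$ If $0=t_0<\dots<t_{N+1}=1$ and the super-curve lies in the patch $i$ over $[t_i,t_{i+1}]$, then the spliced Wilson line is $$U(1,0)=U_N(1,t_N)\,\Omega_{N-1}(t_N)\,U_{N-1}(t_N,t_{N-1})\cdots\Omega_0(t_1)\,U_0(t_1,0),$$ where the invertible degree-preserving matrix $\Omega_i$, evaluated at the junction at $t_{i+1}$, $\theta=0$, is the transition function $\zeta'_\alpha=\sum_\beta\zeta_\beta\Omega^\beta{}_\alpha$ between the trivializations in the earlier patch (primed) and the later patch (unprimed), compatible with $Q$ and $\hat Q$: on the overlap $(-1)^\gamma Q\Omega^\gamma{}_\alpha+\sum_\beta(-1)^\gamma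 T^\gamma{}_\beta\Omega^\beta{}_\alpha=\sum_\beta(-1)^\beta\Omega^\gamma{}_\beta T'^\beta{}_\alpha$. **Claim.** 1. The series defining the Wilson line of a super-curve in one patch over any $[a,b]$, $a<b$, converges, for each of its coefficients (at each point of the body of $\mathcal L$). For super-curves in one patch over $[0,1]$, $$\delta_BU^\alpha{}_\beta(1,0)=-\sum_\delta T^\alpha{}_\delta(1)\,U^\delta{}_\beta(1,0)+\sum_\gamma(-1)^{\alpha+\gamma}\,U^\alpha{}_\gamma(1,0)\,T^\gamma{}_\beta(0).$$ With the action of $\delta_B$ on $\zeta_\alpha$, $\zeta^\alpha$ included, $U_C=\sum_{\alpha,\beta}\zeta_\alpha U^\alpha{}_\beta(1,0)\zeta^\beta$ satisfies $\delta_BU_C=0$. 2. The same two identities hold for spliced Wilson lines, with $T(1)$ taken in the last patch and $T(0)$ in the first. 3. For a closed super-curve (one whose initial and final points at $\theta=0$ coincide) in one patch, the Wilson loop $U_{\mathrm O}=\sum_\alpha(-1)^\alpha U^\alpha{}_\alpha(1,0)$ satisfies $\delta_BU_{\mathrm O}=0$. The same holds for the Wilson loop of a closed super-curve through several patches, where $U(1,0)$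 is the spliced Wilson line multiplied from the left by the transition function from the last patch back to the first. -/

import Mathlib

open scoped ContDiff


set_option linter.unusedSectionVars false

namespace WilsonLine

noncomputable section

/-! ### Signs, monomials -/

/-- The sign `(-1)^n`. -/
def sgn (n : ℤ) : ℤ := (Int.negOnePow n : ℤ)

theorem sgn_add (a b : ℤ) : sgn (a + b) = sgn a * sgn b := by
  simp [sgn, Int.negOnePow_add]

theorem sgn_of_even {a : ℤ} (h : Even a) : sgn a = 1 := by
  simp [sgn, Int.negOnePow_even a h]

theorem sgn_of_odd {a : ℤ} (h : Odd a) : sgn a = -1 := by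
  simp [sgn, Int.negOnePow_odd a h]

theorem sgn_mul_self (a : ℤ) : sgn a * sgn a = 1 := by
  rw [← sgn_add]; exact sgn_of_even ⟨a, rfl⟩

/-- A monomial `z_0^{e_0} ⋯ z_{n-1}^{e_{n-1}}` is admissible if no odd generator occurs twice. -/
def Adm {n : ℕ} (deg : Fin n → ℤ) (e : Fin n →₀ ℕ) : Prop := ∀ i, Odd (deg i) → e i ≤ 1

/-- The degree of a monomial. -/
def mdeg {n : ℕ} (deg : Fin n → ℤ) (e : Fin n →₀ ℕ) : ℤ := ∑ i, (e i : ℤ) * deg i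

/-- The Koszul exponent: `z^a * z^b = (-1)^{swap a b} z^{a+b}`, all generators being moved into
increasing order. -/
def swap {n : ℕ} (deg : Fin n → ℤ) (a b : Fin n →₀ ℕ) : ℤ :=
  ∑ i, ∑ j, if j < i then ((a i : ℤ) * deg i) * ((b j : ℤ) * deg j) else 0

section Monomials
variable {n : ℕ} {deg : Fin n → ℤ}

theorem Adm.left {a b : Fin n →₀ ℕ} (h : Adm deg (a + b)) : Adm deg a := fun i hi =>
  le_trans (by simp) (h i hi)

theorem Adm.right {a b : Fin n →₀ ℕ} (h : Adm deg (a + b)) : Adm deg b := fun i hi =>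
  le_trans (by simp) (h i hi)

theorem Adm.zero : Adm deg 0 := fun i _ => by simp

theorem mdeg_add (a b : Fin n →₀ ℕ) : mdeg deg (a + b) = mdeg deg a + mdeg deg b := by
  simp [mdeg, add_mul, Finset.sum_add_distrib]

theorem mdeg_zero : mdeg deg 0 = 0 := by simp [mdeg]

theorem swap_add_left (a b c : Fin n →₀ ℕ) :
    swap deg (a + b) c = swap deg a c + swap deg b c := by
  simp only [swap, ← Finset.sum_add_distrib]
  refine Finset.sum_congr rfl fun i _ => Finset.sum_congr rfl fun j _ => ?_
  split_ifs <;> simp; ring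

theorem swap_add_right (a b c : Fin n →₀ ℕ) :
    swap deg a (b + c) = swap deg a b + swap deg a c := by
  simp only [swap, ← Finset.sum_add_distrib]
  refine Finset.sum_congr rfl fun i _ => Finset.sum_congr rfl fun j _ => ?_
  split_ifs <;> simp; ring

theorem swap_zero_left (a : Fin n →₀ ℕ) : swap deg 0 a = 0 := by simp [swap]

theorem swap_zero_right (a : Fin n →₀ ℕ) : swap deg a 0 = 0 := by simp [swap]

theorem swap_comm {a b : Fin n →₀ ℕ} (h : Adm deg (a + b)) :
    sgn (swap deg a b) = sgn (mdeg deg a * mdeg deg b) * sgn (swap deg b a) := by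
  have key : swap deg a b + swap deg b a + ∑ i, ((a i : ℤ) * deg i) * ((b i : ℤ) * deg i)
      = mdeg deg a * mdeg deg b := by
    have h2 : swap deg b a =
        ∑ i, ∑ j, if i < j then ((a i : ℤ) * deg i) * ((b j : ℤ) * deg j) else 0 := by
      rw [swap, Finset.sum_comm]
      refine Finset.sum_congr rfl fun i _ => Finset.sum_congr rfl fun j _ => ?_
      split_ifs <;> ring
    have h3 : ∑ i, ((a i : ℤ) * deg i) * ((b i : ℤ) * deg i) =
        ∑ i, ∑ j, if i = j then ((a i : ℤ) * deg i) * ((b j : ℤ) * deg j) else 0 := by simp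
    rw [h2, h3, swap, mdeg, mdeg, Finset.sum_mul_sum, ← Finset.sum_add_distrib,
      ← Finset.sum_add_distrib]
    refine Finset.sum_congr rfl fun i _ => ?_
    rw [← Finset.sum_add_distrib, ← Finset.sum_add_distrib]
    refine Finset.sum_congr rfl fun j _ => ?_
    rcases lt_trichotomy i j with h | h | h
    · simp [h, h.not_gt, h.ne]
    · simp [h]
    · simp [h, h.not_gt, h.ne']
  have hev : Even (∑ i, ((a i : ℤ) * deg i) * ((b i : ℤ) * deg i)) := by
    refine Finset.sum_induction _ Even (fun _ _ => Even.add) (by simp) fun i _ => ?_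
    rcases Int.even_or_odd (deg i) with hd | hd
    · exact (hd.mul_left _).mul_right _
    · have := h i hd
      simp only [Finsupp.add_apply] at this
      have : a i = 0 ∨ b i = 0 := by omega
      rcases this with h | h <;> simp [h]
  rw [← key, sgn_add, sgn_add, sgn_of_even hev, mul_one, mul_assoc, sgn_mul_self, mul_one]

end Monomials

/-! ### Formal functions -/

/-- Families `(f_e)` of functions indexed by monomials, vanishing at inadmissible monomials. -/
def formalSubmodule (k : Type*) [RCLike k] (X : Type*) {n : ℕ} (deg : Fin n → ℤ) :
    Submodule k ((Fin n →₀ ℕ) → X → k) where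
  carrier := {f | ∀ e, ¬ Adm deg e → f e = 0}
  add_mem' := fun {f g} hf hg e he => by simp [hf e he, hg e he]
  zero_mem' := fun e _ => rfl
  smul_mem' := fun c f hf e he => by simp [hf e he]

/-- Formal power series in graded commuting generators `z_0, …, z_{n-1}` (of degrees `deg i`), whose
coefficients are `k`-valued functions on `X`: the family `f` stands for `∑_e f_e z^e`, the factors
of `z^e` being written in increasing order; inadmissible monomials vanish. -/
def FormalFn (k : Type*) [RCLike k] (X : Type*) {n : ℕ} (deg : Fin n → ℤ) : Type _ :=
  ↥(formalSubmodule k X deg)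

namespace FormalFn

section
variable {k : Type*} [RCLike k] {X Y : Type*} {n : ℕ} {deg : Fin n → ℤ}

instance : AddCommGroup (FormalFn k X deg) :=
  inferInstanceAs (AddCommGroup ↥(formalSubmodule k X deg))
instance : Module k (FormalFn k X deg) := inferInstanceAs (Module k ↥(formalSubmodule k X deg))

/-- The coefficient of the monomial `z^e`. -/
def coeff (f : FormalFn k X deg) (e : Fin n →₀ ℕ) : X → k := f.1 e

theorem coeff_eq_zero (f : FormalFn k X deg) {e : Fin n →₀ ℕ} (h : ¬ Adm deg e) :
    f.coeff e = 0 := f.2 e h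

/-- A formal function with prescribed coefficients at the admissible monomials. -/
def mk (c : (Fin n →₀ ℕ) → X → k) : FormalFn k X deg :=
  open Classical in ⟨fun e => if Adm deg e then c e else 0, fun e he => by simp [he]⟩

theorem coeff_mk (c : (Fin n →₀ ℕ) → X → k) {e : Fin n →₀ ℕ} (h : Adm deg e) :
    (mk c : FormalFn k X deg).coeff e = c e := by simp [mk, coeff, h]

theorem coeff_mk' (c : (Fin n →₀ ℕ) → X → k) (hc : ∀ e, ¬ Adm deg e → c e = 0)
    (e : Fin n →₀ ℕ) : (mk c : FormalFn k X deg).coeff e = c e := by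
  by_cases h : Adm deg e
  · exact coeff_mk c h
  · rw [coeff_eq_zero _ h, hc e h]

theorem ext {f g : FormalFn k X deg} (h : ∀ e, Adm deg e → f.coeff e = g.coeff e) : f = g := by
  apply Subtype.ext
  funext e
  by_cases he : Adm deg e
  · exact h e he
  · exact (f.2 e he).trans (g.2 e he).symm

@[simp] theorem coeff_add (f g : FormalFn k X deg) (e) :
    (f + g).coeff e = f.coeff e + g.coeff e := rfl
@[simp] theorem coeff_sub (f g : FormalFn k X deg) (e) :
    (f - g).coeff e = f.coeff e - g.coeff e := rfl
@[simp] theorem coeff_neg (f : FormalFn k X deg) (e) : (-f).coeff e = -f.coeff e := rfl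
@[simp] theorem coeff_zero (e) : (0 : FormalFn k X deg).coeff e = 0 := rfl
@[simp] theorem coeff_smul (c : k) (f : FormalFn k X deg) (e) :
    (c • f).coeff e = c • f.coeff e := rfl

/-- `coeff` as an additive map. -/
def coeffHom (e : Fin n →₀ ℕ) : FormalFn k X deg →+ (X → k) where
  toFun f := f.coeff e
  map_zero' := rfl
  map_add' _ _ := rfl

@[simp] theorem coeff_zsmul (c : ℤ) (f : FormalFn k X deg) (e) :
    (c • f).coeff e = c • f.coeff e := map_zsmul (coeffHom e) c f

/-- The product `(∑ f_a z^a) (∑ g_b z^b) = ∑ ± f_a g_b z^{a+b}`. -/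
instance : Mul (FormalFn k X deg) :=
  ⟨fun f g => mk fun e => ∑ p ∈ Finset.HasAntidiagonal.antidiagonal e,
    sgn (swap deg p.1 p.2) • (f.coeff p.1 * g.coeff p.2)⟩

instance : One (FormalFn k X deg) := ⟨mk fun e => if e = 0 then 1 else 0⟩

theorem coeff_mul (f g : FormalFn k X deg) {e : Fin n →₀ ℕ} (h : Adm deg e) :
    (f * g).coeff e = ∑ p ∈ Finset.HasAntidiagonal.antidiagonal e,
      sgn (swap deg p.1 p.2) • (f.coeff p.1 * g.coeff p.2) := coeff_mk _ h

theorem coeff_one (e : Fin n →₀ ℕ) :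
    (1 : FormalFn k X deg).coeff e = if e = 0 then 1 else 0 := by
  refine coeff_mk' _ (fun e he => ?_) e
  rw [if_neg]
  rintro rfl
  exact he Adm.zero

theorem mul_assoc' (f g h : FormalFn k X deg) : f * g * h = f * (g * h) := by
  refine ext fun e he => ?_
  rw [coeff_mul _ _ he, coeff_mul _ _ he]
  have h1 : ∀ p ∈ Finset.HasAntidiagonal.antidiagonal e,
      sgn (swap deg p.1 p.2) • ((f * g).coeff p.1 * h.coeff p.2) =
      ∑ q ∈ Finset.HasAntidiagonal.antidiagonal p.1, (sgn (swap deg q.1 p.2) * sgn (swap deg q.2 p.2) *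
        sgn (swap deg q.1 q.2)) • (f.coeff q.1 * g.coeff q.2 * h.coeff p.2) := by
    intro p hp
    rw [Finset.HasAntidiagonal.mem_antidiagonal] at hp
    rw [coeff_mul _ _ (Adm.left (hp ▸ he)), Finset.sum_mul, Finset.smul_sum]
    refine Finset.sum_congr rfl fun q hq => ?_
    rw [Finset.HasAntidiagonal.mem_antidiagonal] at hq
    rw [← hq, swap_add_left, sgn_add, smul_mul_assoc, smul_smul]
  have h2 : ∀ p ∈ Finset.HasAntidiagonal.antidiagonal e,
      sgn (swap deg p.1 p.2) • (f.coeff p.1 * (g * h).coeff p.2) =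
      ∑ q ∈ Finset.HasAntidiagonal.antidiagonal p.2, (sgn (swap deg p.1 q.1) * sgn (swap deg p.1 q.2) *
        sgn (swap deg q.1 q.2)) • (f.coeff p.1 * g.coeff q.1 * h.coeff q.2) := by
    intro p hp
    rw [Finset.HasAntidiagonal.mem_antidiagonal] at hp
    rw [coeff_mul _ _ (Adm.right (hp ▸ he)), Finset.mul_sum, Finset.smul_sum]
    refine Finset.sum_congr rfl fun q hq => ?_
    rw [Finset.HasAntidiagonal.mem_antidiagonal] at hq
    rw [← hq, swap_add_right, sgn_add, mul_smul_comm, smul_smul, mul_assoc (f.coeff _)]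
  rw [Finset.sum_congr rfl h1, Finset.sum_congr rfl h2, Finset.sum_sigma', Finset.sum_sigma']
  refine Finset.sum_nbij' (fun x => ⟨(x.2.1, x.2.2 + x.1.2), (x.2.2, x.1.2)⟩)
    (fun x => ⟨(x.1.1 + x.2.1, x.2.2), (x.1.1, x.2.1)⟩) ?_ ?_ ?_ ?_ ?_
  · rintro ⟨⟨i, j⟩, ⟨a, b⟩⟩ hx
    simp only [Finset.mem_sigma, Finset.HasAntidiagonal.mem_antidiagonal] at hx ⊢
    exact ⟨by rw [← hx.1, ← hx.2, add_assoc], trivial⟩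
  · rintro ⟨⟨i, j⟩, ⟨a, b⟩⟩ hx
    simp only [Finset.mem_sigma, Finset.HasAntidiagonal.mem_antidiagonal] at hx ⊢
    exact ⟨by rw [← hx.1, ← hx.2, add_assoc], trivial⟩
  · rintro ⟨⟨i, j⟩, ⟨a, b⟩⟩ hx
    simp only [Finset.mem_sigma, Finset.HasAntidiagonal.mem_antidiagonal] at hx
    obtain ⟨_, rfl⟩ := hx
    rfl
  · rintro ⟨⟨i, j⟩, ⟨a, b⟩⟩ hx
    simp only [Finset.mem_sigma, Finset.HasAntidiagonal.mem_antidiagonal] at hx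
    obtain ⟨_, rfl⟩ := hx
    rfl
  · rintro ⟨⟨i, j⟩, ⟨a, b⟩⟩ hx
    simp only [Finset.mem_sigma, Finset.HasAntidiagonal.mem_antidiagonal] at hx
    congr 1
    ring

theorem one_mul' (f : FormalFn k X deg) : 1 * f = f := by
  refine ext fun e he => ?_
  rw [coeff_mul _ _ he, Finset.sum_eq_single (0, e)]
  · simp [coeff_one, swap_zero_left, sgn]
  · rintro ⟨a, b⟩ hp hne
    rw [Finset.HasAntidiagonal.mem_antidiagonal] at hp
    have : a ≠ 0 := by rintro rfl; apply hne; simp at hp; simp [hp]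
    simp [coeff_one, this]
  · intro h; simp at h

theorem mul_one' (f : FormalFn k X deg) : f * 1 = f := by
  refine ext fun e he => ?_
  rw [coeff_mul _ _ he, Finset.sum_eq_single (e, 0)]
  · simp [coeff_one, swap_zero_right, sgn]
  · rintro ⟨a, b⟩ hp hne
    rw [Finset.HasAntidiagonal.mem_antidiagonal] at hp
    have : b ≠ 0 := by rintro rfl; apply hne; simp at hp; simp [hp]
    simp [coeff_one, this]
  · intro h; simp at h

instance : Ring (FormalFn k X deg) :=
  { (inferInstance : AddCommGroup (FormalFn k X deg)) with
    mul := (· * ·)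
    one := 1
    mul_assoc := mul_assoc'
    one_mul := one_mul'
    mul_one := mul_one'
    left_distrib := fun f g h => ext fun e he => by
      simp [coeff_mul _ _ he, mul_add, Finset.sum_add_distrib]
    right_distrib := fun f g h => ext fun e he => by
      simp [coeff_mul _ _ he, add_mul, Finset.sum_add_distrib]
    zero_mul := fun f => ext fun e he => by simp [coeff_mul _ _ he]
    mul_zero := fun f => ext fun e he => by simp [coeff_mul _ _ he]
    zsmul := fun m f => m • f
    zsmul_zero' := fun f => zero_zsmul f
    zsmul_succ' := fun m f => SubNegMonoid.zsmul_succ' m f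
    zsmul_neg' := fun m f => SubNegMonoid.zsmul_neg' m f
    nsmul := fun m f => m • f
    nsmul_zero := fun f => zero_nsmul f
    nsmul_succ := fun m f => AddMonoid.nsmul_succ m f }

instance : Algebra k (FormalFn k X deg) :=
  Algebra.ofModule
    (fun c f g => ext fun e he => by
      simp only [coeff_smul, coeff_mul _ _ he, Finset.smul_sum]
      refine Finset.sum_congr rfl fun p _ => ?_
      rw [smul_comm, smul_mul_assoc])
    (fun c f g => ext fun e he => by
      simp only [coeff_smul, coeff_mul _ _ he, Finset.smul_sum]
      refine Finset.sum_congr rfl fun p _ => ?_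
      rw [smul_comm, mul_smul_comm])

theorem coeff_sum {ι : Type*} (s : Finset ι) (f : ι → FormalFn k X deg) (e) :
    (∑ i ∈ s, f i).coeff e = ∑ i ∈ s, (f i).coeff e := map_sum (coeffHom e) f s

/-- `f` is homogeneous of degree `p`. -/
def IsHomog (p : ℤ) (f : FormalFn k X deg) : Prop := ∀ e, mdeg deg e ≠ p → f.coeff e = 0

/-- The part of degree `p` of a formal function. -/
def proj (p : ℤ) (f : FormalFn k X deg) : FormalFn k X deg :=
  mk fun e => if mdeg deg e = p then f.coeff e else 0

theorem coeff_proj (p : ℤ) (f : FormalFn k X deg) (e) :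
    (proj p f).coeff e = if mdeg deg e = p then f.coeff e else 0 :=
  coeff_mk' _ (fun e he => by simp [coeff_eq_zero f he]) e

/-- The parity automorphism, `f ↦ (-1)^p f` on functions of degree `p`. -/
def parity (f : FormalFn k X deg) : FormalFn k X deg :=
  mk fun e => sgn (mdeg deg e) • f.coeff e

theorem coeff_parity (f : FormalFn k X deg) (e) :
    (parity f).coeff e = sgn (mdeg deg e) • f.coeff e :=
  coeff_mk' _ (fun e he => by simp [coeff_eq_zero f he]) e

theorem isHomog_iff {p : ℤ} {f : FormalFn k X deg} : IsHomog p f ↔ proj p f = f := by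
  constructor
  · intro h
    refine ext fun e _ => ?_
    rw [coeff_proj]
    split_ifs with h'
    · rfl
    · exact (h e h').symm
  · intro h e he
    rw [← h, coeff_proj, if_neg he]

theorem IsHomog.mul {p q : ℤ} {f g : FormalFn k X deg} (hf : IsHomog p f) (hg : IsHomog q g) :
    IsHomog (p + q) (f * g) := by
  intro e he
  by_cases ha : Adm deg e
  · rw [coeff_mul _ _ ha]
    refine Finset.sum_eq_zero fun x hx => ?_
    rw [Finset.HasAntidiagonal.mem_antidiagonal] at hx
    by_cases h1 : mdeg deg x.1 = p
    · have : mdeg deg x.2 ≠ q := by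
        rintro h2; apply he; rw [← hx, mdeg_add, h1, h2]
      simp [hg _ this]
    · simp [hf _ h1]
  · exact coeff_eq_zero _ ha

theorem IsHomog.add {p : ℤ} {f g : FormalFn k X deg} (hf : IsHomog p f) (hg : IsHomog p g) :
    IsHomog p (f + g) := fun e he => by simp [hf e he, hg e he]

theorem IsHomog.zsmul {p : ℤ} {f : FormalFn k X deg} (c : ℤ) (hf : IsHomog p f) :
    IsHomog p (c • f) := fun e he => by rw [coeff_zsmul, hf e he, smul_zero]

theorem IsHomog.sum {ι : Type*} {p : ℤ} {s : Finset ι} {f : ι → FormalFn k X deg}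
    (hf : ∀ i ∈ s, IsHomog p (f i)) : IsHomog p (∑ i ∈ s, f i) := fun e he => by
  rw [coeff_sum]; exact Finset.sum_eq_zero fun i hi => hf i hi e he

/-- Apply an additive operation to all coefficients. -/
def mapCoeff (F : (X → k) → Y → k) (f : FormalFn k X deg) : FormalFn k Y deg :=
  mk fun e => F (f.coeff e)

theorem coeff_mapCoeff {F : (X → k) → Y → k} (hF : F 0 = 0) (f : FormalFn k X deg) (e) :
    (mapCoeff F f).coeff e = F (f.coeff e) :=
  coeff_mk' _ (fun e he => by simp [coeff_eq_zero f he, hF]) e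

/-- The generator `z_p` as a formal function. -/
def gen (p : Fin n) : FormalFn k X deg := mk fun e => if e = Finsupp.single p 1 then 1 else 0

theorem adm_single (p : Fin n) : Adm deg (Finsupp.single p 1) := fun i _ => by
  by_cases h : p = i
  · subst h; simp
  · simp [h]

theorem mdeg_single (p : Fin n) : mdeg deg (Finsupp.single p 1) = deg p := by
  simp [mdeg, Finsupp.single_apply]

theorem coeff_gen (p : Fin n) (e) :
    (gen p : FormalFn k X deg).coeff e = if e = Finsupp.single p 1 then 1 else 0 := by
  refine coeff_mk' _ (fun e he => ?_) e
  rw [if_neg]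
  rintro rfl
  exact he (adm_single p)

theorem isHomog_gen (p : Fin n) : IsHomog (deg p) (gen p : FormalFn k X deg) := fun e he => by
  rw [coeff_gen, if_neg]
  rintro rfl
  exact he (mdeg_single p)

theorem gen_mul {p : Fin n} (hp : Odd (deg p)) (f : FormalFn k X deg) :
    gen p * f = parity f * gen p := by
  refine ext fun e he => ?_
  rw [coeff_mul _ _ he, coeff_mul _ _ he]
  refine Finset.sum_nbij' Prod.swap Prod.swap ?_ ?_ (fun _ _ => rfl) (fun _ _ => rfl) ?_
  · intro x hx
    simpa [add_comm] using hx
  · intro x hx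
    simpa [add_comm] using hx
  intro y hy
  obtain ⟨x, rfl⟩ : ∃ x : (Fin n →₀ ℕ) × (Fin n →₀ ℕ), x.swap = y := ⟨y.swap, rfl⟩
  have hx : x.1 + x.2 = e := by simpa [add_comm] using hy
  simp only [Prod.swap_swap, Prod.fst_swap, Prod.snd_swap, coeff_gen, coeff_parity]
  split_ifs with h
  · rw [one_mul, mul_one, smul_smul,
      swap_comm (a := x.2) (b := x.1) (by rw [add_comm, hx]; exact he), h, mdeg_single]
    have : sgn (deg p * mdeg deg x.1) = sgn (mdeg deg x.1) := by
      rcases Int.even_or_odd (mdeg deg x.1) with h' | h'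
      · rw [sgn_of_even h', sgn_of_even (h'.mul_left _)]
      · rw [sgn_of_odd h', sgn_of_odd (hp.mul h')]
    rw [this, mul_comm]
  · simp

theorem gen_mul_self {p : Fin n} (hp : Odd (deg p)) :
    (gen p * gen p : FormalFn k X deg) = 0 := by
  refine ext fun e he => ?_
  rw [coeff_mul _ _ he, coeff_zero]
  refine Finset.sum_eq_zero fun x hx => ?_
  rw [Finset.HasAntidiagonal.mem_antidiagonal] at hx
  simp only [coeff_gen]
  split_ifs with h1 h2
  · exfalso
    have := he p hp
    rw [← hx, h1, h2] at this
    simp at this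
  all_goals simp

theorem isHomog_proj (p : ℤ) (f : FormalFn k X deg) : IsHomog p (proj p f) := fun e he => by
  rw [coeff_proj, if_neg he]

theorem proj_add (p : ℤ) (f g : FormalFn k X deg) : proj p (f + g) = proj p f + proj p g := by
  refine ext fun e _ => ?_
  simp only [coeff_proj, coeff_add]
  split_ifs <;> simp

theorem proj_gen_mul (p : Fin n) (q : ℤ) (f : FormalFn k X deg) :
    proj (deg p + q) (gen p * f) = gen p * proj q f := by
  refine ext fun e he => ?_
  rw [coeff_proj, coeff_mul _ _ he, coeff_mul _ _ he]
  split_ifs with h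
  · refine Finset.sum_congr rfl fun x hx => ?_
    rw [Finset.HasAntidiagonal.mem_antidiagonal] at hx
    rw [coeff_gen, coeff_proj]
    split_ifs with h1 h2 h2
    · rfl
    · exfalso; apply h2
      rw [← hx, mdeg_add, h1, mdeg_single] at h
      linarith
    · simp
    · simp
  · symm
    refine Finset.sum_eq_zero fun x hx => ?_
    rw [Finset.HasAntidiagonal.mem_antidiagonal] at hx
    rw [coeff_gen, coeff_proj]
    split_ifs with h1 h2 h2
    · exfalso; apply h
      rw [← hx, mdeg_add, h1, mdeg_single, h2]
    all_goals simp

end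

/-! Inserting one more generator `z_p`, and setting it to zero. -/

section Insert
variable {k : Type*} [RCLike k] {X : Type*} {n : ℕ} {deg : Fin n → ℤ} {deg' : Fin (n + 1) → ℤ}

/-- The exponent with entry `y` at place `p` and the entries of `e` elsewhere. -/
def ins (p : Fin (n + 1)) (y : ℕ) (e : Fin n →₀ ℕ) : Fin (n + 1) →₀ ℕ :=
  Finsupp.equivFunOnFinite.symm (p.insertNth y (e : Fin n → ℕ))

/-- Forget the entry at place `p`. -/
def del (p : Fin (n + 1)) (e : Fin (n + 1) →₀ ℕ) : Fin n →₀ ℕ :=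
  Finsupp.equivFunOnFinite.symm fun i => e (p.succAbove i)

@[simp] theorem ins_same (p : Fin (n + 1)) (y : ℕ) (e : Fin n →₀ ℕ) : ins p y e p = y := by
  simp [ins]
@[simp] theorem ins_succAbove (p : Fin (n + 1)) (y : ℕ) (e : Fin n →₀ ℕ) (i) :
    ins p y e (p.succAbove i) = e i := by simp [ins]
@[simp] theorem del_apply (p : Fin (n + 1)) (e : Fin (n + 1) →₀ ℕ) (i) :
    del p e i = e (p.succAbove i) := by simp [del]
@[simp] theorem del_ins (p : Fin (n + 1)) (y : ℕ) (e : Fin n →₀ ℕ) : del p (ins p y e) = e := by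
  ext i; simp

theorem ins_del (p : Fin (n + 1)) (e : Fin (n + 1) →₀ ℕ) : ins p (e p) (del p e) = e := by
  ext i
  refine Fin.succAboveCases p ?_ ?_ i
  · simp
  · intro j; simp

theorem ins_add (p : Fin (n + 1)) (x y : ℕ) (a b : Fin n →₀ ℕ) :
    ins p (x + y) (a + b) = ins p x a + ins p y b := by
  ext i
  refine Fin.succAboveCases p ?_ ?_ i
  · simp
  · intro j; simp

theorem adm_ins_zero {p : Fin (n + 1)} (h : ∀ i, deg' (p.succAbove i) = deg i) (e : Fin n →₀ ℕ) :
    Adm deg' (ins p 0 e) ↔ Adm deg e := by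
  constructor
  · intro he i hi
    have := he (p.succAbove i) (by rwa [h])
    simpa using this
  · intro he i
    refine Fin.succAboveCases p ?_ ?_ i
    · simp
    · intro j hj
      rw [h] at hj
      simpa using he j hj

theorem adm_ins_one {p : Fin (n + 1)} (h : ∀ i, deg' (p.succAbove i) = deg i) (e : Fin n →₀ ℕ) :
    Adm deg' (ins p 1 e) ↔ Adm deg e := by
  constructor
  · intro he i hi
    have := he (p.succAbove i) (by rwa [h])
    simpa using this
  · intro he i
    refine Fin.succAboveCases p ?_ ?_ i
    · simp
    · intro j hj
      rw [h] at hj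
      simpa using he j hj

theorem mdeg_ins {p : Fin (n + 1)} (h : ∀ i, deg' (p.succAbove i) = deg i) (y : ℕ)
    (e : Fin n →₀ ℕ) : mdeg deg' (ins p y e) = y * deg' p + mdeg deg e := by
  simp [mdeg, Fin.sum_univ_succAbove _ p, h]

theorem swap_ins_zero {p : Fin (n + 1)} (h : ∀ i, deg' (p.succAbove i) = deg i)
    (a b : Fin n →₀ ℕ) : swap deg' (ins p 0 a) (ins p 0 b) = swap deg a b := by
  simp only [swap, Fin.sum_univ_succAbove _ p]
  simp [h]

theorem sum_antidiagonal_ins {M : Type*} [AddCommMonoid M] (p : Fin (n + 1)) (e : Fin n →₀ ℕ)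
    (F : (Fin (n + 1) →₀ ℕ) × (Fin (n + 1) →₀ ℕ) → M) :
    ∑ x ∈ Finset.HasAntidiagonal.antidiagonal (ins p 0 e), F x =
      ∑ x ∈ Finset.HasAntidiagonal.antidiagonal e, F (ins p 0 x.1, ins p 0 x.2) := by
  have hz : ∀ x ∈ Finset.HasAntidiagonal.antidiagonal (ins p 0 e), x.1 p = 0 ∧ x.2 p = 0 := by
    intro x hx
    rw [Finset.HasAntidiagonal.mem_antidiagonal] at hx
    have := DFunLike.congr_fun hx p
    simpa using this
  refine Finset.sum_nbij' (fun x => (del p x.1, del p x.2))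
    (fun x => (ins p 0 x.1, ins p 0 x.2)) ?_ ?_ ?_ ?_ ?_
  · intro x hx
    rw [Finset.HasAntidiagonal.mem_antidiagonal] at hx ⊢
    ext i
    have := DFunLike.congr_fun hx (p.succAbove i)
    simpa using this
  · intro x hx
    rw [Finset.HasAntidiagonal.mem_antidiagonal] at hx ⊢
    rw [← ins_add, hx]
  · intro x hx
    obtain ⟨h1, h2⟩ := hz x hx
    have e1 := ins_del p x.1
    have e2 := ins_del p x.2
    rw [h1] at e1
    rw [h2] at e2
    exact Prod.ext e1 e2
  · intro x _
    simp
  · intro x hx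
    obtain ⟨h1, h2⟩ := hz x hx
    have e1 := ins_del p x.1
    have e2 := ins_del p x.2
    rw [h1] at e1
    rw [h2] at e2
    simp only [e1, e2]

/-- Regard a formal function as one that does not depend on the additional generator `z_p`. -/
def push (p : Fin (n + 1)) (f : FormalFn k X deg) : FormalFn k X deg' :=
  mk fun e => if e p = 0 then f.coeff (del p e) else 0

/-- Set the generator `z_p` to zero. -/
def kill (p : Fin (n + 1)) (f : FormalFn k X deg') : FormalFn k X deg :=
  mk fun e => f.coeff (ins p 0 e)

/-- The left coefficient `g` of the first generator in `f = h + z_0 g`, with `g` and `h`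
independent of `z_0`; for odd `z_0` this is the left derivative `∂f/∂z_0` at `z_0 = 0`. -/
def leftCoeff (f : FormalFn k X deg') : FormalFn k X deg := mk fun e => f.coeff (ins 0 1 e)

variable {p : Fin (n + 1)}

theorem coeff_push (h : ∀ i, deg' (p.succAbove i) = deg i) (f : FormalFn k X deg) (e) :
    (push p f : FormalFn k X deg').coeff e = if e p = 0 then f.coeff (del p e) else 0 := by
  refine coeff_mk' _ (fun e he => ?_) e
  split_ifs with h0
  · refine coeff_eq_zero _ fun hd => he ?_
    rw [← ins_del p e, h0]
    exact (adm_ins_zero h _).2 hd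
  · rfl

theorem coeff_kill (h : ∀ i, deg' (p.succAbove i) = deg i) (f : FormalFn k X deg') (e) :
    (kill p f : FormalFn k X deg).coeff e = f.coeff (ins p 0 e) :=
  coeff_mk' _ (fun _ he => coeff_eq_zero _ fun hd => he ((adm_ins_zero h _).1 hd)) e

theorem push_mul (h : ∀ i, deg' (p.succAbove i) = deg i) (f g : FormalFn k X deg) :
    (push p (f * g) : FormalFn k X deg') = push p f * push p g := by
  refine ext fun e he => ?_
  rw [coeff_push h, coeff_mul _ _ he]
  split_ifs with h0
  · have e1 := ins_del p e
    rw [h0] at e1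
    have hd : Adm deg (del p e) := (adm_ins_zero h _).1 (by rw [e1]; exact he)
    rw [coeff_mul _ _ hd]
    conv_rhs => rw [← e1, sum_antidiagonal_ins]
    refine Finset.sum_congr rfl fun x _ => ?_
    simp [coeff_push h, swap_ins_zero h]
  · symm
    refine Finset.sum_eq_zero fun x hx => ?_
    rw [Finset.HasAntidiagonal.mem_antidiagonal] at hx
    have := DFunLike.congr_fun hx p
    simp only [Finsupp.add_apply] at this
    rw [coeff_push h, coeff_push h]
    split_ifs with h1 h2
    · omega
    all_goals simp

theorem push_one (h : ∀ i, deg' (p.succAbove i) = deg i) :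
    (push p (1 : FormalFn k X deg) : FormalFn k X deg') = 1 := by
  refine ext fun e _ => ?_
  rw [coeff_push h, coeff_one, coeff_one]
  by_cases h0 : e p = 0
  · have e1 := ins_del p e
    rw [h0] at e1
    have : del p e = 0 ↔ e = 0 := by
      constructor
      · intro hd
        rw [← e1, hd]
        ext i
        refine Fin.succAboveCases p ?_ ?_ i <;> simp
      · rintro rfl
        ext i; simp
    simp [h0, this]
  · have : e ≠ 0 := by rintro rfl; simp at h0
    simp [h0, this]

theorem push_add (h : ∀ i, deg' (p.succAbove i) = deg i) (f g : FormalFn k X deg) :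
    (push p (f + g) : FormalFn k X deg') = push p f + push p g := by
  refine ext fun e _ => ?_
  simp only [coeff_push h, coeff_add]
  split_ifs <;> simp

theorem push_smul (h : ∀ i, deg' (p.succAbove i) = deg i) (c : k) (f : FormalFn k X deg) :
    (push p (c • f) : FormalFn k X deg') = c • push p f := by
  refine ext fun e _ => ?_
  simp only [coeff_push h, coeff_smul]
  split_ifs <;> simp

theorem push_zero (h : ∀ i, deg' (p.succAbove i) = deg i) :
    (push p (0 : FormalFn k X deg) : FormalFn k X deg') = 0 := by
  refine ext fun e _ => ?_
  simp [coeff_push h]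

theorem push_parity (h : ∀ i, deg' (p.succAbove i) = deg i) (f : FormalFn k X deg) :
    (push p (parity f) : FormalFn k X deg') = parity (push p f) := by
  refine ext fun e _ => ?_
  rw [coeff_push h, coeff_parity, coeff_parity, coeff_push h]
  split_ifs with h0
  · have e1 := mdeg_ins h (e p) (del p e)
    rw [ins_del, h0] at e1
    simp [e1]
  · simp

theorem push_proj (h : ∀ i, deg' (p.succAbove i) = deg i) (q : ℤ) (f : FormalFn k X deg) :
    (push p (proj q f) : FormalFn k X deg') = proj q (push p f) := by
  refine ext fun e _ => ?_
  rw [coeff_push h, coeff_proj, coeff_proj, coeff_push h]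
  split_ifs with h0 h1 h2 h2 <;> try rfl
  · have e1 := mdeg_ins h (e p) (del p e)
    rw [ins_del, h0] at e1
    exfalso; apply h2; rw [e1, ← h1]; simp
  · have e1 := mdeg_ins h (e p) (del p e)
    rw [ins_del, h0] at e1
    exfalso; apply h1; rw [← h2, e1]; simp

theorem isHomog_push (h : ∀ i, deg' (p.succAbove i) = deg i) {q : ℤ} {f : FormalFn k X deg}
    (hf : IsHomog q f) : IsHomog q (push p f : FormalFn k X deg') := by
  rw [isHomog_iff] at hf ⊢
  rw [← push_proj h, hf]

theorem kill_mul (h : ∀ i, deg' (p.succAbove i) = deg i) (f g : FormalFn k X deg') :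
    (kill p (f * g) : FormalFn k X deg) = kill p f * kill p g := by
  refine ext fun e he => ?_
  rw [coeff_kill h, coeff_mul _ _ he, coeff_mul _ _ ((adm_ins_zero h _).2 he),
    sum_antidiagonal_ins]
  refine Finset.sum_congr rfl fun x _ => ?_
  rw [coeff_kill h, coeff_kill h, swap_ins_zero h]

theorem kill_gen_succ (h : ∀ i, deg' ((0 : Fin (n + 1)).succAbove i) = deg i) (i : Fin n) :
    (kill 0 (gen i.succ : FormalFn k X deg') : FormalFn k X deg) = gen i := by
  refine ext fun e _ => ?_
  rw [coeff_kill h, coeff_gen, coeff_gen]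
  have : ins 0 0 e = Finsupp.single i.succ 1 ↔ e = Finsupp.single i 1 := by
    constructor
    · intro h'
      ext j
      have := DFunLike.congr_fun h' ((0 : Fin (n + 1)).succAbove j)
      rw [ins_succAbove] at this
      rw [this]
      simp [Finsupp.single_apply]
    · rintro rfl
      ext j
      refine Fin.succAboveCases 0 ?_ ?_ j
      · simp
      · intro j
        rw [ins_succAbove]
        simp [Finsupp.single_apply]
  simp only [this]

theorem kill_gen (h : ∀ i, deg' (p.succAbove i) = deg i) :
    (kill p (gen p : FormalFn k X deg') : FormalFn k X deg) = 0 := by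
  refine ext fun e _ => ?_
  rw [coeff_kill h, coeff_gen, if_neg]
  · rfl
  · intro h'
    have := DFunLike.congr_fun h' p
    simp at this

end Insert

end FormalFn

open FormalFn

/-! ### Smooth functions -/

section Smooth
variable {k : Type*} [RCLike k] {E : Type*} [NormedAddCommGroup E] [NormedSpace ℝ E]

/-- Extension of a function on `D` by zero. -/
def extZ {D : Set E} (f : D → k) : E → k :=
  open Classical in fun x => if h : x ∈ D then f ⟨x, h⟩ else 0

theorem extZ_apply {D : Set E} (f : D → k) {x : E} (h : x ∈ D) : extZ f x = f ⟨x, h⟩ := by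
  simp [extZ, h]

theorem extZ_zero {D : Set E} : extZ (0 : D → k) = 0 := by
  funext x; simp [extZ]

theorem extZ_add {D : Set E} (f g : D → k) : extZ (f + g) = extZ f + extZ g := by
  funext x; by_cases h : x ∈ D <;> simp [extZ, h]

theorem extZ_mul {D : Set E} (f g : D → k) : extZ (f * g) = extZ f * extZ g := by
  funext x; by_cases h : x ∈ D <;> simp [extZ, h]

theorem extZ_smul {D : Set E} (c : k) (f : D → k) : extZ (c • f) = c • extZ f := by
  funext x; by_cases h : x ∈ D <;> simp [extZ, h]

/-- Smoothness of a `k`-valued function on the subset `D` of a normed space. -/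
def IsSmooth {D : Set E} (f : D → k) : Prop := ContDiffOn ℝ ∞ (extZ f) D

theorem IsSmooth.zero {D : Set E} : IsSmooth (0 : D → k) := by
  rw [IsSmooth, extZ_zero]; exact contDiffOn_const

theorem IsSmooth.const {D : Set E} (c : k) : IsSmooth (fun _ : D => c) :=
  (contDiffOn_const (c := c)).congr fun x hx => by simp [extZ, hx]

theorem IsSmooth.add {D : Set E} {f g : D → k} (hf : IsSmooth f) (hg : IsSmooth g) :
    IsSmooth (f + g) := by
  rw [IsSmooth, extZ_add]; exact ContDiffOn.add hf hg

theorem IsSmooth.mul {D : Set E} {f g : D → k} (hf : IsSmooth f) (hg : IsSmooth g) :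
    IsSmooth (f * g) := by
  rw [IsSmooth, extZ_mul]; exact ContDiffOn.mul hf hg

theorem IsSmooth.smul {D : Set E} {f : D → k} (c : k) (hf : IsSmooth f) : IsSmooth (c • f) := by
  rw [IsSmooth, extZ_smul]; exact ContDiffOn.const_smul c hf

theorem IsSmooth.zsmul {D : Set E} {f : D → k} (c : ℤ) (hf : IsSmooth f) : IsSmooth (c • f) := by
  have : c • f = (c : k) • f := by ext x; simp
  rw [this]; exact hf.smul _

theorem IsSmooth.sum {ι : Type*} {D : Set E} {s : Finset ι} {f : ι → D → k}
    (hf : ∀ i ∈ s, IsSmooth (f i)) : IsSmooth (∑ i ∈ s, f i) :=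
  Finset.sum_induction _ IsSmooth (fun _ _ => IsSmooth.add) IsSmooth.zero hf

variable (k) in
/-- The algebra `C^∞(D)[[z_0, …, z_{n-1}]]` of functions on the graded domain with body `D` and
generators of degrees `deg i`. -/
def smoothAlg (D : Set E) {n : ℕ} (deg : Fin n → ℤ) : Subalgebra k (FormalFn k D deg) where
  carrier := {f | ∀ e, IsSmooth (f.coeff e)}
  mul_mem' := fun {f g} hf hg e => by
    by_cases he : Adm deg e
    · rw [coeff_mul _ _ he]
      exact IsSmooth.sum fun p _ => ((hf _).mul (hg _)).zsmul _
    · rw [coeff_eq_zero _ he]; exact IsSmooth.zero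
  add_mem' := fun {f g} hf hg e => (hf e).add (hg e)
  algebraMap_mem' := fun c e => by
    rw [Algebra.algebraMap_eq_smul_one, coeff_smul, coeff_one]
    split_ifs
    · exact (IsSmooth.const 1).smul c
    · exact IsSmooth.zero.smul c

variable (k) in
/-- `C^∞` of a graded domain, as a type. -/
abbrev CInf (D : Set E) {n : ℕ} (deg : Fin n → ℤ) : Type _ := ↥(smoothAlg k D deg)

variable {D : Set E} {n : ℕ} {deg : Fin n → ℤ}

/-- The part of degree `p`. -/
def cproj (p : ℤ) (f : CInf k D deg) : CInf k D deg :=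
  ⟨proj p f.1, fun e => by
    rw [coeff_proj]; split_ifs
    · exact f.2 e
    · exact IsSmooth.zero⟩

/-- The parity automorphism `f ↦ (-1)^{deg f} f`. -/
def cparity (f : CInf k D deg) : CInf k D deg :=
  ⟨parity f.1, fun e => by rw [coeff_parity]; exact (f.2 e).zsmul _⟩

/-- The generator `z_p`. -/
def cgen (p : Fin n) : CInf k D deg :=
  ⟨gen p, fun e => by
    rw [coeff_gen]; split_ifs
    · exact IsSmooth.const 1
    · exact IsSmooth.zero⟩

/-- Functions that do not depend on the additional generator `z_p`. -/
def cpush {deg' : Fin (n + 1) → ℤ} (p : Fin (n + 1)) (h : ∀ i, deg' (p.succAbove i) = deg i)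
    (f : CInf k D deg) : CInf k D deg' :=
  ⟨push p f.1, fun e => by
    rw [coeff_push h]; split_ifs
    · exact f.2 _
    · exact IsSmooth.zero⟩

theorem cpush_add {deg' : Fin (n + 1) → ℤ} (p : Fin (n + 1))
    (h : ∀ i, deg' (p.succAbove i) = deg i) (f g : CInf k D deg) :
    cpush p h (f + g) = cpush p h f + cpush p h g := Subtype.ext (push_add h _ _)

theorem cpush_mul {deg' : Fin (n + 1) → ℤ} (p : Fin (n + 1))
    (h : ∀ i, deg' (p.succAbove i) = deg i) (f g : CInf k D deg) :
    cpush p h (f * g) = cpush p h f * cpush p h g := Subtype.ext (push_mul h _ _)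

theorem cpush_smul {deg' : Fin (n + 1) → ℤ} (p : Fin (n + 1))
    (h : ∀ i, deg' (p.succAbove i) = deg i) (c : k) (f : CInf k D deg) :
    cpush p h (c • f) = c • cpush p h f := Subtype.ext (push_smul h _ _)

theorem cpush_parity {deg' : Fin (n + 1) → ℤ} (p : Fin (n + 1))
    (h : ∀ i, deg' (p.succAbove i) = deg i) (f : CInf k D deg) :
    cpush p h (cparity f) = cparity (cpush p h f) := Subtype.ext (push_parity h _)

theorem cpush_proj {deg' : Fin (n + 1) → ℤ} (p : Fin (n + 1))
    (h : ∀ i, deg' (p.succAbove i) = deg i) (q : ℤ) (f : CInf k D deg) :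
    cpush p h (cproj q f) = cproj q (cpush p h f) := Subtype.ext (push_proj h _ _)

theorem cgen_mul {p : Fin n} (hp : Odd (deg p)) (f : CInf k D deg) :
    cgen p * f = cparity f * cgen p := Subtype.ext (gen_mul hp _)

theorem cgen_mul_self {p : Fin n} (hp : Odd (deg p)) :
    (cgen p * cgen p : CInf k D deg) = 0 := Subtype.ext (gen_mul_self hp)

theorem cproj_cgen_mul (p : Fin n) (q : ℤ) (f : CInf k D deg) :
    cproj (deg p + q) (cgen p * f) = cgen p * cproj q f := Subtype.ext (proj_gen_mul p q _)

theorem cproj_add (p : ℤ) (f g : CInf k D deg) : cproj p (f + g) = cproj p f + cproj p g :=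
  Subtype.ext (proj_add p _ _)

/-- A function is determined by its homogeneous parts. -/
theorem cproj_ext {f g : CInf k D deg} (h : ∀ p, cproj p f = cproj p g) : f = g := by
  refine Subtype.ext (FormalFn.ext fun e _ => ?_)
  have := congrArg (fun u => FormalFn.coeff u.1 e) (h (mdeg deg e))
  simpa [cproj, coeff_proj] using this

theorem cproj_cparity (p : ℤ) (f : CInf k D deg) : cproj p (cparity f) = sgn p • cproj p f := by
  refine Subtype.ext (FormalFn.ext fun e _ => ?_)
  have : ((sgn p • cproj p f : CInf k D deg) : FormalFn k D deg) = sgn p • (cproj p f).1 := by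
    simp
  rw [this, coeff_zsmul]
  simp only [cproj, cparity, coeff_proj, coeff_parity]
  split_ifs with h
  · rw [h]
  · simp

theorem cparity_cproj (p : ℤ) (f : CInf k D deg) : cparity (cproj p f) = sgn p • cproj p f := by
  refine Subtype.ext (FormalFn.ext fun e _ => ?_)
  have : ((sgn p • cproj p f : CInf k D deg) : FormalFn k D deg) = sgn p • (cproj p f).1 := by
    simp
  rw [this, coeff_zsmul]
  simp only [cproj, cparity, coeff_proj, coeff_parity]
  split_ifs with h
  · rw [h]
  · simp

end Smooth

/-! ### Morphisms -/

section Morphisms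
variable (k : Type*) [RCLike k]
variable {E : Type*} [NormedAddCommGroup E] [NormedSpace ℝ E] {D : Set E} {n : ℕ}
variable {E' : Type*} [NormedAddCommGroup E'] [NormedSpace ℝ E'] {D' : Set E'} {n' : ℕ}

/-- A morphism of graded domains `(D', deg') → (D, deg)`, given by the pull-back of functions: a
morphism of graded algebras. -/
structure GHom (D : Set E) (deg : Fin n → ℤ) (D' : Set E') (deg' : Fin n' → ℤ) where
  toAlgHom : CInf k D deg →ₐ[k] CInf k D' deg'
  map_proj : ∀ p f, toAlgHom (cproj p f) = cproj p (toAlgHom f)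

variable {k} {deg : Fin n → ℤ} {deg' : Fin n' → ℤ}

instance : CoeFun (GHom k D deg D' deg') (fun _ => CInf k D deg → CInf k D' deg') :=
  ⟨fun φ => φ.toAlgHom⟩

theorem GHom.map_parity (φ : GHom k D deg D' deg') (f : CInf k D deg) :
    φ (cparity f) = cparity (φ f) := by
  refine cproj_ext fun p => ?_
  rw [← φ.map_proj, cproj_cparity, cproj_cparity, ← φ.map_proj, map_zsmul]

/-- The infinitesimal displacement `φ + ε δ` of a morphism `φ` along a derivation `δ` of degree `1`
over `φ`; the parameter `ε` is the additional generator `z_q`, of degree `-1`. -/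
def GHom.displace (φ : GHom k D deg D' deg') (δ : CInf k D deg →ₗ[k] CInf k D' deg')
    (hmul : ∀ f g, δ (f * g) = δ f * φ g + cparity (φ f) * δ g)
    (hproj : ∀ p f, δ (cproj p f) = cproj (p + 1) (δ f))
    {deg'' : Fin (n' + 1) → ℤ} (q : Fin (n' + 1)) (h : ∀ i, deg'' (q.succAbove i) = deg' i)
    (hq : deg'' q = -1) : GHom k D deg D' deg'' :=
  have hodd : Odd (deg'' q) := by rw [hq]; exact ⟨-1, by norm_num⟩
  have h1 : δ 1 = 0 := by
    have := hmul 1 1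
    have hp : cparity (φ (1 : CInf k D deg)) = 1 := by
      rw [← φ.map_parity]
      have : cparity (1 : CInf k D deg) = 1 := by
        refine Subtype.ext (FormalFn.ext fun e _ => ?_)
        have h1 : ((1 : CInf k D deg) : FormalFn k D deg) = 1 := rfl
        simp only [cparity, coeff_parity, h1, coeff_one]
        split_ifs with h0
        · rw [h0, mdeg_zero]; simp [sgn]
        · simp
      rw [this, map_one]
    rw [hp, map_one φ.toAlgHom, one_mul, mul_one, one_mul] at this
    simpa using this
  have hone : cpush q h (1 : CInf k D' deg') = 1 := Subtype.ext (push_one h)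
  have hzero : cpush q h (0 : CInf k D' deg') = 0 := Subtype.ext (push_zero h)
  { toAlgHom := AlgHom.ofLinearMap
      { toFun := fun f => cpush q h (φ f) + cgen q * cpush q h (δ f)
        map_add' := fun f g => by
          rw [map_add, map_add, cpush_add, cpush_add, mul_add]; abel
        map_smul' := fun c f => by
          rw [map_smul, map_smul, cpush_smul, cpush_smul, mul_smul_comm, RingHom.id_apply,
            smul_add] }
      (by simp [h1, hone, hzero])
      (fun f g => by
        simp only [LinearMap.coe_mk, AddHom.coe_mk]
        rw [map_mul, hmul, cpush_add, cpush_mul, cpush_mul, cpush_mul, cpush_parity,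
          add_mul, mul_add, mul_add, mul_add]
        have e1 : cgen q * (cparity (cpush q h (φ f)) * cpush q h (δ g)) =
            cpush q h (φ f) * (cgen q * cpush q h (δ g)) := by
          have hpp : cparity (cparity (cpush q h (φ f))) = cpush q h (φ f) := by
            refine cproj_ext fun p => ?_
            rw [cproj_cparity, cproj_cparity, smul_smul, sgn_mul_self, one_smul]
          rw [← mul_assoc, cgen_mul hodd, hpp, mul_assoc]
        have e2 : cgen q * cpush q h (δ f) * (cgen q * cpush q h (δ g)) = 0 := by
          rw [cgen_mul hodd, mul_assoc, ← mul_assoc (cgen q), cgen_mul_self hodd, zero_mul,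
            mul_zero]
        rw [e1, e2, mul_assoc]
        abel)
    map_proj := fun p f => by
      simp only [AlgHom.ofLinearMap_apply, LinearMap.coe_mk, AddHom.coe_mk]
      rw [φ.map_proj, hproj, cproj_add, cpush_proj, cpush_proj]
      congr 1
      have := cproj_cgen_mul q (p + 1) (cpush q h (δ f))
      rw [hq] at this
      rw [← this]
      congr 1
      ring }

theorem GHom.displace_apply (φ : GHom k D deg D' deg') (δ : CInf k D deg →ₗ[k] CInf k D' deg')
    (hmul : ∀ f g, δ (f * g) = δ f * φ g + cparity (φ f) * δ g)
    (hproj : ∀ p f, δ (cproj p f) = cproj (p + 1) (δ f))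
    {deg'' : Fin (n' + 1) → ℤ} (q : Fin (n' + 1)) (h : ∀ i, deg'' (q.succAbove i) = deg' i)
    (hq : deg'' q = -1) (f : CInf k D deg) :
    φ.displace δ hmul hproj q h hq f = cpush q h (φ f) + cgen q * cpush q h (δ f) := rfl

end Morphisms

/-! ### Graded domains, NQ-charts, representations -/

/-- A graded domain: an open subset of some `ℝ^m` together with finitely many generators of nonzero
integer degrees. These are the local models of graded manifolds. -/
structure GDomain where
  m : ℕ
  body : Set (EuclideanSpace ℝ (Fin m))
  isOpen_body : IsOpen body
  n : ℕ
  deg : Fin n → ℤ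
  deg_ne : ∀ i, deg i ≠ 0

/-- The algebra of functions on a graded domain. -/
abbrev GDomain.C (k : Type*) [RCLike k] (L : GDomain) : Type _ := CInf k L.body L.deg

/-- The product of `L` with the odd line with coordinate `ε` of degree `-1` (the generator `0`). -/
abbrev GDomain.eps (L : GDomain) : GDomain where
  m := L.m
  body := L.body
  isOpen_body := L.isOpen_body
  n := L.n + 1
  deg := Fin.cons (-1) L.deg
  deg_ne := fun i => by
    refine Fin.cases ?_ (fun j => ?_) i
    · simp
    · simpa using L.deg_ne j

theorem GDomain.eps_deg (L : GDomain) (i : Fin L.n) :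
    L.eps.deg ((0 : Fin (L.n + 1)).succAbove i) = L.deg i := by
  simp

section
universe u
variable (k : Type u) [RCLike k]

/-- A coordinate patch of an NQ-manifold: a graded domain whose generators have positive degrees,
with a homological vector field `Q` of degree `1`. -/
structure NQChart extends GDomain where
  deg_pos : ∀ i, 0 < deg i
  Q : CInf k body deg →ₗ[k] CInf k body deg
  Q_proj : ∀ p f, Q (cproj p f) = cproj (p + 1) (Q f)
  Q_mul : ∀ f g, Q (f * g) = Q f * g + cparity f * Q g
  Q_sq : ∀ f, Q (Q f) = 0

/-- A representation of an NQ-chart on the trivial graded vector bundle with fibre coordinates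
`ζ_α` of degree `lev α`: the lift `Q̂ = Q + ∑ R^β_α ζ_β ∂/∂ζ_α` of `Q` has degree `1` and square
zero. Here `R β α` is `R^β_α`. -/
structure RepChart {ι : Type*} [Fintype ι] (lev : ι → ℤ) extends NQChart k where
  R : ι → ι → CInf k body deg
  R_homog : ∀ β α, FormalFn.IsHomog (1 + lev α - lev β) (R β α).1
  flat : ∀ β α, Q (R β α) +
    ∑ γ, sgn ((lev β + lev γ) * (1 + lev γ + lev α)) • (R β γ * R γ α) = 0

variable {k}

/-- The normalized representation matrix `T^β_α = (-1)^{αβ+β} R^β_α`. -/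
def RepChart.T {ι : Type*} [Fintype ι] {lev : ι → ℤ} (P : RepChart k lev) (β α : ι) :
    CInf k P.body P.deg := sgn (lev α * lev β + lev β) • P.R β α

theorem RepChart.T_homog {ι : Type*} [Fintype ι] {lev : ι → ℤ} (P : RepChart k lev) (β α : ι) :
    FormalFn.IsHomog (1 + lev α - lev β) (P.T β α).1 := by
  have : (P.T β α).1 = sgn (lev α * lev β + lev β) • (P.R β α).1 := by simp [RepChart.T]
  rw [this]
  exact (P.R_homog β α).zsmul _

/-! ### Superfields on `T[1][a,b] × L` -/

/-- The body `[a,b] × |L|` of `T[1][a,b] × L`. -/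
abbrev tube (a b : ℝ) (L : GDomain) : Set (ℝ × EuclideanSpace ℝ (Fin L.m)) := Set.Icc a b ×ˢ L.body

/-- The generators of `T[1][a,b] × L`: first `θ`, of degree `1`, then those of `L`. -/
def sdeg (L : GDomain) : Fin (L.n + 1) → ℤ := Fin.cons 1 L.deg

theorem sdeg_succAbove (L : GDomain) (i : Fin L.n) :
    sdeg L ((0 : Fin (L.n + 1)).succAbove i) = L.deg i := by simp [sdeg]

theorem sdeg_eps (L : GDomain) (i : Fin (L.n + 1)) :
    sdeg L.eps ((1 : Fin (L.n + 2)).succAbove i) = sdeg L i := by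
  refine Fin.cases ?_ (fun j => ?_) i
  · rfl
  · rw [show (1 : Fin (L.n + 2)) = (0 : Fin (L.n + 1)).succ from rfl, Fin.succ_succAbove_succ]
    simp [sdeg, GDomain.eps]

variable (k) in
/-- Functions on `T[1][a,b] × L`. -/
abbrev SuperField (a b : ℝ) (L : GDomain) : Type _ := CInf k (tube a b L) (sdeg L)

/-- `∂/∂t` on functions on `[a,b] × |L|`. -/
def dtFn {a b : ℝ} {L : GDomain} (f : tube a b L → k) : tube a b L → k := fun x =>
  fderivWithin ℝ (extZ f) (tube a b L) x.1 (1, 0)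

theorem uniqueDiffOn_tube {a b : ℝ} (hab : a < b) (L : GDomain) :
    UniqueDiffOn ℝ (tube a b L) :=
  (uniqueDiffOn_Icc hab).prod L.isOpen_body.uniqueDiffOn

section dt
variable {a b : ℝ} (hab : a < b) {L : GDomain}

theorem IsSmooth.dtFn {f : tube a b L → k} (hab : a < b) (hf : IsSmooth f) :
    IsSmooth (WilsonLine.dtFn f) := by
  have h1 : ContDiffOn ℝ ∞ (fderivWithin ℝ (extZ f) (tube a b L)) (tube a b L) :=
    hf.fderivWithin (uniqueDiffOn_tube hab L) (by simp)
  refine (h1.clm_apply (contDiffOn_const (c := ((1, 0) : ℝ × EuclideanSpace ℝ (Fin L.m))))).congr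
    fun x hx => ?_
  rw [extZ_apply _ hx]
  rfl

theorem IsSmooth.diff {f : tube a b L → k} (hf : IsSmooth f) (x : tube a b L) :
    DifferentiableWithinAt ℝ (extZ f) (tube a b L) x.1 :=
  (ContDiffOn.differentiableOn hf (by simp)) x.1 x.2

theorem dtFn_zero : dtFn (0 : tube a b L → k) = 0 := by
  funext x
  simp [dtFn, extZ_zero]

theorem dtFn_add (hab : a < b) {f g : tube a b L → k} (hf : IsSmooth f) (hg : IsSmooth g) :
    dtFn (f + g) = dtFn f + dtFn g := by
  funext x
  have hu := uniqueDiffOn_tube hab L x.1 x.2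
  simp only [dtFn, extZ_add, Pi.add_apply]
  rw [fderivWithin_add hu (hf.diff x) (hg.diff x)]
  rfl

theorem dtFn_smul (hab : a < b) {f : tube a b L → k} (c : k) (hf : IsSmooth f) :
    dtFn (c • f) = c • dtFn f := by
  funext x
  have hu := uniqueDiffOn_tube hab L x.1 x.2
  simp only [dtFn, extZ_smul, Pi.smul_apply]
  rw [fderivWithin_const_smul hu (hf.diff x)]
  rfl

theorem dtFn_mul (hab : a < b) {f g : tube a b L → k} (hf : IsSmooth f) (hg : IsSmooth g) :
    dtFn (f * g) = dtFn f * g + f * dtFn g := by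
  funext x
  have hu := uniqueDiffOn_tube hab L x.1 x.2
  simp only [dtFn, extZ_mul, Pi.add_apply, Pi.mul_apply]
  rw [fderivWithin_mul hu (hf.diff x) (hg.diff x)]
  simp [extZ_apply _ x.2]
  ring

theorem dtFn_zsmul (hab : a < b) {f : tube a b L → k} (c : ℤ) (hf : IsSmooth f) :
    dtFn (c • f) = c • dtFn f := by
  have : ∀ g : tube a b L → k, c • g = (c : k) • g := fun g => by ext x; simp
  rw [this, this, dtFn_smul hab _ hf]

theorem dtFn_sum (hab : a < b) {κ : Type*} (s : Finset κ) {f : κ → tube a b L → k}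
    (hf : ∀ i, IsSmooth (f i)) : dtFn (∑ i ∈ s, f i) = ∑ i ∈ s, dtFn (f i) := by
  classical
  induction s using Finset.induction_on with
  | empty => simp [dtFn_zero]
  | insert i s hi ih =>
    rw [Finset.sum_insert hi, Finset.sum_insert hi, dtFn_add hab (hf i) (IsSmooth.sum fun j _ => hf j),
      ih]

/-- `∂/∂t` on superfields. -/
def dt (f : SuperField k a b L) : SuperField k a b L :=
  ⟨mapCoeff dtFn f.1, fun e => by
    rw [coeff_mapCoeff dtFn_zero]; exact (f.2 e).dtFn hab⟩

theorem dt_add (f g : SuperField k a b L) : dt hab (f + g) = dt hab f + dt hab g := by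
  refine Subtype.ext (FormalFn.ext fun e _ => ?_)
  change (mapCoeff dtFn (f.1 + g.1)).coeff e = (mapCoeff dtFn f.1 + mapCoeff dtFn g.1).coeff e
  rw [coeff_add]
  simp only [coeff_mapCoeff dtFn_zero, coeff_add]
  exact dtFn_add hab (f.2 e) (g.2 e)

theorem dt_smul (c : k) (f : SuperField k a b L) : dt hab (c • f) = c • dt hab f := by
  refine Subtype.ext (FormalFn.ext fun e _ => ?_)
  change (mapCoeff dtFn (c • f.1)).coeff e = (c • mapCoeff dtFn f.1).coeff e
  rw [coeff_smul]
  simp only [coeff_mapCoeff dtFn_zero, coeff_smul]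
  exact dtFn_smul hab c (f.2 e)

theorem dt_mul (f g : SuperField k a b L) : dt hab (f * g) = dt hab f * g + f * dt hab g := by
  refine Subtype.ext (FormalFn.ext fun e he => ?_)
  change (mapCoeff dtFn (f.1 * g.1)).coeff e =
    (mapCoeff dtFn f.1 * g.1 + f.1 * mapCoeff dtFn g.1).coeff e
  rw [coeff_add, coeff_mapCoeff dtFn_zero, coeff_mul _ _ he, coeff_mul _ _ he, coeff_mul _ _ he,
    dtFn_sum hab _ fun p => ((f.2 _).mul (g.2 _)).zsmul _, ← Finset.sum_add_distrib]
  refine Finset.sum_congr rfl fun p _ => ?_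
  rw [dtFn_zsmul hab _ ((f.2 _).mul (g.2 _)), dtFn_mul hab (f.2 _) (g.2 _), smul_add,
    coeff_mapCoeff dtFn_zero, coeff_mapCoeff dtFn_zero]

theorem dt_proj (p : ℤ) (f : SuperField k a b L) : dt hab (cproj p f) = cproj p (dt hab f) := by
  refine Subtype.ext (FormalFn.ext fun e _ => ?_)
  change (mapCoeff dtFn (proj p f.1)).coeff e = (proj p (mapCoeff dtFn f.1)).coeff e
  rw [coeff_mapCoeff dtFn_zero, coeff_proj, coeff_proj, coeff_mapCoeff dtFn_zero]
  split_ifs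
  · rfl
  · exact dtFn_zero

/-- The de Rham differential `D = θ ∂/∂t` of `T[1][a,b]`, acting on superfields. -/
def deRham : SuperField k a b L →ₗ[k] SuperField k a b L where
  toFun f := cgen 0 * dt hab f
  map_add' f g := by rw [dt_add, mul_add]
  map_smul' c f := by rw [dt_smul, mul_smul_comm, RingHom.id_apply]

theorem sdeg_zero_odd (L : GDomain) : Odd (sdeg L 0) := ⟨0, by simp [sdeg]⟩

theorem deRham_mul (f g : SuperField k a b L) :
    deRham hab (f * g) = deRham hab f * g + cparity f * deRham hab g := by
  change cgen 0 * dt hab (f * g) = cgen 0 * dt hab f * g + cparity f * (cgen 0 * dt hab g)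
  rw [dt_mul, mul_add, mul_assoc, ← mul_assoc (cparity f), ← cgen_mul (sdeg_zero_odd L), mul_assoc]

theorem deRham_proj (p : ℤ) (f : SuperField k a b L) :
    deRham hab (cproj p f) = cproj (p + 1) (deRham hab f) := by
  change cgen 0 * dt hab (cproj p f) = cproj (p + 1) (cgen 0 * dt hab f)
  rw [dt_proj, ← cproj_cgen_mul]
  congr 1
  simp [sdeg, add_comm]

end dt

/-- The value at `t`, `θ = 0` of a superfield, a function on `L`. -/
def evalAt {a b : ℝ} {L : GDomain} (t : ℝ) (ht : t ∈ Set.Icc a b) (f : SuperField k a b L) :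
    L.C k :=
  ⟨mapCoeff (fun g v => g ⟨(t, v.1), ht, v.2⟩) (kill 0 f.1), fun e => by
    rw [coeff_mapCoeff rfl, coeff_kill (sdeg_succAbove L)]
    have h1 : ContDiffOn ℝ ∞ (fun v : EuclideanSpace ℝ (Fin L.m) => (t, v)) L.body :=
      contDiffOn_const.prodMk contDiffOn_id
    refine (ContDiffOn.comp (f.2 (ins 0 0 e)) h1 fun v hv => ⟨ht, hv⟩).congr fun v hv => ?_
    rw [extZ_apply _ hv, Function.comp_apply, extZ_apply _ (show (t, v) ∈ tube a b L from ⟨ht, hv⟩)]⟩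

theorem coeff_evalAt {a b : ℝ} {L : GDomain} (t : ℝ) (ht : t ∈ Set.Icc a b)
    (f : SuperField k a b L) (e : Fin L.n →₀ ℕ) (v : L.body) :
    (evalAt t ht f).1.coeff e v = f.1.coeff (ins 0 0 e) ⟨(t, v.1), ht, v.2⟩ := by
  rw [evalAt, coeff_mapCoeff rfl, coeff_kill (sdeg_succAbove L)]

section evalAt
variable {a b : ℝ} {L : GDomain} (t : ℝ) (ht : t ∈ Set.Icc a b)

theorem evalAt_add (f g : SuperField k a b L) :
    evalAt t ht (f + g) = evalAt t ht f + evalAt t ht g := by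
  refine Subtype.ext (FormalFn.ext fun e _ => funext fun v => ?_)
  change _ = ((evalAt t ht f).1 + (evalAt t ht g).1).coeff e v
  rw [coeff_add, Pi.add_apply]
  simp only [coeff_evalAt]
  rfl

theorem evalAt_mul (f g : SuperField k a b L) :
    evalAt t ht (f * g) = evalAt t ht f * evalAt t ht g := by
  refine Subtype.ext (FormalFn.ext fun e he => funext fun v => ?_)
  change _ = ((evalAt t ht f).1 * (evalAt t ht g).1).coeff e v
  rw [coeff_mul _ _ he, coeff_evalAt]
  change (f.1 * g.1).coeff _ _ = _
  rw [coeff_mul _ _ ((adm_ins_zero (sdeg_succAbove L) _).2 he), sum_antidiagonal_ins,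
    Finset.sum_apply, Finset.sum_apply]
  refine Finset.sum_congr rfl fun x _ => ?_
  simp only [Pi.smul_apply, Pi.mul_apply, coeff_evalAt, swap_ins_zero (sdeg_succAbove L)]

theorem evalAt_cgen_zero : evalAt t ht (cgen 0 : SuperField k a b L) = 0 := by
  refine Subtype.ext (FormalFn.ext fun e _ => funext fun v => ?_)
  rw [coeff_evalAt, cgen, coeff_gen, if_neg]
  · rfl
  · intro h
    have := DFunLike.congr_fun h 0
    simp at this

theorem evalAt_deRham (hab : a < b) (f : SuperField k a b L) :
    evalAt t ht (deRham hab f) = 0 := by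
  change evalAt t ht (cgen 0 * dt hab f) = 0
  rw [evalAt_mul, evalAt_cgen_zero, zero_mul]

theorem evalAt_cgen_one :
    evalAt t ht (cgen 1 : SuperField k a b L.eps) = cgen (0 : Fin (L.n + 1)) := by
  refine Subtype.ext ?_
  have : kill 0 (gen (1 : Fin (L.n + 2)) : FormalFn k (tube a b L.eps) (sdeg L.eps)) =
      (gen (0 : Fin (L.n + 1)) : FormalFn k (tube a b L.eps) L.eps.deg) :=
    kill_gen_succ (sdeg_succAbove L.eps) 0
  refine FormalFn.ext fun e _ => funext fun v => ?_
  have h2 := congrArg (fun u => FormalFn.coeff u e) this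
  simp only [coeff_kill (sdeg_succAbove L.eps)] at h2
  rw [coeff_evalAt]
  refine (congrFun h2 _).trans ?_
  rw [coeff_gen]
  change _ = (gen (0 : Fin (L.n + 1)) : FormalFn k L.eps.body L.eps.deg).coeff e v
  rw [coeff_gen]
  split_ifs <;> rfl

theorem evalAt_cpush (f : SuperField k a b L) :
    evalAt t ht (cpush (deg' := sdeg L.eps) 1 (sdeg_eps L) f : SuperField k a b L.eps) =
      cpush (deg' := L.eps.deg) 0 L.eps_deg (evalAt t ht f) := by
  refine Subtype.ext (FormalFn.ext fun e _ => funext fun v => ?_)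
  rw [coeff_evalAt]
  change (push 1 f.1 : FormalFn k (tube a b L) (sdeg L.eps)).coeff _ _ =
    (push 0 (evalAt t ht f).1 : FormalFn k L.body L.eps.deg).coeff e v
  rw [coeff_push (sdeg_eps L), coeff_push L.eps_deg]
  have h1 : ins 0 0 e (1 : Fin (L.n + 2)) = e (0 : Fin (L.n + 1)) := by
    rw [show (1 : Fin (L.n + 2)) = (0 : Fin (L.n + 2)).succAbove 0 from rfl, ins_succAbove]
  have h2 : del (1 : Fin (L.n + 2)) (ins 0 0 e) = ins 0 0 (del (0 : Fin (L.n + 1)) e) := by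
    ext i
    refine Fin.cases ?_ (fun j => ?_) i
    · rw [del_apply]
      have : (1 : Fin (L.n + 2)).succAbove 0 = 0 := by simp
      rw [this, ins_same, ins_same]
    · rw [del_apply, show (1 : Fin (L.n + 2)) = (0 : Fin (L.n + 1)).succ from rfl,
        Fin.succ_succAbove_succ]
      have e1 := ins_succAbove (0 : Fin (L.n + 2)) 0 e ((0 : Fin (L.n + 1)).succAbove j)
      have e2 := ins_succAbove (0 : Fin (L.n + 1)) 0 (del (0 : Fin (L.n + 1)) e) j
      rw [del_apply] at e2
      rw [Fin.zero_succAbove] at e1 e2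
      rw [e1, e2, Fin.zero_succAbove]
  rw [h1, h2]
  split_ifs
  · rw [coeff_evalAt]
  · rfl

end evalAt

/-! ### The space of super-curves and the BRST differential -/

universe w

/-- A space of fields, given through its points with values in the graded domains `L`, together with
a vector field of degree `1`: it displaces a point `p` with values in `L` to the point `p + ε δp`
with values in `L × {ε}`, `ε` of degree `-1`. -/
structure FieldSpace where
  Pt : GDomain → Type w
  displace : ∀ L, Pt L → Pt L.eps

variable (k) in
/-- Functions on a space of fields: they assign to each point with values in `L` a function on `L`
(a formal function with coefficients on the body of `L`). Sums and products are pointwise. -/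
abbrev FieldSpace.Fn (X : FieldSpace.{w}) : Type _ :=
  ∀ L : GDomain, X.Pt L → FormalFn k L.body L.deg

/-- The action of the vector field on functions: `F(p + ε δp) = F(p) + ε (δ_B F)(p)`. -/
def FieldSpace.deltaB (X : FieldSpace.{w}) (F : X.Fn k) : X.Fn k :=
  fun L p => leftCoeff (F L.eps (X.displace L p))

/-- A super-curve with values in `L`: a morphism `T[1][a,b] × L → 𝓜`. -/
abbrev SuperCurve (P : NQChart k) (a b : ℝ) (L : GDomain) : Type _ :=
  GHom k P.body P.deg (tube a b L) (sdeg L)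

/-- The BRST variation of a super-curve, `f ↦ (Q f)(𝒙) - D (f(𝒙))`; on coordinates this is
`δ_B 𝒙^A = Q^A(𝒙) - D 𝒙^A`. -/
def SuperCurve.brst {P : NQChart k} {a b : ℝ} (hab : a < b) {L : GDomain}
    (φ : SuperCurve P a b L) : P.C k →ₗ[k] SuperField k a b L :=
  φ.toAlgHom.toLinearMap ∘ₗ P.Q - deRham hab ∘ₗ φ.toAlgHom.toLinearMap

/-- The displaced super-curve `φ + ε δ_B φ`. -/
def SuperCurve.displace {P : NQChart k} {a b : ℝ} (hab : a < b) {L : GDomain}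
    (φ : SuperCurve P a b L) : SuperCurve P a b L.eps :=
  GHom.displace φ (φ.brst hab)
    (fun f g => by
      have h1 : ∀ f, φ.brst hab f = φ (P.Q f) - deRham hab (φ f) := fun _ => rfl
      rw [h1, h1, h1, P.Q_mul, map_add, map_mul, map_mul, map_mul, deRham_mul, φ.map_parity,
        sub_mul, mul_sub]
      abel)
    (fun p f => by
      have h1 : ∀ f, φ.brst hab f = φ (P.Q f) - deRham hab (φ f) := fun _ => rfl
      have h2 : ∀ f g : SuperField k a b L,
          cproj (p + 1) (f - g) = cproj (p + 1) f - cproj (p + 1) g := fun f g => by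
        rw [eq_sub_iff_add_eq, ← cproj_add, sub_add_cancel]
      rw [h1, h1, P.Q_proj, φ.map_proj, φ.map_proj, deRham_proj, h2])
    1 (sdeg_eps L) rfl

/-- The space of super-curves `T[1][a,b] → 𝓜` with the BRST differential. -/
def curveSpace (P : NQChart k) {a b : ℝ} (hab : a < b) : FieldSpace.{u} where
  Pt := SuperCurve P a b
  displace := fun _ φ => φ.displace hab

theorem evalAt_displace {P : NQChart k} {a b : ℝ} (hab : a < b) {L : GDomain}
    (φ : SuperCurve P a b L) (t : ℝ) (ht : t ∈ Set.Icc a b) (f : P.C k) :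
    evalAt t ht (φ.displace hab f) =
      cpush 0 L.eps_deg (evalAt t ht (φ f)) +
        cgen 0 * cpush 0 L.eps_deg (evalAt t ht (φ (P.Q f))) := by
  have h0 : φ.displace hab f = cpush 1 (sdeg_eps L) (φ f) +
    cgen 1 * cpush 1 (sdeg_eps L) (φ.brst hab f) := rfl
  have h1 : φ.brst hab f = φ (P.Q f) - deRham hab (φ f) := rfl
  have h2 : evalAt t ht (φ.brst hab f) = evalAt t ht (φ (P.Q f)) := by
    rw [h1]
    have := evalAt_add t ht (φ (P.Q f) - deRham hab (φ f)) (deRham hab (φ f))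
    rw [sub_add_cancel, evalAt_deRham, add_zero] at this
    exact this.symm
  rw [h0, evalAt_add, evalAt_mul, evalAt_cgen_one, evalAt_cpush, evalAt_cpush, h2]

/-! ### The Wilson line -/

section Wilson
variable {ι : Type*} [Fintype ι] [DecidableEq ι] {lev : ι → ℤ}

/-- `f ↦ ∫_a^t f dt`, on formal functions on `[a,b] × L`. -/
def primitive {a b : ℝ} {L : GDomain} (f : FormalFn k (tube a b L) L.deg) :
    FormalFn k (tube a b L) L.deg :=
  mapCoeff (fun g x => ∫ s in a..x.1.1, extZ g (s, x.1.2)) f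

/-- The iterated integrals `∫_a^t dt_1 A(t_1) ∫_a^{t_1} dt_2 A(t_2) ⋯ ∫_a^{t_{q-1}} dt_q A(t_q)`. -/
def iterInt {a b : ℝ} {L : GDomain} (A : Matrix ι ι (FormalFn k (tube a b L) L.deg)) :
    ℕ → Matrix ι ι (FormalFn k (tube a b L) L.deg)
  | 0 => 1
  | q + 1 => (A * iterInt A q).map primitive

/-- The matrix `∂_θ 𝑻 |_{θ=0}` along a super-curve. -/
def thetaT (P : RepChart k lev) {a b : ℝ} {L : GDomain} (φ : SuperCurve P.toNQChart a b L) :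
    Matrix ι ι (FormalFn k (tube a b L) L.deg) :=
  Matrix.of fun α β => leftCoeff (φ (P.T α β)).1

/-- The term of order `q` of `ℙ exp (-∫ dt dθ 𝑻)`: the coefficient of the monomial `z^e` at the point
`v` of the body of `L`. -/
def wilsonTerm (P : RepChart k lev) {a b : ℝ} (hab : a < b) {L : GDomain}
    (φ : SuperCurve P.toNQChart a b L) (α β : ι) (e : Fin L.n →₀ ℕ) (v : L.body) (q : ℕ) : k :=
  (-1) ^ q * (iterInt (thetaT P φ) q α β).coeff e ⟨(b, v.1), Set.right_mem_Icc.2 hab.le, v.2⟩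

/-- The Wilson line `U(b,a) = ℙ exp (-∫_a^b dt dθ 𝑻)` of a super-curve in a patch. -/
def wilson (P : RepChart k lev) {a b : ℝ} (hab : a < b) {L : GDomain}
    (φ : SuperCurve P.toNQChart a b L) : Matrix ι ι (FormalFn k L.body L.deg) :=
  Matrix.of fun α β => FormalFn.mk fun e v => ∑' q, wilsonTerm P hab φ α β e v q

/-- The representation matrix at the time `t`, `T(𝒙(t,θ))|_{θ=0}`. -/
def repAt (P : RepChart k lev) {a b : ℝ} (t : ℝ) (ht : t ∈ Set.Icc a b) {L : GDomain}
    (φ : SuperCurve P.toNQChart a b L) (α β : ι) : L.C k := evalAt t ht (φ (P.T α β))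

theorem GHom.map_homog {E : Type*} [NormedAddCommGroup E] [NormedSpace ℝ E] {D : Set E} {n : ℕ}
    {E' : Type*} [NormedAddCommGroup E'] [NormedSpace ℝ E'] {D' : Set E'} {n' : ℕ}
    {deg : Fin n → ℤ} {deg' : Fin n' → ℤ} (φ : GHom k D deg D' deg') {p : ℤ} {f : CInf k D deg}
    (hf : IsHomog p f.1) : IsHomog p (φ f).1 := by
  have h1 : cproj p f = f := Subtype.ext (isHomog_iff.1 hf)
  have h2 := φ.map_proj p f
  rw [h1] at h2
  exact isHomog_iff.2 (congrArg Subtype.val h2).symm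

theorem evalAt_homog {a b : ℝ} {L : GDomain} (t : ℝ) (ht : t ∈ Set.Icc a b) {p : ℤ}
    {f : SuperField k a b L} (hf : IsHomog p f.1) : IsHomog p (evalAt t ht f).1 := by
  intro e he
  funext v
  rw [coeff_evalAt, hf]
  · rfl
  · rw [mdeg_ins (sdeg_succAbove L)]
    simpa using he

theorem repAt_homog (P : RepChart k lev) {a b : ℝ} (t : ℝ) (ht : t ∈ Set.Icc a b) {L : GDomain}
    (φ : SuperCurve P.toNQChart a b L) (α β : ι) :
    IsHomog (1 + lev β - lev α) (repAt P t ht φ α β).1 :=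
  evalAt_homog t ht (φ.map_homog (P.T_homog α β))

/-! ### Including the fibre coordinates over the two end points -/

/-- Points of the bundle of fibre coordinates over a space of fields `X`: a point of `X`, fibre
coordinates `ζ_α` of degree `lev α` (of `𝓔` over the final point) and dual fibre coordinates `ζ^α`
of degree `-lev α` (of `𝓔^*` over the initial point). -/
structure EndPt (k : Type u) [RCLike k] (lev : ι → ℤ) (X : FieldSpace.{w}) (L : GDomain) where
  base : X.Pt L
  low : ι → L.C k
  up : ι → L.C k
  low_homog : ∀ α, IsHomog (lev α) (low α).1
  up_homog : ∀ α, IsHomog (-lev α) (up α).1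

theorem cpush_homog {L : GDomain} {p : ℤ} {f g : L.C k} (hf : IsHomog p f.1)
    (hg : IsHomog (p + 1) g.1) :
    IsHomog p (cpush (deg' := L.eps.deg) 0 L.eps_deg f +
      cgen 0 * cpush (deg' := L.eps.deg) 0 L.eps_deg g).1 := by
  have h1 : IsHomog p (push 0 f.1 : FormalFn k L.body L.eps.deg) := isHomog_push L.eps_deg hf
  have h2 : IsHomog (p + 1) (push 0 g.1 : FormalFn k L.body L.eps.deg) :=
    isHomog_push L.eps_deg hg
  have h3 : IsHomog (-1) (gen 0 : FormalFn k L.body L.eps.deg) := isHomog_gen 0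
  have h4 := h3.mul h2
  rw [show -1 + (p + 1) = p by ring] at h4
  exact h1.add h4

/-- The space of fields and fibre coordinates: the vector field is extended by
`δ_B ζ_α = (-1)^β ζ_β T^β_α(1)` and `δ_B ζ^α = -T^α_β(0) ζ^β`, where `T1` and `T0` are the
representation matrices at the final and at the initial point. -/
def endSpace (k : Type u) [RCLike k] (lev : ι → ℤ) (X : FieldSpace.{w})
    (T1 T0 : ∀ L, X.Pt L → ι → ι → L.C k)
    (h1 : ∀ L p α β, IsHomog (1 + lev β - lev α) (T1 L p α β).1)
    (h0 : ∀ L p α β, IsHomog (1 + lev β - lev α) (T0 L p α β).1) : FieldSpace where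
  Pt := fun L => EndPt k lev X L
  displace := fun L p =>
    { base := X.displace L p.base
      low := fun α => cpush 0 L.eps_deg (p.low α) +
        cgen 0 * cpush 0 L.eps_deg (∑ β, sgn (lev β) • (p.low β * T1 L p.base β α))
      up := fun α => cpush 0 L.eps_deg (p.up α) +
        cgen 0 * cpush 0 L.eps_deg (-∑ β, T0 L p.base α β * p.up β)
      low_homog := fun α => cpush_homog (p.low_homog α) (by
        have : (∑ β, sgn (lev β) • (p.low β * T1 L p.base β α) : L.C k).1 =
            ∑ β, sgn (lev β) • ((p.low β).1 * (T1 L p.base β α).1) := by simp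
        rw [this]
        refine IsHomog.sum fun β _ => IsHomog.zsmul _ ?_
        have := (p.low_homog β).mul (h1 L p.base β α)
        rwa [show lev β + (1 + lev α - lev β) = lev α + 1 by ring] at this)
      up_homog := fun α => cpush_homog (p.up_homog α) (by
        have : (-∑ β, T0 L p.base α β * p.up β : L.C k).1 =
            (-1 : ℤ) • ∑ β, (T0 L p.base α β).1 * (p.up β).1 := by simp
        rw [this]
        refine IsHomog.zsmul _ (IsHomog.sum fun β _ => ?_)
        have := (h0 L p.base α β).mul (p.up_homog β)
        rwa [show 1 + lev β - lev α + -lev β = -lev α + 1 by ring] at this) }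

/-- `U_C = ζ_α U^α_β ζ^β`, for a matrix `U` of functions of the fields. -/
def contract {X : FieldSpace.{w}} (U : ∀ L, X.Pt L → Matrix ι ι (FormalFn k L.body L.deg))
    (L : GDomain) (p : EndPt k lev X L) : FormalFn k L.body L.deg :=
  ∑ α, ∑ β, (p.low α).1 * U L p.base α β * (p.up β).1

/-! ### Closed super-curves -/

/-- The space of closed super-curves, i.e. super-curves `T[1][0,1] × L → 𝓜` whose values at `t = 0`
and `t = 1` (and `θ = 0`) coincide. -/
def closedCurveSpace (P : NQChart k) : FieldSpace.{u} where
  Pt := fun L => {φ : SuperCurve P 0 1 L // ∀ f : P.C k,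
    evalAt 0 (Set.left_mem_Icc.2 zero_le_one) (φ f) =
      evalAt 1 (Set.right_mem_Icc.2 zero_le_one) (φ f)}
  displace := fun L φ => ⟨φ.1.displace zero_lt_one, fun f => by
    rw [evalAt_displace, evalAt_displace, φ.2, φ.2]⟩

end Wilson

/-! ### Splicing Wilson lines over several patches -/

section Splice
variable {ι : Type*} [Fintype ι] [DecidableEq ι]

/-- Overlap of two patches `P` and `P'` and the transition function between the trivializations over
them: `ζ'_α = ζ_β Ω^β_α`. The invertible matrix `Ω` intertwines the two lifts of `Q`, i.e.
`(-1)^γ Q Ω^γ_α + (-1)^γ T^γ_β Ω^β_α = (-1)^β Ω^γ_β T'^β_α`. -/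
structure Transition {lev : ι → ℤ} (P P' : RepChart k lev) where
  ovl : NQChart k
  res : GHom k P.body P.deg ovl.body ovl.deg
  res' : GHom k P'.body P'.deg ovl.body ovl.deg
  res_Q : ∀ f, res (P.Q f) = ovl.Q (res f)
  res_Q' : ∀ f, res' (P'.Q f) = ovl.Q (res' f)
  Ω : Matrix ι ι (CInf k ovl.body ovl.deg)
  Ω_homog : ∀ β α, IsHomog (lev α - lev β) (Ω β α).1
  Ω_unit : IsUnit Ω
  gauge : ∀ γ α, sgn (lev γ) • ovl.Q (Ω γ α) + ∑ β, sgn (lev γ) • (res (P.T γ β) * Ω β α) =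
    ∑ β, sgn (lev β) • (Ω γ β * res' (P'.T β α))

variable (k) in
/-- A partition `0 = t_0 < t_1 < ⋯ < t_{N+1} = 1` of `[0,1]`, a patch for each of the `N + 1`
subintervals, and transition functions between consecutive ones. -/
structure PatchChain (lev : ι → ℤ) where
  N : ℕ
  P : Fin (N + 1) → RepChart k lev
  tr : ∀ i : Fin N, Transition (P i.succ) (P i.castSucc)
  t : Fin (N + 2) → ℝ
  t_mono : StrictMono t
  t_zero : t 0 = 0
  t_last : t (Fin.last (N + 1)) = 1

variable {lev : ι → ℤ}

theorem PatchChain.lt (c : PatchChain k lev) (i : Fin (c.N + 1)) :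
    c.t i.castSucc < c.t i.succ := c.t_mono Fin.castSucc_lt_succ

/-- The displacement of a point of an overlap along `Q`. -/
def displacePt {O : NQChart k} {L : GDomain} (ψ : GHom k O.body O.deg L.body L.deg) :
    GHom k O.body O.deg L.eps.body L.eps.deg :=
  GHom.displace ψ (ψ.toAlgHom.toLinearMap ∘ₗ O.Q)
    (fun f g => by
      have h1 : ∀ f, (ψ.toAlgHom.toLinearMap ∘ₗ O.Q) f = ψ (O.Q f) := fun _ => rfl
      rw [h1, h1, h1, O.Q_mul, map_add, map_mul, map_mul, ψ.map_parity])
    (fun p f => by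
      have h1 : ∀ f, (ψ.toAlgHom.toLinearMap ∘ₗ O.Q) f = ψ (O.Q f) := fun _ => rfl
      rw [h1, h1, O.Q_proj, ψ.map_proj])
    0 L.eps_deg rfl

theorem displacePt_apply {O : NQChart k} {L : GDomain} (ψ : GHom k O.body O.deg L.body L.deg)
    (f : O.C k) : displacePt ψ f = cpush 0 L.eps_deg (ψ f) + cgen 0 * cpush 0 L.eps_deg (ψ (O.Q f)) :=
  rfl

/-- A super-curve running through the patches of a chain: a super-curve in each patch, and for each
junction a point of the overlap which is the final point of the earlier piece (in the earlier patch)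
and the initial point of the later piece (in the later patch). -/
structure ChainPt (c : PatchChain k lev) (L : GDomain) where
  piece : ∀ i : Fin (c.N + 1), SuperCurve (c.P i).toNQChart (c.t i.castSucc) (c.t i.succ) L
  junc : ∀ i : Fin c.N, GHom k (c.tr i).ovl.body (c.tr i).ovl.deg L.body L.deg
  junc_later : ∀ i f, junc i ((c.tr i).res f) =
    evalAt _ (Set.left_mem_Icc.2 (c.lt i.succ).le) (piece i.succ f)
  junc_earlier : ∀ i f, junc i ((c.tr i).res' f) =
    evalAt _ (Set.right_mem_Icc.2 (c.lt i.castSucc).le) (piece i.castSucc f)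

/-- The displaced super-curve. -/
def ChainPt.displace {c : PatchChain k lev} {L : GDomain} (x : ChainPt c L) : ChainPt c L.eps where
  piece := fun i => (x.piece i).displace (c.lt i)
  junc := fun i => displacePt (x.junc i)
  junc_later := fun i f => by
    rw [evalAt_displace, displacePt_apply, ← (c.tr i).res_Q, x.junc_later, x.junc_later]
  junc_earlier := fun i f => by
    rw [evalAt_displace, displacePt_apply, ← (c.tr i).res_Q', x.junc_earlier, x.junc_earlier]

/-- The space of super-curves through the patches of a chain, with the BRST differential. -/
def chainSpace (c : PatchChain k lev) : FieldSpace.{u} where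
  Pt := ChainPt c
  displace := fun _ x => x.displace

/-- The spliced Wilson line
`U_N(1,t_N) Ω_{N-1}(t_N) U_{N-1}(t_N,t_{N-1}) ⋯ Ω_0(t_1) U_0(t_1,0)`. -/
def splicedWilson (c : PatchChain k lev) {L : GDomain} (x : ChainPt c L) :
    Matrix ι ι (FormalFn k L.body L.deg) :=
  Fin.induction (motive := fun _ => Matrix ι ι (FormalFn k L.body L.deg))
    (wilson (c.P 0) (c.lt 0) (x.piece 0))
    (fun i U => wilson (c.P i.succ) (c.lt i.succ) (x.piece i.succ) *
      ((c.tr i).Ω.map fun f => (x.junc i f).1) * U)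
    (Fin.last c.N)

/-- The representation matrix at the final point, in the last patch. -/
def chainRep1 (c : PatchChain k lev) (L : GDomain) (x : ChainPt c L) (α β : ι) : L.C k :=
  repAt (c.P (Fin.last c.N)) _ (Set.right_mem_Icc.2 (c.lt _).le) (x.piece (Fin.last c.N)) α β

/-- The representation matrix at the initial point, in the first patch. -/
def chainRep0 (c : PatchChain k lev) (L : GDomain) (x : ChainPt c L) (α β : ι) : L.C k :=
  repAt (c.P 0) _ (Set.left_mem_Icc.2 (c.lt _).le) (x.piece 0) α β

variable (k) in
/-- A chain of patches that closes up: there is also a transition function from the last patch to the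
first one. -/
structure ClosedChain (lev : ι → ℤ) extends PatchChain k lev where
  closing : Transition (P 0) (P (Fin.last N))

/-- A closed super-curve through the patches of a closed chain. -/
structure ClosedChainPt (c : ClosedChain k lev) (L : GDomain) extends ChainPt c.toPatchChain L where
  base : GHom k c.closing.ovl.body c.closing.ovl.deg L.body L.deg
  base_later : ∀ f, base (c.closing.res f) =
    evalAt _ (Set.left_mem_Icc.2 (c.lt 0).le) (piece 0 f)
  base_earlier : ∀ f, base (c.closing.res' f) =
    evalAt _ (Set.right_mem_Icc.2 (c.lt (Fin.last c.N)).le) (piece (Fin.last c.N) f)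

/-- The space of closed super-curves through the patches of a closed chain. -/
def closedChainSpace (c : ClosedChain k lev) : FieldSpace.{u} where
  Pt := ClosedChainPt c
  displace := fun _ x =>
    { x.toChainPt.displace with
      base := displacePt x.base
      base_later := fun f => by
        change _ = evalAt _ _ ((x.piece 0).displace (c.lt 0) f)
        rw [evalAt_displace, displacePt_apply, ← c.closing.res_Q, x.base_later, x.base_later]
      base_earlier := fun f => by
        change _ = evalAt _ _ ((x.piece _).displace (c.lt (Fin.last c.N)) f)
        rw [evalAt_displace, displacePt_apply, ← c.closing.res_Q', x.base_earlier,
          x.base_earlier] }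

/-- The spliced Wilson line of a closed super-curve, from the trivialization over the first patch
back to itself. -/
def closedWilson (c : ClosedChain k lev) {L : GDomain} (x : ClosedChainPt c L) :
    Matrix ι ι (FormalFn k L.body L.deg) :=
  (c.closing.Ω.map fun f => (x.base f).1) * splicedWilson c.toPatchChain x.toChainPt

end Splice

end

end

end WilsonLine

open WilsonLine

namespace WilsonLine

noncomputable section

open FormalFn

universe u w

/-! ### Functions of one additional odd generator -/

section Dual
variable {k : Type*} [RCLike k] {X : Type*} {n : ℕ} {deg : Fin n → ℤ} {deg' : Fin (n + 1) → ℤ}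

/-! The BRST variation of a functional is read off from its value at the displaced super-curve,
whose functions have the form `f + ε g`. Since `ε` is odd and is extracted to the left, these
multiply as `(f + ε g)(f' + ε g') = f f' + ε (g f' + parity f * g')`. A matrix of degree `0` has
entries of degree `β - α`, so `parity` acts on it as the purely numerical conjugation `twist`, with
signs `(-1)^(α+β)`. The proof is therefore ordinary calculus of path-ordered exponentials, in which
every factor to the left of a variation is twisted.

Write `A` for `∂_θ 𝑻` and `T` for `𝑻` at `θ = 0`. Flatness of the representation, together with the
term `-D𝑻`, shows that displacing the curve replaces `A` by `A + ε (∂_t T + twist A * T - T * A)`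
(`thetaT_displace`): an infinitesimal gauge transformation with parameter `T`. The `ε`-part of an
iterated integral is the integral with this matrix inserted once (`iterInt_dualMat`). Integration by
parts, order by order, trades the inserted commutator for insertions of `∂_t T` in two consecutive
orders and for values at the end points (`insInt_gauge`). In the alternating series the `∂_t T`
insertions telescope to zero, and only `-T(b) U + twist U * T(a)` survives
(`hasAltSum_insInt_gauge`).

Convergence holds coefficient by coefficient: a coefficient of a product involves only the finitely
many smaller monomials, and the usual `(K (t-a))^q / q!` estimate applies to all of them at once
(`norm_iterInt_le`). Series with an insertion converge because they are off-diagonal blocks of an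
ordered exponential of a block triangular matrix (`iterInt_fromBlocks`).

The resulting transformation law is isolated as `IsTransport`. It is stable under composition,
because the intermediate representation matrices cancel (`IsTransport.mul`), and transition
functions obey it by their compatibility with `Q` (`isTransport_transition`). Hence spliced Wilson
lines obey it too. Invariance of the contraction with end-point coordinates and of the supertrace
around a closed curve are formal consequences of this law and of graded commutativity. -/

theorem parity_parity (f : FormalFn k X deg) : parity (parity f) = f := by
  refine FormalFn.ext fun e _ => ?_
  rw [coeff_parity, coeff_parity, smul_smul, sgn_mul_self, one_smul]

theorem FormalFn.IsHomog.parity_eq {p : ℤ} {f : FormalFn k X deg} (hf : IsHomog p f) :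
    parity f = sgn p • f := by
  refine FormalFn.ext fun e _ => ?_
  rw [coeff_parity, coeff_zsmul]
  by_cases h : mdeg deg e = p
  · rw [h]
  · rw [hf e h, smul_zero, smul_zero]

/-- Only monomial pairs with degrees `p` and `q` contribute, and for these the Koszul sign is given
by `swap_comm`. This is what makes the supertrace cyclic. -/
theorem FormalFn.IsHomog.mul_comm_sgn {p q : ℤ} {f g : FormalFn k X deg} (hf : IsHomog p f)
    (hg : IsHomog q g) : f * g = sgn (p * q) • (g * f) := by
  refine FormalFn.ext fun e he => ?_
  rw [coeff_zsmul, coeff_mul _ _ he, coeff_mul _ _ he, Finset.smul_sum]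
  refine Finset.sum_nbij' Prod.swap Prod.swap ?_ ?_ (fun _ _ => rfl) (fun _ _ => rfl) ?_
  · intro x hx
    simpa [add_comm] using hx
  · intro x hx
    simpa [add_comm] using hx
  intro x hx
  rw [Finset.HasAntidiagonal.mem_antidiagonal] at hx
  simp only [Prod.fst_swap, Prod.snd_swap]
  by_cases h1 : mdeg deg x.1 = p
  · by_cases h2 : mdeg deg x.2 = q
    · rw [swap_comm (by rw [hx]; exact he), h1, h2, smul_smul, mul_comm (f.coeff _)]
    · simp [hg _ h2]
  · simp [hf _ h1]

theorem leftCoeff_coeff (h : ∀ i, deg' ((0 : Fin (n + 1)).succAbove i) = deg i)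
    (f : FormalFn k X deg') (e) :
    (leftCoeff f : FormalFn k X deg).coeff e = f.coeff (ins 0 1 e) :=
  coeff_mk' _ (fun _ he => coeff_eq_zero _ fun hd => he ((adm_ins_one h _).1 hd)) e

variable (h : ∀ i, deg' ((0 : Fin (n + 1)).succAbove i) = deg i)
include h

theorem kill_add (f g : FormalFn k X deg') :
    (kill 0 (f + g) : FormalFn k X deg) = kill 0 f + kill 0 g := by
  refine FormalFn.ext fun e _ => ?_
  simp only [coeff_kill h, coeff_add]

theorem leftCoeff_add (f g : FormalFn k X deg') :
    (leftCoeff (f + g) : FormalFn k X deg) = leftCoeff f + leftCoeff g := by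
  refine FormalFn.ext fun e _ => ?_
  simp only [leftCoeff_coeff h, coeff_add]

theorem leftCoeff_sub (f g : FormalFn k X deg') :
    (leftCoeff (f - g) : FormalFn k X deg) = leftCoeff f - leftCoeff g := by
  refine FormalFn.ext fun e _ => ?_
  simp only [leftCoeff_coeff h, coeff_sub]

theorem leftCoeff_zsmul (c : ℤ) (f : FormalFn k X deg') :
    (leftCoeff (c • f) : FormalFn k X deg) = c • leftCoeff f := by
  refine FormalFn.ext fun e _ => ?_
  simp only [leftCoeff_coeff h, coeff_zsmul]

theorem leftCoeff_neg (f : FormalFn k X deg') :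
    (leftCoeff (-f) : FormalFn k X deg) = -leftCoeff f := by
  refine FormalFn.ext fun e _ => ?_
  simp only [leftCoeff_coeff h, coeff_neg]

theorem kill_sum {κ : Type*} (s : Finset κ) (f : κ → FormalFn k X deg') :
    (kill 0 (∑ i ∈ s, f i) : FormalFn k X deg) = ∑ i ∈ s, kill 0 (f i) := by
  refine FormalFn.ext fun e _ => ?_
  simp only [coeff_kill h, FormalFn.coeff_sum]

theorem leftCoeff_sum {κ : Type*} (s : Finset κ) (f : κ → FormalFn k X deg') :
    (leftCoeff (∑ i ∈ s, f i) : FormalFn k X deg) = ∑ i ∈ s, leftCoeff (f i) := by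
  refine FormalFn.ext fun e _ => ?_
  simp only [leftCoeff_coeff h, FormalFn.coeff_sum]

theorem kill_push (f : FormalFn k X deg) :
    (kill 0 (push 0 f : FormalFn k X deg') : FormalFn k X deg) = f := by
  refine FormalFn.ext fun e _ => ?_
  simp [coeff_kill h, coeff_push h]

theorem leftCoeff_push (f : FormalFn k X deg) :
    (leftCoeff (push 0 f : FormalFn k X deg') : FormalFn k X deg) = 0 := by
  refine FormalFn.ext fun e _ => ?_
  simp [leftCoeff_coeff h, coeff_push h]

theorem leftCoeff_gen_mul (f : FormalFn k X deg') :
    (leftCoeff (gen 0 * f) : FormalFn k X deg) = kill 0 f := by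
  refine FormalFn.ext fun e he => ?_
  have hs : Finsupp.single 0 1 + ins 0 0 e = ins 0 1 e := by
    ext i
    refine Fin.cases ?_ (fun j => ?_) i
    · simp
    · have h1 := ins_succAbove (0 : Fin (n + 1)) 0 e j
      have h2 := ins_succAbove (0 : Fin (n + 1)) 1 e j
      rw [Fin.zero_succAbove] at h1 h2
      simp [h1, h2]
  rw [leftCoeff_coeff h, coeff_kill h, coeff_mul _ _ ((adm_ins_one h _).2 he),
    Finset.sum_eq_single (Finsupp.single 0 1, ins 0 0 e)]
  · have : swap deg' (Finsupp.single 0 1) (ins 0 0 e) = 0 := by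
      refine Finset.sum_eq_zero fun i _ => Finset.sum_eq_zero fun j _ => ?_
      split_ifs with hij
      · rw [Finsupp.single_eq_of_ne (by rintro rfl; exact absurd hij (by simp))]
        simp
      · rfl
    simp [coeff_gen, this, sgn]
  · rintro ⟨x, y⟩ hp hne
    rw [Finset.HasAntidiagonal.mem_antidiagonal] at hp
    rw [coeff_gen, if_neg]
    · simp
    · rintro hx
      refine hne (Prod.ext hx ?_)
      simp only at hx hp
      rw [hx, ← hs] at hp
      exact add_left_cancel hp
  · intro hn
    exact absurd (by rw [Finset.HasAntidiagonal.mem_antidiagonal]; exact hs) hn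

/-- Since `z_0` is odd, it occurs at most once in an admissible monomial, so these two parts exhaust
all coefficients. -/
theorem dual_ext (ho : Odd (deg' 0)) {f g : FormalFn k X deg'}
    (h0 : (kill 0 f : FormalFn k X deg) = kill 0 g)
    (h1 : (leftCoeff f : FormalFn k X deg) = leftCoeff g) : f = g := by
  refine FormalFn.ext fun e he => ?_
  have h2 := he 0 ho
  have h3 := ins_del 0 e
  have h4 := congrArg (fun u => FormalFn.coeff u (del 0 e)) h0
  have h5 := congrArg (fun u => FormalFn.coeff u (del 0 e)) h1
  simp only [coeff_kill h, leftCoeff_coeff h] at h4 h5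
  rcases Nat.le_one_iff_eq_zero_or_eq_one.1 h2 with h6 | h6
  · rw [h6] at h3
    rwa [h3] at h4
  · rw [h6] at h3
    rwa [h3] at h5

omit h in
/-- The function `f + z_0 g` of an additional generator `z_0`. -/
def dual (f g : FormalFn k X deg) : FormalFn k X deg' := push 0 f + gen 0 * push 0 g

theorem kill_dual (f g : FormalFn k X deg) :
    (kill 0 (dual f g : FormalFn k X deg') : FormalFn k X deg) = f := by
  rw [dual, kill_add h, kill_mul h, kill_gen h, zero_mul, add_zero, kill_push h]

theorem leftCoeff_dual (f g : FormalFn k X deg) :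
    (leftCoeff (dual f g : FormalFn k X deg') : FormalFn k X deg) = g := by
  rw [dual, leftCoeff_add h, leftCoeff_push h, leftCoeff_gen_mul h, zero_add, kill_push h]

theorem dual_kill_leftCoeff (ho : Odd (deg' 0)) (f : FormalFn k X deg') :
    dual (kill 0 f : FormalFn k X deg) (leftCoeff f) = f :=
  dual_ext h ho (kill_dual h _ _) (leftCoeff_dual h _ _)

/-- Pulling `z_0` to the left past `f` produces `parity f`, and the term with two factors `z_0`
vanishes. -/
theorem dual_mul (ho : Odd (deg' 0)) (f g f' g' : FormalFn k X deg) :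
    (dual f g * dual f' g' : FormalFn k X deg') = dual (f * f') (g * f' + parity f * g') := by
  have hc : (push 0 f * gen 0 : FormalFn k X deg') = gen 0 * push 0 (parity f) := by
    rw [push_parity h, gen_mul ho, parity_parity]
  have hz : (gen 0 * push 0 g * gen 0 : FormalFn k X deg') = 0 := by
    rw [gen_mul ho, mul_assoc, gen_mul_self ho, mul_zero]
  simp only [dual, push_add h, push_mul h, mul_add, add_mul]
  rw [← mul_assoc (push 0 f) (gen 0), hc, ← mul_assoc (gen 0 * push 0 g) (gen 0), hz]
  simp only [mul_assoc, zero_mul]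
  abel

theorem leftCoeff_mul (ho : Odd (deg' 0)) (f g : FormalFn k X deg') :
    (leftCoeff (f * g) : FormalFn k X deg) =
      leftCoeff f * kill 0 g + parity (kill 0 f) * leftCoeff g := by
  conv_lhs => rw [← dual_kill_leftCoeff h ho f, ← dual_kill_leftCoeff h ho g, dual_mul h ho]
  rw [leftCoeff_dual h]

theorem FormalFn.IsHomog.kill {p : ℤ} {f : FormalFn k X deg'} (hf : IsHomog p f) :
    IsHomog p (FormalFn.kill 0 f : FormalFn k X deg) := by
  intro e he
  rw [coeff_kill h, hf]
  rwa [mdeg_ins h, Nat.cast_zero, zero_mul, zero_add]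

theorem FormalFn.IsHomog.leftCoeff {p : ℤ} {f : FormalFn k X deg'} (hf : IsHomog p f) :
    IsHomog (p - deg' 0) (FormalFn.leftCoeff f : FormalFn k X deg) := by
  intro e he
  rw [leftCoeff_coeff h, hf]
  rw [mdeg_ins h, Nat.cast_one, one_mul]
  omega

end Dual

/-! ### Matrices of functions -/

section Matrices
variable {ι : Type*} [Fintype ι] [DecidableEq ι] (lev : ι → ℤ)

/-- The conjugation `M^α_β ↦ (-1)^{α+β} M^α_β`. -/
def twist {R : Type*} [AddCommGroup R] (M : Matrix ι ι R) : Matrix ι ι R :=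
  Matrix.of fun α β => sgn (lev α + lev β) • M α β

theorem twist_apply {R : Type*} [AddCommGroup R] (M : Matrix ι ι R) (α β : ι) :
    twist lev M α β = sgn (lev α + lev β) • M α β := rfl

variable {R : Type*} [Ring R]

/-- The twist is conjugation by the diagonal matrix of the signs `(-1)^α`; the two signs at an inner
index cancel. -/
theorem twist_mul (M N : Matrix ι ι R) : twist lev (M * N) = twist lev M * twist lev N := by
  ext α β
  simp only [twist, Matrix.of_apply, Matrix.mul_apply, Finset.smul_sum, smul_mul_smul_comm]
  refine Finset.sum_congr rfl fun γ _ => ?_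
  congr 1
  rw [sgn_add, sgn_add, sgn_add]
  linear_combination -(sgn (lev α) * sgn (lev β)) * sgn_mul_self (lev γ)

theorem twist_one : twist lev (1 : Matrix ι ι R) = 1 := by
  ext α β
  by_cases h : α = β
  · subst h
    simp only [twist, Matrix.of_apply, sgn_add, sgn_mul_self, one_smul]
  · simp [twist, h]

variable {k : Type*} [RCLike k] {X : Type*} {n : ℕ} {deg : Fin n → ℤ} {deg' : Fin (n + 1) → ℤ}

/-- The matrix `M` has degree `d`, as an endomorphism of the graded bundle. -/
def HomogMat (d : ℤ) (M : Matrix ι ι (FormalFn k X deg)) : Prop :=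
  ∀ α β, IsHomog (d + lev β - lev α) (M α β)

variable {lev}

/-- The entry at `(α, β)` has degree `β - α`, which has the parity of `α + β`. This is the source of
the sign `(-1)^(α+γ)` in the variation formula. -/
theorem HomogMat.map_parity {M : Matrix ι ι (FormalFn k X deg)} (hM : HomogMat lev 0 M) :
    M.map parity = twist lev M := by
  ext1 α β
  simp only [twist, Matrix.of_apply, Matrix.map_apply]
  rw [IsHomog.parity_eq (hM α β)]
  congr 1
  rw [zero_add, sub_eq_add_neg, add_comm, sgn_add, sgn_add]
  simp [sgn]

theorem HomogMat.mul {c d : ℤ} {M N : Matrix ι ι (FormalFn k X deg)} (hM : HomogMat lev c M)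
    (hN : HomogMat lev d N) : HomogMat lev (c + d) (M * N) := by
  intro α β
  rw [Matrix.mul_apply]
  refine IsHomog.sum fun γ _ => ?_
  have := (hM α γ).mul (hN γ β)
  rwa [show c + lev γ - lev α + (d + lev β - lev γ) = c + d + lev β - lev α by ring] at this

theorem HomogMat.one : HomogMat lev 0 (1 : Matrix ι ι (FormalFn k X deg)) := by
  intro α β e he
  by_cases h : α = β
  · subst h
    rw [Matrix.one_apply_eq, coeff_one, if_neg]
    rintro rfl
    exact he (by rw [mdeg_zero]; ring)
  · rw [Matrix.one_apply_ne h, coeff_zero]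

/-- The matrix `M + z_0 N`. -/
def dualMat (M N : Matrix ι ι (FormalFn k X deg)) : Matrix ι ι (FormalFn k X deg') :=
  Matrix.of fun α β => dual (M α β) (N α β)

variable (h : ∀ i, deg' ((0 : Fin (n + 1)).succAbove i) = deg i)
include h

theorem kill_dualMat (M N : Matrix ι ι (FormalFn k X deg)) (α β : ι) :
    (kill 0 ((dualMat M N : Matrix ι ι (FormalFn k X deg')) α β) : FormalFn k X deg) = M α β :=
  kill_dual h _ _

theorem leftCoeff_dualMat (M N : Matrix ι ι (FormalFn k X deg)) (α β : ι) :
    (leftCoeff ((dualMat M N : Matrix ι ι (FormalFn k X deg')) α β) : FormalFn k X deg) =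
      N α β :=
  leftCoeff_dual h _ _

theorem dualMat_mul (ho : Odd (deg' 0)) (M N M' N' : Matrix ι ι (FormalFn k X deg)) :
    (dualMat M N * dualMat M' N' : Matrix ι ι (FormalFn k X deg')) =
      dualMat (M * M') (N * M' + M.map parity * N') := by
  ext1 α β
  simp only [dualMat, Matrix.of_apply, Matrix.mul_apply, Matrix.add_apply, Matrix.map_apply]
  refine dual_ext h ho ?_ ?_
  · rw [kill_sum h, kill_dual h]
    exact Finset.sum_congr rfl fun γ _ => by rw [kill_mul h, kill_dual h, kill_dual h]
  · rw [leftCoeff_sum h, leftCoeff_dual h, ← Finset.sum_add_distrib]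
    exact Finset.sum_congr rfl fun γ _ => by rw [dual_mul h ho, leftCoeff_dual h]

theorem dualMat_one :
    (dualMat (1 : Matrix ι ι (FormalFn k X deg)) 0 : Matrix ι ι (FormalFn k X deg')) = 1 := by
  ext1 α β
  by_cases hαβ : α = β
  · subst hαβ
    simp [dualMat, dual, push_one h, push_zero h]
  · simp [dualMat, dual, hαβ, push_zero h]

end Matrices

/-! ### Calculus in the time direction -/

section Time
variable {k : Type*} [RCLike k] {a b : ℝ} {L : GDomain} {n : ℕ} {deg : Fin n → ℤ}

/-- The coefficient of `z^e` along the line through `v` in the time direction. -/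
def timeFn (f : FormalFn k (tube a b L) deg) (e : Fin n →₀ ℕ) (v : L.body) (s : ℝ) : k :=
  extZ (f.coeff e) (s, v.1)

theorem timeFn_apply (f : FormalFn k (tube a b L) deg) (e) (v : L.body) {s : ℝ}
    (hs : s ∈ Set.Icc a b) : timeFn f e v s = f.coeff e ⟨(s, v.1), hs, v.2⟩ :=
  extZ_apply _ _

theorem extZ_zsmul {E : Type*} [NormedAddCommGroup E] [NormedSpace ℝ E] {D : Set E} (c : ℤ)
    (f : D → k) : extZ (c • f) = c • extZ f := by
  funext x; by_cases h : x ∈ D <;> simp [extZ, h]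

theorem extZ_sum {E : Type*} [NormedAddCommGroup E] [NormedSpace ℝ E] {D : Set E} {κ : Type*}
    (s : Finset κ) (f : κ → D → k) : extZ (∑ i ∈ s, f i) = ∑ i ∈ s, extZ (f i) := by
  funext x; by_cases h : x ∈ D <;> simp [extZ, h]

theorem timeFn_zero (e) (v : L.body) :
    timeFn (0 : FormalFn k (tube a b L) deg) e v = 0 := by
  funext s; simp [timeFn, extZ_zero]

theorem timeFn_add (f g : FormalFn k (tube a b L) deg) (e) (v : L.body) :
    timeFn (f + g) e v = timeFn f e v + timeFn g e v := by
  funext s; simp [timeFn, extZ_add]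

theorem timeFn_zsmul (c : ℤ) (f : FormalFn k (tube a b L) deg) (e) (v : L.body) :
    timeFn (c • f) e v = c • timeFn f e v := by
  funext s; simp only [timeFn, coeff_zsmul, extZ_zsmul]; rfl

theorem timeFn_mul (f g : FormalFn k (tube a b L) deg) {e} (he : Adm deg e) (v : L.body) :
    timeFn (f * g) e v = ∑ p ∈ Finset.HasAntidiagonal.antidiagonal e,
      sgn (swap deg p.1 p.2) • (timeFn f p.1 v * timeFn g p.2 v) := by
  funext s
  simp only [timeFn, coeff_mul _ _ he, extZ_sum, extZ_zsmul, extZ_mul, Finset.sum_apply,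
    Pi.smul_apply, Pi.mul_apply]

theorem timeFn_of_not_adm (f : FormalFn k (tube a b L) deg) {e} (he : ¬ Adm deg e)
    (v : L.body) : timeFn f e v = 0 := by
  funext s; simp [timeFn, coeff_eq_zero _ he, extZ_zero]

/-- All coefficients of `f` depend continuously on the time. -/
def TimeCont (f : FormalFn k (tube a b L) deg) : Prop :=
  ∀ e (v : L.body), ContinuousOn (timeFn f e v) (Set.Icc a b)

/-- The derivative of `f` with respect to the time is `g`. -/
def HasTimeDeriv (f g : FormalFn k (tube a b L) deg) : Prop :=
  ∀ e (v : L.body), ∀ t ∈ Set.Icc a b,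
    HasDerivWithinAt (timeFn f e v) (timeFn g e v t) (Set.Icc a b) t

section
variable {f g f' g' : FormalFn k (tube a b L) deg}

theorem TimeCont.zero : TimeCont (0 : FormalFn k (tube a b L) deg) := fun e v => by
  rw [timeFn_zero]; exact continuousOn_const

theorem TimeCont.add (hf : TimeCont f) (hg : TimeCont g) : TimeCont (f + g) := fun e v => by
  rw [timeFn_add]; exact (hf e v).add (hg e v)

theorem TimeCont.zsmul (c : ℤ) (hf : TimeCont f) : TimeCont (c • f) := fun e v => by
  rw [timeFn_zsmul]; exact (hf e v).const_smul c

theorem TimeCont.sum {κ : Type*} {s : Finset κ} {f : κ → FormalFn k (tube a b L) deg}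
    (hf : ∀ i ∈ s, TimeCont (f i)) : TimeCont (∑ i ∈ s, f i) :=
  Finset.sum_induction _ TimeCont (fun _ _ => TimeCont.add) TimeCont.zero hf

theorem TimeCont.mul (hf : TimeCont f) (hg : TimeCont g) : TimeCont (f * g) := fun e v => by
  by_cases he : Adm deg e
  · rw [timeFn_mul _ _ he]
    exact Finset.sum_induction _ (ContinuousOn · (Set.Icc a b)) (fun _ _ => ContinuousOn.add)
      continuousOn_const fun p _ => ((hf p.1 v).mul (hg p.2 v)).const_smul _
  · rw [timeFn_of_not_adm _ he]; exact continuousOn_const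

theorem HasTimeDeriv.timeCont (hf : HasTimeDeriv f f') : TimeCont f := fun e v t ht =>
  (hf e v t ht).continuousWithinAt

theorem HasTimeDeriv.zero : HasTimeDeriv (0 : FormalFn k (tube a b L) deg) 0 := fun e v t _ => by
  rw [timeFn_zero]; exact hasDerivWithinAt_const _ _ _

theorem HasTimeDeriv.add (hf : HasTimeDeriv f f') (hg : HasTimeDeriv g g') :
    HasTimeDeriv (f + g) (f' + g') := fun e v t ht => by
  rw [timeFn_add, timeFn_add]; exact (hf e v t ht).add (hg e v t ht)

theorem HasTimeDeriv.zsmul (c : ℤ) (hf : HasTimeDeriv f f') : HasTimeDeriv (c • f) (c • f') :=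
  fun e v t ht => by
    rw [timeFn_zsmul, timeFn_zsmul]; exact (hf e v t ht).const_smul c

theorem HasTimeDeriv.neg (hf : HasTimeDeriv f f') : HasTimeDeriv (-f) (-f') := by
  simpa using hf.zsmul (-1)

theorem HasTimeDeriv.sub (hf : HasTimeDeriv f f') (hg : HasTimeDeriv g g') :
    HasTimeDeriv (f - g) (f' - g') := by
  rw [sub_eq_add_neg, sub_eq_add_neg]; exact hf.add hg.neg

theorem HasTimeDeriv.sum {κ : Type*} {s : Finset κ} {f f' : κ → FormalFn k (tube a b L) deg}
    (hf : ∀ i ∈ s, HasTimeDeriv (f i) (f' i)) :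
    HasTimeDeriv (∑ i ∈ s, f i) (∑ i ∈ s, f' i) := by
  classical
  induction s using Finset.induction_on with
  | empty => simpa using HasTimeDeriv.zero
  | insert i s hi ih =>
    rw [Finset.sum_insert hi, Finset.sum_insert hi]
    exact (hf i (by simp)).add (ih fun j hj => hf j (by simp [hj]))

theorem HasTimeDeriv.mul (hf : HasTimeDeriv f f') (hg : HasTimeDeriv g g') :
    HasTimeDeriv (f * g) (f' * g + f * g') := fun e v t ht => by
  by_cases he : Adm deg e
  · rw [timeFn_add, timeFn_mul _ _ he, timeFn_mul _ _ he, timeFn_mul _ _ he,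
      ← Finset.sum_add_distrib, Finset.sum_apply]
    refine HasDerivWithinAt.sum fun p _ => ?_
    simp only [Pi.add_apply, Pi.smul_apply, ← smul_add, Pi.mul_apply]
    exact ((hf p.1 v t ht).mul (hg p.2 v t ht)).const_smul _
  · rw [timeFn_of_not_adm _ he, timeFn_of_not_adm _ he]
    exact hasDerivWithinAt_const _ _ _

end

theorem coeff_mapCoeff_slice (t : ℝ) (ht : t ∈ Set.Icc a b) (f : FormalFn k (tube a b L) deg)
    (e) : (mapCoeff (fun g v => g ⟨(t, v.1), ht, v.2⟩) f : FormalFn k L.body deg).coeff e =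
      fun v : L.body => f.coeff e ⟨(t, v.1), ht, v.2⟩ := by
  rw [coeff_mapCoeff rfl]

/-- The restriction to the time `t`. -/
def timeSlice (t : ℝ) (ht : t ∈ Set.Icc a b) :
    FormalFn k (tube a b L) deg →+* FormalFn k L.body deg where
  toFun := mapCoeff fun g v => g ⟨(t, v.1), ht, v.2⟩
  map_one' := FormalFn.ext fun e _ => by
    rw [coeff_mapCoeff_slice t ht, coeff_one, coeff_one]; split_ifs <;> rfl
  map_zero' := FormalFn.ext fun e _ => by rw [coeff_mapCoeff_slice t ht]; rfl
  map_add' f g := FormalFn.ext fun e _ => by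
    simp only [coeff_add, coeff_mapCoeff_slice t ht]; rfl
  map_mul' f g := FormalFn.ext fun e he => by
    rw [coeff_mul _ _ he, coeff_mapCoeff_slice t ht, coeff_mul _ _ he]
    funext v
    simp only [Finset.sum_apply, Pi.smul_apply, Pi.mul_apply, coeff_mapCoeff_slice t ht]

theorem coeff_timeSlice (t : ℝ) (ht : t ∈ Set.Icc a b) (f : FormalFn k (tube a b L) deg) (e)
    (v : L.body) : (timeSlice t ht f).coeff e v = f.coeff e ⟨(t, v.1), ht, v.2⟩ :=
  congrFun (coeff_mapCoeff_slice t ht f e) v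

/-- Regard a function on `L` as one that does not depend on the time. -/
def timeConst (f : FormalFn k L.body deg) : FormalFn k (tube a b L) deg :=
  mapCoeff (fun g x => g ⟨x.1.2, x.2.2⟩) f

theorem timeSlice_timeConst (t : ℝ) (ht : t ∈ Set.Icc a b) (f : FormalFn k L.body deg) :
    timeSlice t ht (timeConst f : FormalFn k (tube a b L) deg) = f := by
  refine FormalFn.ext fun e _ => funext fun v => ?_
  rw [coeff_timeSlice, timeConst, coeff_mapCoeff rfl]

theorem hasTimeDeriv_timeConst (f : FormalFn k L.body deg) :
    HasTimeDeriv (timeConst f : FormalFn k (tube a b L) deg) 0 := by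
  intro e v t ht
  rw [timeFn_zero]
  refine (hasDerivWithinAt_const t (Set.Icc a b) (f.coeff e v)).congr_of_mem (fun s hs => ?_) ht
  rw [timeFn_apply _ _ _ hs, timeConst, coeff_mapCoeff rfl]

theorem hasTimeDeriv_one : HasTimeDeriv (1 : FormalFn k (tube a b L) deg) 0 := by
  have h : (1 : FormalFn k (tube a b L) deg) = timeConst 1 := by
    refine FormalFn.ext fun e _ => ?_
    rw [timeConst, coeff_mapCoeff rfl, coeff_one, coeff_one]
    split_ifs <;> rfl
  rw [h]
  exact hasTimeDeriv_timeConst 1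

/-- This replaces explicit integration by parts: identities between iterated integrals are verified
by comparing time derivatives and values at `a`. -/
theorem HasTimeDeriv.unique (hab : a < b) {f g h : FormalFn k (tube a b L) deg}
    (hf : HasTimeDeriv f h) (hg : HasTimeDeriv g h)
    (h0 : timeSlice a (Set.left_mem_Icc.2 hab.le) f =
      timeSlice a (Set.left_mem_Icc.2 hab.le) g) : f = g := by
  rw [← sub_eq_zero]
  have hd := hf.sub hg
  rw [sub_self] at hd
  refine FormalFn.ext fun e _ => funext fun x => ?_
  obtain ⟨⟨t, v⟩, ht, hv⟩ := x
  have hc := constant_of_derivWithin_zero (fun s hs => (hd e ⟨v, hv⟩ s hs).differentiableWithinAt)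
    (fun s hs => by
      rw [(hd e ⟨v, hv⟩ s (Set.Ico_subset_Icc_self hs)).derivWithin
        (uniqueDiffOn_Icc hab s (Set.Ico_subset_Icc_self hs)), timeFn_zero]
      rfl) t ht
  rw [timeFn_apply _ _ _ ht, timeFn_apply _ _ _ (Set.left_mem_Icc.2 hab.le)] at hc
  change (f - g).coeff e ⟨(t, v), _⟩ = 0
  rw [hc]
  have h1 := congrFun (congrArg (fun u => FormalFn.coeff u e) h0) ⟨v, hv⟩
  simp only [coeff_timeSlice] at h1
  rw [coeff_sub, Pi.sub_apply, h1, sub_self]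

theorem primitive_zero_fn : (fun (x : tube a b L) =>
    ∫ s in a..x.1.1, extZ (0 : tube a b L → k) (s, x.1.2)) = 0 := by
  funext x; simp [extZ_zero]

theorem coeff_primitive (f : FormalFn k (tube a b L) L.deg) (e) (x : tube a b L) :
    (primitive f).coeff e x = ∫ s in a..x.1.1, timeFn f e ⟨x.1.2, x.2.2⟩ s := by
  rw [primitive, coeff_mapCoeff primitive_zero_fn]; rfl

theorem timeSlice_primitive (hab : a ≤ b) (f : FormalFn k (tube a b L) L.deg) :
    timeSlice a (Set.left_mem_Icc.2 hab) (primitive f) = 0 := by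
  refine FormalFn.ext fun e _ => funext fun v => ?_
  rw [coeff_timeSlice, coeff_primitive, intervalIntegral.integral_same]
  rfl

theorem TimeCont.intervalIntegrable {f : FormalFn k (tube a b L) deg} (hf : TimeCont f) (e)
    (v : L.body) {t : ℝ} (ht : t ∈ Set.Icc a b) :
    IntervalIntegrable (timeFn f e v) MeasureTheory.volume a t :=
  ((hf e v).mono (by
    rw [Set.uIcc_of_le ht.1]; exact Set.Icc_subset_Icc_right ht.2)).intervalIntegrable

theorem hasTimeDeriv_primitive {f : FormalFn k (tube a b L) L.deg} (hf : TimeCont f) :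
    HasTimeDeriv (primitive f) f := by
  intro e v t ht
  -- This instance provides the filter class for the fundamental theorem of calculus within a closed
  -- interval, so that the end points are included with one-sided derivatives.
  have : Fact (t ∈ Set.Icc a b) := ⟨ht⟩
  have h1 := intervalIntegral.integral_hasDerivWithinAt_right (hf.intervalIntegrable e v ht)
    (s := Set.Icc a b) (t := Set.Icc a b)
    ((hf e v).stronglyMeasurableAtFilter_nhdsWithin measurableSet_Icc t) (hf e v t ht)
  refine h1.congr_of_mem (fun s hs => ?_) ht
  rw [timeFn_apply _ _ _ hs, coeff_primitive]

/-! Matrices of functions depending on the time. -/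

variable {ι : Type*} [Fintype ι] [DecidableEq ι]

/-- The entrywise time derivative of the matrix `M` is `N`. -/
def HasTimeDerivMat (M N : Matrix ι ι (FormalFn k (tube a b L) deg)) : Prop :=
  ∀ α β, HasTimeDeriv (M α β) (N α β)

section
variable {M N M' N' : Matrix ι ι (FormalFn k (tube a b L) deg)}

theorem HasTimeDerivMat.add (hM : HasTimeDerivMat M M') (hN : HasTimeDerivMat N N') :
    HasTimeDerivMat (M + N) (M' + N') := fun α β => (hM α β).add (hN α β)

theorem HasTimeDerivMat.sub (hM : HasTimeDerivMat M M') (hN : HasTimeDerivMat N N') :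
    HasTimeDerivMat (M - N) (M' - N') := fun α β => (hM α β).sub (hN α β)

theorem HasTimeDerivMat.mul (hM : HasTimeDerivMat M M') (hN : HasTimeDerivMat N N') :
    HasTimeDerivMat (M * N) (M' * N + M * N') := fun α β => by
  rw [Matrix.add_apply, Matrix.mul_apply, Matrix.mul_apply, Matrix.mul_apply,
    ← Finset.sum_add_distrib]
  exact HasTimeDeriv.sum fun γ _ => (hM α γ).mul (hN γ β)

theorem HasTimeDerivMat.unique (hab : a < b) (hM : HasTimeDerivMat M M')
    (hN : HasTimeDerivMat N M')
    (h0 : M.map (timeSlice a (Set.left_mem_Icc.2 hab.le)) =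
      N.map (timeSlice a (Set.left_mem_Icc.2 hab.le))) : M = N := by
  ext1 α β
  exact (hM α β).unique hab (hN α β) (congrFun (congrFun h0 α) β)

theorem hasTimeDerivMat_timeConst (M : Matrix ι ι (FormalFn k L.body deg)) :
    HasTimeDerivMat (M.map timeConst : Matrix ι ι (FormalFn k (tube a b L) deg)) 0 :=
  fun _ _ => hasTimeDeriv_timeConst _

end

theorem hasTimeDerivMat_primitive {M : Matrix ι ι (FormalFn k (tube a b L) L.deg)}
    (hM : ∀ α β, TimeCont (M α β)) : HasTimeDerivMat (M.map primitive) M :=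
  fun α β => hasTimeDeriv_primitive (hM α β)

theorem timeCont_mul_mat {M N : Matrix ι ι (FormalFn k (tube a b L) deg)}
    (hM : ∀ α β, TimeCont (M α β)) (hN : ∀ α β, TimeCont (N α β)) (α β : ι) :
    TimeCont ((M * N) α β) := by
  rw [Matrix.mul_apply]; exact TimeCont.sum fun γ _ => (hM α γ).mul (hN γ β)

theorem timeCont_iterInt {A : Matrix ι ι (FormalFn k (tube a b L) L.deg)}
    (hA : ∀ α β, TimeCont (A α β)) (q : ℕ) (α β : ι) : TimeCont (iterInt A q α β) := by
  induction q generalizing α β with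
  | zero =>
    rw [iterInt, Matrix.one_apply]
    split_ifs
    · exact hasTimeDeriv_one.timeCont
    · exact TimeCont.zero
  | succ q ih => exact (hasTimeDeriv_primitive (timeCont_mul_mat hA ih α β)).timeCont

theorem hasTimeDerivMat_iterInt_succ {A : Matrix ι ι (FormalFn k (tube a b L) L.deg)}
    (hA : ∀ α β, TimeCont (A α β)) (q : ℕ) :
    HasTimeDerivMat (iterInt A (q + 1)) (A * iterInt A q) :=
  hasTimeDerivMat_primitive (timeCont_mul_mat hA (timeCont_iterInt hA q))

end Time

/-! ### Convergence of iterated integrals -/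

section Convergence
variable {k : Type*} [RCLike k] {a b : ℝ} {L : GDomain} {n : ℕ} {deg : Fin n → ℤ}
variable {ι : Type*} [Fintype ι] [DecidableEq ι]

theorem norm_sgn_smul (m : ℤ) (x : k) : ‖sgn m • x‖ = ‖x‖ := by
  rcases Int.even_or_odd m with h | h
  · rw [sgn_of_even h, one_smul]
  · rw [sgn_of_odd h, neg_smul, one_smul, norm_neg]

/-- The exponents below `e₀` are finite in number and closed under passing to factors. Counting all
pairs of them gives a constant that does not depend on `e`, so the estimate can be iterated. -/
theorem norm_timeFn_mul_le {f g : FormalFn k (tube a b L) deg} {v : L.body} {e₀ : Fin n →₀ ℕ}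
    {s c d : ℝ} (hc : ∀ e ≤ e₀, ‖timeFn f e v s‖ ≤ c) (hd : ∀ e ≤ e₀, ‖timeFn g e v s‖ ≤ d)
    (hc0 : 0 ≤ c) (hd0 : 0 ≤ d) {e : Fin n →₀ ℕ} (he : e ≤ e₀) :
    ‖timeFn (f * g) e v s‖ ≤ (Finset.Icc 0 e₀ ×ˢ Finset.Icc 0 e₀).card * (c * d) := by
  by_cases ha : Adm deg e
  · rw [timeFn_mul _ _ ha, Finset.sum_apply]
    have hsub : Finset.HasAntidiagonal.antidiagonal e ⊆ Finset.Icc 0 e₀ ×ˢ Finset.Icc 0 e₀ := by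
      intro p hp
      rw [Finset.HasAntidiagonal.mem_antidiagonal] at hp
      rw [Finset.mem_product, Finset.mem_Icc, Finset.mem_Icc]
      have h1 : p.1 ≤ e := hp ▸ le_self_add
      have h2 : p.2 ≤ e := hp ▸ le_add_self
      exact ⟨⟨zero_le, h1.trans he⟩, zero_le, h2.trans he⟩
    calc _ ≤ ∑ p ∈ Finset.HasAntidiagonal.antidiagonal e, c * d := by
          refine norm_sum_le_of_le _ fun p hp => ?_
          have hp' := hsub hp
          rw [Finset.mem_product, Finset.mem_Icc, Finset.mem_Icc] at hp'
          rw [Pi.smul_apply, norm_sgn_smul, Pi.mul_apply, norm_mul]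
          exact mul_le_mul (hc _ hp'.1.2) (hd _ hp'.2.2) (norm_nonneg _) hc0
      _ ≤ _ := by
          rw [Finset.sum_const, nsmul_eq_mul]
          exact mul_le_mul_of_nonneg_right (by exact_mod_cast Finset.card_le_card hsub)
            (mul_nonneg hc0 hd0)
  · rw [timeFn_of_not_adm _ ha]
    simp only [Pi.zero_apply, norm_zero]
    positivity

theorem timeFn_sum {κ : Type*} (s : Finset κ) (f : κ → FormalFn k (tube a b L) deg) (e)
    (v : L.body) : timeFn (∑ i ∈ s, f i) e v = ∑ i ∈ s, timeFn (f i) e v := by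
  funext t
  simp only [timeFn, FormalFn.coeff_sum, extZ_sum, Finset.sum_apply]

/-- The bound is proved for all exponents below `e₀` and all matrix entries together. Each factor
`A` costs one constant `K` (summation index, number of monomial pairs, bound on `A`), and each
integration raises the power of `t - a` and supplies the factorial. -/
theorem norm_iterInt_le {A : Matrix ι ι (FormalFn k (tube a b L) L.deg)} {v : L.body}
    {e₀ : Fin L.n →₀ ℕ} {c : ℝ} (hc0 : 0 ≤ c)
    (hc : ∀ α β, ∀ e ≤ e₀, ∀ s ∈ Set.Icc a b, ‖timeFn (A α β) e v s‖ ≤ c)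
    (q : ℕ) (α β : ι) {e : Fin L.n →₀ ℕ} (he : e ≤ e₀) {t : ℝ} (ht : t ∈ Set.Icc a b) :
    ‖timeFn (iterInt A q α β) e v t‖ ≤
      (Fintype.card ι * (Finset.Icc 0 e₀ ×ˢ Finset.Icc 0 e₀).card * c * (t - a)) ^ q /
        q.factorial := by
  set K : ℝ := Fintype.card ι * (Finset.Icc 0 e₀ ×ˢ Finset.Icc 0 e₀).card * c with hK
  have hK0 : 0 ≤ K := by positivity
  induction q generalizing α β e t with
  | zero =>
    rw [timeFn_apply _ _ _ ht, iterInt, Matrix.one_apply]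
    split_ifs
    · rw [coeff_one]
      split_ifs <;> simp
    · simp
  | succ q ih =>
    have hstep : ∀ s ∈ Set.Icc a b, ‖timeFn ((A * iterInt A q) α β) e v s‖ ≤
        K * ((K * (s - a)) ^ q / q.factorial) := by
      intro s hs
      have hd0 : 0 ≤ (K * (s - a)) ^ q / q.factorial := by
        have := sub_nonneg.2 hs.1
        positivity
      rw [Matrix.mul_apply, timeFn_sum, Finset.sum_apply]
      calc _ ≤ ∑ γ : ι, ((Finset.Icc 0 e₀ ×ˢ Finset.Icc 0 e₀).card : ℝ) *
              (c * ((K * (s - a)) ^ q / q.factorial)) :=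
            norm_sum_le_of_le _ fun γ _ => norm_timeFn_mul_le (fun e he => hc α γ e he s hs)
              (fun e he => ih γ β he hs) hc0 hd0 he
        _ = _ := by
            rw [Finset.sum_const, nsmul_eq_mul, Finset.card_univ, hK]; ring
    -- The integral of the bound on the integrand is exactly the bound of the next order.
    have hint : ∫ s in a..t, K * ((K * (s - a)) ^ q / q.factorial) =
        (K * (t - a)) ^ (q + 1) / (q + 1).factorial := by
      have hder : ∀ s ∈ Set.uIcc a t, HasDerivAt
          (fun s => (K * (s - a)) ^ (q + 1) / ((q + 1).factorial : ℝ))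
          (K * ((K * (s - a)) ^ q / q.factorial)) s := by
        intro s _
        have h1 := ((((hasDerivAt_id s).sub_const a).const_mul K).pow (q + 1)).div_const
          ((q + 1).factorial : ℝ)
        refine h1.congr_deriv ?_
        have h2 : (q.factorial : ℝ) ≠ 0 := by positivity
        have h3 : (q : ℝ) + 1 ≠ 0 := by positivity
        simp only [Nat.factorial_succ, id, add_tsub_cancel_right]
        push_cast
        field_simp
      rw [intervalIntegral.integral_eq_sub_of_hasDerivAt hder
        ((by fun_prop : Continuous fun s => K * ((K * (s - a)) ^ q / (q.factorial : ℝ)))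
          |>.intervalIntegrable _ _)]
      simp
    rw [timeFn_apply _ _ _ ht, iterInt, Matrix.map_apply, coeff_primitive, ← hint]
    refine intervalIntegral.norm_integral_le_of_norm_le ht.1 (Filter.Eventually.of_forall
      fun s hs => hstep s ⟨hs.1.le, hs.2.trans ht.2⟩) ?_
    exact (by fun_prop : Continuous fun s => K * ((K * (s - a)) ^ q / (q.factorial : ℝ)))
      |>.intervalIntegrable _ _

theorem exists_bound_timeFn {A : Matrix ι ι (FormalFn k (tube a b L) deg)}
    (hA : ∀ α β, TimeCont (A α β)) (v : L.body) (e₀ : Fin n →₀ ℕ) :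
    ∃ c : ℝ, 0 ≤ c ∧ ∀ α β, ∀ e ≤ e₀, ∀ s ∈ Set.Icc a b, ‖timeFn (A α β) e v s‖ ≤ c := by
  choose C hC using fun α β e => isCompact_Icc.exists_bound_of_continuousOn (hA α β e v)
  -- Each coefficient is bounded by compactness of `[a,b]`; the sum of the finitely many bounds, in
  -- absolute value, dominates every one of them.
  refine ⟨∑ α, ∑ β, ∑ e ∈ Finset.Icc 0 e₀, |C α β e|, by positivity, fun α β e he s hs => ?_⟩
  calc _ ≤ |C α β e| := (hC α β e s hs).trans (le_abs_self _)
    _ ≤ ∑ e ∈ Finset.Icc 0 e₀, |C α β e| :=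
      Finset.single_le_sum (f := fun e => |C α β e|) (fun _ _ => abs_nonneg _)
        (Finset.mem_Icc.2 ⟨zero_le, he⟩)
    _ ≤ ∑ β, ∑ e ∈ Finset.Icc 0 e₀, |C α β e| :=
      Finset.single_le_sum (f := fun β => ∑ e ∈ Finset.Icc 0 e₀, |C α β e|)
        (fun _ _ => by positivity) (Finset.mem_univ β)
    _ ≤ _ :=
      Finset.single_le_sum (f := fun α => ∑ β, ∑ e ∈ Finset.Icc 0 e₀, |C α β e|)
        (fun _ _ => by positivity) (Finset.mem_univ α)

/-- The alternating series of iterated integrals, evaluated at the time `t`, converges. -/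
theorem summable_iterInt {A : Matrix ι ι (FormalFn k (tube a b L) L.deg)}
    (hA : ∀ α β, TimeCont (A α β)) (α β : ι) (e : Fin L.n →₀ ℕ) (v : L.body) {t : ℝ}
    (ht : t ∈ Set.Icc a b) :
    Summable fun q : ℕ => (-1) ^ q * (iterInt A q α β).coeff e ⟨(t, v.1), ht, v.2⟩ := by
  obtain ⟨c, hc0, hc⟩ := exists_bound_timeFn hA v e
  refine Summable.of_norm_bounded (Real.summable_pow_div_factorial
    (Fintype.card ι * (Finset.Icc 0 e ×ˢ Finset.Icc 0 e).card * c * (t - a))) fun q => ?_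
  rw [norm_mul, norm_pow, norm_neg, norm_one, one_pow, one_mul,
    ← timeFn_apply (iterInt A q α β) e v ht]
  exact norm_iterInt_le hc0 hc q α β le_rfl ht

end Convergence

/-! ### Iterated integrals with one insertion -/

section Insertion
variable {k : Type*} [RCLike k] {a b : ℝ} {L : GDomain}
variable {ι : Type*} [Fintype ι] [DecidableEq ι]

/-- The iterated integrals with one factor `B`, factors `A₁` at later and `A₂` at earlier times;
there are `q` factors in all. -/
def insInt (A₁ B A₂ : Matrix ι ι (FormalFn k (tube a b L) L.deg)) :
    ℕ → Matrix ι ι (FormalFn k (tube a b L) L.deg)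
  | 0 => 0
  | q + 1 => (A₁ * insInt A₁ B A₂ q + B * iterInt A₂ q).map primitive

theorem primitive_zero : primitive (0 : FormalFn k (tube a b L) L.deg) = 0 := by
  refine FormalFn.ext fun e _ => funext fun x => ?_
  rw [coeff_primitive, timeFn_zero]
  simp

/-- A path through a product of upper triangular block matrices passes from the first block to the
second at most once, and does so by a factor `B`. Continuity and convergence for insertions are thus
inherited from plain iterated integrals over the index set `ι ⊕ ι`. -/
theorem iterInt_fromBlocks (A₁ B A₂ : Matrix ι ι (FormalFn k (tube a b L) L.deg)) (q : ℕ) :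
    iterInt (Matrix.fromBlocks A₁ B 0 A₂) q =
      Matrix.fromBlocks (iterInt A₁ q) (insInt A₁ B A₂ q) 0 (iterInt A₂ q) := by
  induction q with
  | zero => exact Matrix.fromBlocks_one.symm
  | succ q ih =>
    rw [iterInt, ih, Matrix.fromBlocks_multiply, Matrix.fromBlocks_map, iterInt, insInt, iterInt]
    simp only [mul_zero, zero_mul, add_zero, zero_add]
    congr 1
    exact Matrix.map_zero _ primitive_zero

variable {A₁ B A₂ : Matrix ι ι (FormalFn k (tube a b L) L.deg)}

theorem timeCont_fromBlocks (h1 : ∀ α β, TimeCont (A₁ α β)) (hB : ∀ α β, TimeCont (B α β))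
    (h2 : ∀ α β, TimeCont (A₂ α β)) (α β : ι ⊕ ι) :
    TimeCont (Matrix.fromBlocks A₁ B 0 A₂ α β) := by
  rcases α with α | α <;> rcases β with β | β
  exacts [h1 α β, hB α β, TimeCont.zero, h2 α β]

theorem timeCont_insInt (h1 : ∀ α β, TimeCont (A₁ α β)) (hB : ∀ α β, TimeCont (B α β))
    (h2 : ∀ α β, TimeCont (A₂ α β)) (q : ℕ) (α β : ι) : TimeCont (insInt A₁ B A₂ q α β) := by
  have := timeCont_iterInt (timeCont_fromBlocks h1 hB h2) q (Sum.inl α) (Sum.inr β)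
  rwa [iterInt_fromBlocks] at this

theorem hasTimeDerivMat_insInt_succ (h1 : ∀ α β, TimeCont (A₁ α β))
    (hB : ∀ α β, TimeCont (B α β)) (h2 : ∀ α β, TimeCont (A₂ α β)) (q : ℕ) :
    HasTimeDerivMat (insInt A₁ B A₂ (q + 1)) (A₁ * insInt A₁ B A₂ q + B * iterInt A₂ q) :=
  hasTimeDerivMat_primitive fun α β =>
    (timeCont_mul_mat h1 (timeCont_insInt h1 hB h2 q) α β).add
      (timeCont_mul_mat hB (timeCont_iterInt h2 q) α β)

theorem map_timeSlice_primitive (hab : a ≤ b) (M : Matrix ι ι (FormalFn k (tube a b L) L.deg)) :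
    (M.map primitive).map (timeSlice a (Set.left_mem_Icc.2 hab)) = 0 := by
  ext1 α β
  exact timeSlice_primitive hab _

/-- Insertions of a gauge transformation are boundary terms. -/
theorem insInt_gauge (hab : a < b) {T E : Matrix ι ι (FormalFn k (tube a b L) L.deg)}
    (h1 : ∀ α β, TimeCont (A₁ α β)) (h2 : ∀ α β, TimeCont (A₂ α β))
    (hT : HasTimeDerivMat T E) (hE : ∀ α β, TimeCont (E α β)) (q : ℕ) :
    insInt A₁ (E + A₁ * T - T * A₂) A₂ q = insInt A₁ E A₂ q + insInt A₁ E A₂ (q + 1) -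
      (T * iterInt A₂ q - iterInt A₁ q *
        (T.map (timeSlice a (Set.left_mem_Icc.2 hab.le))).map timeConst) := by
  have hTc : ∀ α β, TimeCont (T α β) := fun α β => (hT α β).timeCont
  have hB : ∀ α β, TimeCont ((E + A₁ * T - T * A₂) α β) := fun α β => by
    have := ((hE α β).add (timeCont_mul_mat h1 hTc α β)).add
      ((timeCont_mul_mat hTc h2 α β).zsmul (-1))
    rwa [neg_one_zsmul, ← sub_eq_add_neg] at this
  -- `C` is the initial value of `T`, extended as a constant in time so that it may occur in
  -- time-dependent identities.
  set C : Matrix ι ι (FormalFn k (tube a b L) L.deg) :=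
    (T.map (timeSlice a (Set.left_mem_Icc.2 hab.le))).map timeConst with hC
  have hCd : HasTimeDerivMat C 0 := hasTimeDerivMat_timeConst _
  have hCa : C.map (timeSlice a (Set.left_mem_Icc.2 hab.le)) =
      T.map (timeSlice a (Set.left_mem_Icc.2 hab.le)) := by
    ext1 α β
    exact timeSlice_timeConst _ (Set.left_mem_Icc.2 hab.le) _
  have hI : ∀ {A : Matrix ι ι (FormalFn k (tube a b L) L.deg)} (q : ℕ),
      (iterInt A (q + 1)).map (timeSlice a (Set.left_mem_Icc.2 hab.le)) = 0 :=
    fun q => map_timeSlice_primitive hab.le _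
  have hJ : ∀ {B : Matrix ι ι (FormalFn k (tube a b L) L.deg)} (q : ℕ),
      (insInt A₁ B A₂ (q + 1)).map (timeSlice a (Set.left_mem_Icc.2 hab.le)) = 0 :=
    fun q => map_timeSlice_primitive hab.le _
  have hdJ := fun q => hasTimeDerivMat_insInt_succ h1 hE h2 q
  induction q with
  | zero =>
    -- In lowest order the insertion of the derivative `E` is simply integrated: the fundamental
    -- theorem of calculus.
    have h : insInt A₁ E A₂ 1 = T - C := by
      refine (hdJ 0).unique hab ?_ ?_
      · have := hT.sub hCd
        simpa [insInt, iterInt] using this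
      · rw [hJ, Matrix.map_sub _ (map_sub _), hCa, sub_self]
    rw [zero_add, h]
    simp [insInt, iterInt]
  | succ q ih =>
    refine (hasTimeDerivMat_insInt_succ h1 hB h2 q).unique hab ?_ ?_
    · have := ((hdJ q).add (hdJ (q + 1))).sub ((hT.mul (hasTimeDerivMat_iterInt_succ h2 q)).sub
        ((hasTimeDerivMat_iterInt_succ h1 q).mul hCd))
      convert this using 1
      rw [ih]
      noncomm_ring
    -- At the initial time every integral of positive order vanishes, hence both sides do.
    · rw [hJ, Matrix.map_sub _ (map_sub _), Matrix.map_add _ (map_add _), hJ, hJ,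
        Matrix.map_sub _ (map_sub _), Matrix.map_mul, Matrix.map_mul, hI, hI]
      simp

/-- The ordered exponential `∑_q (-1)^q ∫ A ⋯ A` at the time `t`. -/
def orderedExp (A : Matrix ι ι (FormalFn k (tube a b L) L.deg)) (t : ℝ) (ht : t ∈ Set.Icc a b) :
    Matrix ι ι (FormalFn k L.body L.deg) :=
  Matrix.of fun α β => FormalFn.mk fun e v =>
    ∑' q : ℕ, (-1) ^ q * (iterInt A q α β).coeff e ⟨(t, v.1), ht, v.2⟩

/-- The coefficients of the alternating series of the values of `M q` at the time `t` converge to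
those of `S`. -/
def HasAltSum {κ κ' : Type*} (M : ℕ → Matrix κ κ' (FormalFn k L.body L.deg))
    (S : Matrix κ κ' (FormalFn k L.body L.deg)) : Prop :=
  ∀ α β e v, HasSum (fun q => (-1) ^ q * (M q α β).coeff e v) ((S α β).coeff e v)

theorem coeff_orderedExp (A : Matrix ι ι (FormalFn k (tube a b L) L.deg)) {t : ℝ}
    (ht : t ∈ Set.Icc a b) (α β : ι) (e : Fin L.n →₀ ℕ) (v : L.body) :
    (orderedExp A t ht α β).coeff e v =
      ∑' q : ℕ, (-1) ^ q * (iterInt A q α β).coeff e ⟨(t, v.1), ht, v.2⟩ := by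
  rw [orderedExp, Matrix.of_apply, coeff_mk']
  intro e he
  funext v
  simp [coeff_eq_zero _ he]

theorem hasAltSum_orderedExp {A : Matrix ι ι (FormalFn k (tube a b L) L.deg)}
    (hA : ∀ α β, TimeCont (A α β)) {t : ℝ} (ht : t ∈ Set.Icc a b) :
    HasAltSum (fun q => (iterInt A q).map (timeSlice t ht)) (orderedExp A t ht) := by
  intro α β e v
  rw [coeff_orderedExp]
  simp only [Matrix.map_apply, coeff_timeSlice]
  exact (summable_iterInt hA α β e v ht).hasSum

/-! ### Algebra of coefficientwise alternating sums -/

section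
variable {κ κ' κ'' : Type*} {M N : ℕ → Matrix κ κ' (FormalFn k L.body L.deg)}
  {S S' : Matrix κ κ' (FormalFn k L.body L.deg)}

theorem HasAltSum.sub (hM : HasAltSum M S) (hN : HasAltSum N S') :
    HasAltSum (fun q => M q - N q) (S - S') := fun α β e v => by
  simpa only [Matrix.sub_apply, coeff_sub, Pi.sub_apply, mul_sub] using
    (hM α β e v).sub (hN α β e v)

theorem HasAltSum.mul_left [Fintype κ] (C : Matrix κ'' κ (FormalFn k L.body L.deg))
    (hM : HasAltSum M S) : HasAltSum (fun q => C * M q) (C * S) := fun α β e v => by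
  by_cases he : Adm L.deg e
  · simp only [Matrix.mul_apply, FormalFn.coeff_sum, coeff_mul _ _ he, Finset.sum_apply,
      Pi.smul_apply, Pi.mul_apply, Finset.mul_sum]
    refine hasSum_sum fun γ _ => hasSum_sum fun p _ => ?_
    simpa only [mul_smul_comm, mul_left_comm] using
      ((hM γ β p.2 v).mul_left ((C α γ).coeff p.1 v)).const_smul (sgn (swap L.deg p.1 p.2))
  · simp [coeff_eq_zero _ he, hasSum_zero]

theorem HasAltSum.mul_right [Fintype κ'] (C : Matrix κ' κ'' (FormalFn k L.body L.deg))
    (hM : HasAltSum M S) : HasAltSum (fun q => M q * C) (S * C) := fun α β e v => by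
  by_cases he : Adm L.deg e
  · simp only [Matrix.mul_apply, FormalFn.coeff_sum, coeff_mul _ _ he, Finset.sum_apply,
      Pi.smul_apply, Pi.mul_apply, Finset.mul_sum]
    refine hasSum_sum fun γ _ => hasSum_sum fun p _ => ?_
    simpa only [mul_smul_comm, mul_assoc] using
      ((hM α γ p.1 v).mul_right ((C γ β).coeff p.2 v)).const_smul (sgn (swap L.deg p.1 p.2))
  · simp [coeff_eq_zero _ he, hasSum_zero]

/-- With its zeroth term absent, the series shifted by one index has the same sum up to the sign of
the alternation, so the two contributions cancel. -/
theorem HasAltSum.add_succ (hM : HasAltSum M S) (h0 : M 0 = 0) :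
    HasAltSum (fun q => M q + M (q + 1)) 0 := fun α β e v => by
  have h1 := hM α β e v
  have h2 := (hasSum_nat_add_iff' 1).2 h1
  simp only [Finset.range_one, Finset.sum_singleton, h0, Matrix.zero_apply, coeff_zero,
    Pi.zero_apply, mul_zero, sub_zero] at h2
  have h3 := h1.sub h2
  rw [sub_self] at h3
  change HasSum _ (0 : k)
  refine (congrArg (HasSum · (0 : k)) (funext fun q => ?_)).mpr h3
  simp only [Matrix.add_apply, coeff_add, Pi.add_apply, pow_succ]
  ring

end

/-- Only the existence of a sum matters here; its value drops out in the telescoping. -/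
theorem hasAltSum_insInt (h1 : ∀ α β, TimeCont (A₁ α β)) (hB : ∀ α β, TimeCont (B α β))
    (h2 : ∀ α β, TimeCont (A₂ α β)) {t : ℝ} (ht : t ∈ Set.Icc a b) :
    HasAltSum (fun q => (insInt A₁ B A₂ q).map (timeSlice t ht))
      (orderedExp (Matrix.fromBlocks A₁ B 0 A₂) t ht).toBlocks₁₂ := by
  intro α β e v
  have := hasAltSum_orderedExp (timeCont_fromBlocks h1 hB h2) ht (Sum.inl α) (Sum.inr β) e v
  simp only [iterInt_fromBlocks] at this
  exact this

/-- The variation of an ordered exponential by a gauge transformation. -/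
theorem hasAltSum_insInt_gauge (hab : a < b)
    {T E : Matrix ι ι (FormalFn k (tube a b L) L.deg)}
    (h1 : ∀ α β, TimeCont (A₁ α β)) (h2 : ∀ α β, TimeCont (A₂ α β))
    (hT : HasTimeDerivMat T E) (hE : ∀ α β, TimeCont (E α β)) {t : ℝ} (ht : t ∈ Set.Icc a b) :
    HasAltSum (fun q => (insInt A₁ (E + A₁ * T - T * A₂) A₂ q).map (timeSlice t ht))
      (-(T.map (timeSlice t ht) * orderedExp A₂ t ht) +
        orderedExp A₁ t ht * T.map (timeSlice a (Set.left_mem_Icc.2 hab.le))) := by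
  have hC : ((T.map (timeSlice a (Set.left_mem_Icc.2 hab.le))).map timeConst :
      Matrix ι ι (FormalFn k (tube a b L) L.deg)).map (timeSlice t ht) =
      T.map (timeSlice a (Set.left_mem_Icc.2 hab.le)) := by
    ext1 α β
    exact timeSlice_timeConst _ ht _
  -- Of the three contributions in `insInt_gauge`, the insertions of `E` sum to zero and the two
  -- boundary terms sum to ordered exponentials.
  have h3 := ((hasAltSum_insInt h1 hE h2 ht).add_succ (Matrix.map_zero _ (map_zero _))).sub
    (((hasAltSum_orderedExp h2 ht).mul_left (T.map (timeSlice t ht))).sub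
      ((hasAltSum_orderedExp h1 ht).mul_right
        (T.map (timeSlice a (Set.left_mem_Icc.2 hab.le)))))
  convert h3 using 1
  · funext q
    rw [insInt_gauge hab h1 h2 hT hE, Matrix.map_sub _ (map_sub _), Matrix.map_add _ (map_add _),
      Matrix.map_sub _ (map_sub _), Matrix.map_mul, Matrix.map_mul, hC]
  · abel

end Insertion

/-! ### The variation of the Wilson line -/

/-! ### Smooth superfields along the time direction -/

section Smooth
variable {k : Type*} [RCLike k] {a b : ℝ} {L : GDomain} {n : ℕ} {deg : Fin n → ℤ}

theorem timeCont_of_isSmooth {f : FormalFn k (tube a b L) deg} (hf : ∀ e, IsSmooth (f.coeff e)) :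
    TimeCont f := fun e v =>
  (ContDiffOn.continuousOn (hf e)).comp (by fun_prop) fun _ hs => ⟨hs, v.2⟩

theorem hasTimeDeriv_of_isSmooth {f : FormalFn k (tube a b L) deg}
    (hf : ∀ e, IsSmooth (f.coeff e)) : HasTimeDeriv f (mapCoeff dtFn f) := by
  intro e v t ht
  have h1 := ((hf e).diff ⟨(t, v.1), ht, v.2⟩).hasFDerivWithinAt
  have h2 : HasDerivWithinAt (fun s : ℝ => (s, v.1)) ((1 : ℝ), (0 : EuclideanSpace ℝ (Fin L.m)))
      (Set.Icc a b) t :=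
    (hasDerivWithinAt_id t _).prodMk (hasDerivWithinAt_const t _ _)
  have h3 := h1.comp_hasDerivWithinAt t h2 (fun s hs => Set.mk_mem_prod hs v.2)
  rw [timeFn_apply _ _ _ ht, coeff_mapCoeff dtFn_zero]
  exact h3

end Smooth

/-! ### Twist and grading of ordered exponentials -/

section Twist
variable {k : Type*} [RCLike k] {a b : ℝ} {L : GDomain}
variable {ι : Type*} [Fintype ι] [DecidableEq ι] {lev : ι → ℤ}

theorem primitive_sgn_smul (m : ℤ) (f : FormalFn k (tube a b L) L.deg) :
    primitive (sgn m • f) = sgn m • primitive f := by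
  refine FormalFn.ext fun e _ => funext fun x => ?_
  rw [coeff_zsmul, Pi.smul_apply, coeff_primitive, coeff_primitive, timeFn_zsmul]
  rcases Int.even_or_odd m with h | h
  · simp [sgn_of_even h]
  · simp [sgn_of_odd h]

theorem iterInt_twist (A : Matrix ι ι (FormalFn k (tube a b L) L.deg)) (q : ℕ) :
    iterInt (twist lev A) q = twist lev (iterInt A q) := by
  induction q with
  | zero => exact (twist_one lev).symm
  | succ q ih =>
    rw [iterInt, ih, ← twist_mul, iterInt]
    ext1 α β
    exact primitive_sgn_smul _ _

/-- The later factors in a varied exponential are all twisted; this identifies their ordered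
exponential with the twist of the original one. -/
theorem orderedExp_twist (A : Matrix ι ι (FormalFn k (tube a b L) L.deg)) {t : ℝ}
    (ht : t ∈ Set.Icc a b) : orderedExp (twist lev A) t ht = twist lev (orderedExp A t ht) := by
  ext1 α β
  refine FormalFn.ext fun e _ => funext fun v => ?_
  rw [coeff_orderedExp]
  rw [twist_apply, coeff_zsmul, Pi.smul_apply, coeff_orderedExp]
  simp only [iterInt_twist, twist_apply, coeff_zsmul, Pi.smul_apply]
  rcases Int.even_or_odd (lev α + lev β) with h | h
  · simp [sgn_of_even h]
  · simp [sgn_of_odd h, tsum_neg]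

theorem HomogMat.iterInt {A : Matrix ι ι (FormalFn k (tube a b L) L.deg)}
    (hA : HomogMat lev 0 A) (q : ℕ) : HomogMat lev 0 (WilsonLine.iterInt A q) := by
  induction q with
  | zero => exact HomogMat.one
  | succ q ih =>
    intro α β e he
    funext x
    have h := hA.mul ih α β e (by simpa using he)
    rw [WilsonLine.iterInt, Matrix.map_apply, coeff_primitive]
    simp [timeFn, h, extZ_zero]

theorem HomogMat.orderedExp {A : Matrix ι ι (FormalFn k (tube a b L) L.deg)}
    (hA : HomogMat lev 0 A) {t : ℝ} (ht : t ∈ Set.Icc a b) :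
    HomogMat lev 0 (WilsonLine.orderedExp A t ht) := by
  intro α β e he
  funext v
  rw [coeff_orderedExp]
  simp [hA.iterInt _ α β e he]

end Twist

/-! ### Ordered exponentials with an `ε`-part -/

section DualIntegrals
variable {k : Type*} [RCLike k] {a b : ℝ} {L : GDomain}
variable {ι : Type*} [Fintype ι] [DecidableEq ι] {lev : ι → ℤ}

theorem GDomain.eps_deg_zero_odd (L : GDomain) : Odd (L.eps.deg 0) := ⟨-1, by simp⟩

theorem kill_primitive (f : FormalFn k (tube a b L.eps) L.eps.deg) :
    (kill 0 (primitive f) : FormalFn k (tube a b L) L.deg) = primitive (kill 0 f) := by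
  refine FormalFn.ext fun e _ => funext fun x => ?_
  rw [coeff_kill L.eps_deg, coeff_primitive, coeff_primitive]
  simp only [timeFn, coeff_kill L.eps_deg]

theorem leftCoeff_primitive (f : FormalFn k (tube a b L.eps) L.eps.deg) :
    (leftCoeff (primitive f) : FormalFn k (tube a b L) L.deg) = primitive (leftCoeff f) := by
  refine FormalFn.ext fun e _ => funext fun x => ?_
  rw [leftCoeff_coeff L.eps_deg, coeff_primitive, coeff_primitive]
  simp only [timeFn, leftCoeff_coeff L.eps_deg]

/-- At most one factor can supply `ε`. Moving that `ε` to the far left crosses all the later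
factors, which explains `A.map parity` in front of the insertion and plain `A` behind it. -/
theorem iterInt_dualMat (A B : Matrix ι ι (FormalFn k (tube a b L) L.deg)) (q : ℕ) :
    iterInt (dualMat A B : Matrix ι ι (FormalFn k (tube a b L.eps) L.eps.deg)) q =
      (dualMat (iterInt A q) (insInt (A.map parity) B A q) :
        Matrix ι ι (FormalFn k (tube a b L.eps) L.eps.deg)) := by
  induction q with
  | zero => exact (dualMat_one L.eps_deg).symm
  | succ q ih =>
    rw [iterInt, ih, dualMat_mul L.eps_deg L.eps_deg_zero_odd]
    ext1 α β
    refine dual_ext L.eps_deg L.eps_deg_zero_odd ?_ ?_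
    · rw [Matrix.map_apply, kill_primitive, kill_dualMat L.eps_deg, kill_dualMat L.eps_deg,
        iterInt, Matrix.map_apply]
    · rw [Matrix.map_apply, leftCoeff_primitive, leftCoeff_dualMat L.eps_deg,
        leftCoeff_dualMat L.eps_deg, insInt, Matrix.map_apply, add_comm]

/-- The ordered exponential of `A + ε B`, where `B` is a gauge transformation of `A`. -/
theorem orderedExp_dualMat (hab : a < b)
    {A T E : Matrix ι ι (FormalFn k (tube a b L) L.deg)} (hh : HomogMat lev 0 A)
    (hA : ∀ α β, TimeCont (A α β)) (hT : HasTimeDerivMat T E) (hE : ∀ α β, TimeCont (E α β))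
    {t : ℝ} (ht : t ∈ Set.Icc a b) :
    orderedExp (dualMat A (E + twist lev A * T - T * A) :
        Matrix ι ι (FormalFn k (tube a b L.eps) L.eps.deg)) t ht =
      (dualMat (orderedExp A t ht) (-(T.map (timeSlice t ht) * orderedExp A t ht) +
        twist lev (orderedExp A t ht) * T.map (timeSlice a (Set.left_mem_Icc.2 hab.le))) :
        Matrix ι ι (FormalFn k L.eps.body L.eps.deg)) := by
  have hA' : ∀ α β, TimeCont (twist lev A α β) := fun α β => (hA α β).zsmul _
  ext1 α β
  refine dual_ext L.eps_deg L.eps_deg_zero_odd ?_ ?_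
  · refine FormalFn.ext fun e _ => funext fun v => ?_
    rw [coeff_kill L.eps_deg, coeff_orderedExp, kill_dualMat L.eps_deg, coeff_orderedExp]
    refine tsum_congr fun q => ?_
    rw [← coeff_kill L.eps_deg, iterInt_dualMat, kill_dualMat L.eps_deg]
  · refine FormalFn.ext fun e _ => funext fun v => ?_
    -- The `ε`-coefficient is the alternating series of gauge insertions between `twist lev A` and
    -- `A`, whose sum is already known.
    rw [leftCoeff_coeff L.eps_deg, coeff_orderedExp, leftCoeff_dualMat L.eps_deg,
      ← orderedExp_twist, ← (hasAltSum_insInt_gauge hab hA' hA hT hE ht α β e v).tsum_eq]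
    refine tsum_congr fun q => ?_
    rw [← leftCoeff_coeff L.eps_deg, iterInt_dualMat, leftCoeff_dualMat L.eps_deg,
      hh.map_parity]
    simp only [Matrix.map_apply, coeff_timeSlice]

end DualIntegrals

/-! ### The variation of `∂_θ 𝑻` along a super-curve -/

section Variation
variable {k : Type u} [RCLike k] {a b : ℝ} {L : GDomain}
variable {ι : Type*} [Fintype ι] [DecidableEq ι] {lev : ι → ℤ}

theorem ins_zero_apply_one {n : ℕ} (y : ℕ) (e : Fin (n + 1) →₀ ℕ) :
    ins 0 y e (1 : Fin (n + 2)) = e 0 :=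
  ins_succAbove (0 : Fin (n + 2)) y e 0

/-- Index bookkeeping: on `T[1][a,b] × L × {ε}` the generators are `θ`, `ε`, then those of `L`, so
`ε` has index `1` before and index `0` after `θ` is removed. -/
theorem del_one_ins_zero {n : ℕ} (y : ℕ) (e : Fin (n + 1) →₀ ℕ) :
    del (1 : Fin (n + 2)) (ins 0 y e) = ins 0 y (del 0 e) := by
  ext i
  refine Fin.cases ?_ (fun j => ?_) i
  · rw [del_apply, show (1 : Fin (n + 2)).succAbove 0 = 0 by simp, ins_same, ins_same]
  · rw [del_apply, show (1 : Fin (n + 2)) = (0 : Fin (n + 1)).succ from rfl,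
      Fin.succ_succAbove_succ]
    have e1 := ins_succAbove (0 : Fin (n + 2)) y e ((0 : Fin (n + 1)).succAbove j)
    have e2 := ins_succAbove (0 : Fin (n + 1)) y (del (0 : Fin (n + 1)) e) j
    rw [del_apply] at e2
    rw [Fin.zero_succAbove] at e1 e2
    rw [e1, e2, Fin.zero_succAbove]

theorem leftCoeff_push_one (f : FormalFn k (tube a b L) (sdeg L)) :
    (leftCoeff (push 1 f : FormalFn k (tube a b L.eps) (sdeg L.eps)) :
      FormalFn k (tube a b L.eps) L.eps.deg) = push 0 (leftCoeff f : FormalFn k (tube a b L) L.deg) := by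
  refine FormalFn.ext fun e _ => ?_
  rw [leftCoeff_coeff (sdeg_succAbove L.eps), coeff_push (sdeg_eps L), coeff_push L.eps_deg,
    ins_zero_apply_one, del_one_ins_zero, leftCoeff_coeff (sdeg_succAbove L)]

/-- To extract `θ` on the left it must cross `ε`; both are odd, hence the minus sign. -/
theorem leftCoeff_gen_one_mul (f : FormalFn k (tube a b L.eps) (sdeg L.eps)) :
    (leftCoeff (gen 1 * f) : FormalFn k (tube a b L.eps) L.eps.deg) = -(gen 0 * leftCoeff f) := by
  have h0 : (leftCoeff (gen 1 : FormalFn k (tube a b L.eps) (sdeg L.eps)) :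
      FormalFn k (tube a b L.eps) L.eps.deg) = 0 := by
    refine FormalFn.ext fun e _ => ?_
    rw [leftCoeff_coeff (sdeg_succAbove L.eps), coeff_gen, if_neg]
    · rfl
    · intro h
      have := DFunLike.congr_fun h 0
      simp at this
  have h1 : (kill 0 (gen 1 : FormalFn k (tube a b L.eps) (sdeg L.eps)) :
      FormalFn k (tube a b L.eps) L.eps.deg) = gen 0 :=
    kill_gen_succ (sdeg_succAbove L.eps) 0
  have h2 : parity (gen 0 : FormalFn k (tube a b L.eps) L.eps.deg) = -gen 0 := by
    rw [(isHomog_gen 0).parity_eq, sgn_of_odd L.eps_deg_zero_odd, neg_one_zsmul]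
  rw [leftCoeff_mul (sdeg_succAbove L.eps) (sdeg_zero_odd L.eps), h0, h1, h2, zero_mul, zero_add,
    neg_mul]

theorem push_neg {n : ℕ} {X : Type*} {deg : Fin n → ℤ} {deg' : Fin (n + 1) → ℤ}
    {p : Fin (n + 1)} (h : ∀ i, deg' (p.succAbove i) = deg i) (f : FormalFn k X deg) :
    (push p (-f) : FormalFn k X deg') = -push p f := by
  rw [← neg_one_smul k f, push_smul h, neg_one_smul]

/-- The flatness of the representation in terms of `T`. -/
theorem RepChart.Q_T (P : RepChart k lev) (α β : ι) :
    P.Q (P.T α β) = -∑ γ, sgn (lev α + lev γ) • (P.T α γ * P.T γ β) := by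
  have h := P.flat α β
  rw [add_eq_zero_iff_eq_neg] at h
  simp only [RepChart.T]
  rw [map_zsmul, h, smul_neg, Finset.smul_sum]
  congr 1
  refine Finset.sum_congr rfl fun γ _ => ?_
  rw [smul_mul_smul_comm, smul_smul, smul_smul, ← sgn_add, ← sgn_add, ← sgn_add]
  congr 1
  have hg := Int.even_mul_succ_self (lev γ)
  -- The sign exponents on the two sides differ by `γ(γ+1)` plus a multiple of two, which is even.
  rw [show lev β * lev α + lev α + (lev α + lev γ) * (1 + lev γ + lev β) =
      (lev α + lev γ + (lev γ * lev α + lev α + (lev β * lev γ + lev γ))) +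
      ((lev γ * (lev γ + 1)) + 2 * (lev α * lev β - lev γ)) by ring, sgn_add,
    sgn_of_even (hg.add (even_two_mul _)), mul_one]

/-- The matrix `𝑻|_{θ=0}` along a super-curve. -/
def bodyT (P : RepChart k lev) (φ : SuperCurve P.toNQChart a b L) :
    Matrix ι ι (FormalFn k (tube a b L) L.deg) :=
  Matrix.of fun α β => kill 0 (φ (P.T α β)).1

/-- The time derivative of `𝑻|_{θ=0}` along a super-curve. -/
def dtBodyT (P : RepChart k lev) (hab : a < b) (φ : SuperCurve P.toNQChart a b L) :
    Matrix ι ι (FormalFn k (tube a b L) L.deg) :=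
  Matrix.of fun α β => kill 0 (dt hab (φ (P.T α β))).1

variable (P : RepChart k lev) (hab : a < b) (φ : SuperCurve P.toNQChart a b L)

theorem timeCont_thetaT (α β : ι) : TimeCont (thetaT P φ α β) :=
  timeCont_of_isSmooth fun e => by
    rw [thetaT, Matrix.of_apply, leftCoeff_coeff (sdeg_succAbove L)]
    exact (φ (P.T α β)).2 _

theorem timeCont_dtBodyT (α β : ι) : TimeCont (dtBodyT P hab φ α β) :=
  timeCont_of_isSmooth fun e => by
    rw [dtBodyT, Matrix.of_apply, coeff_kill (sdeg_succAbove L)]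
    exact (dt hab (φ (P.T α β))).2 _

theorem hasTimeDerivMat_bodyT : HasTimeDerivMat (bodyT P φ) (dtBodyT P hab φ) := fun α β => by
  have h : dtBodyT P hab φ α β = mapCoeff dtFn (bodyT P φ α β) := by
    refine FormalFn.ext fun e _ => ?_
    rw [coeff_mapCoeff dtFn_zero, bodyT, dtBodyT, Matrix.of_apply, Matrix.of_apply,
      coeff_kill (sdeg_succAbove L), coeff_kill (sdeg_succAbove L), dt,
      coeff_mapCoeff dtFn_zero]
  rw [h]
  refine hasTimeDeriv_of_isSmooth fun e => ?_
  rw [bodyT, Matrix.of_apply, coeff_kill (sdeg_succAbove L)]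
  exact (φ (P.T α β)).2 _

theorem homogMat_thetaT : HomogMat lev 0 (thetaT P φ) := fun α β => by
  have h := (φ.map_homog (P.T_homog α β)).leftCoeff (sdeg_succAbove L)
  rw [show (1 + lev β - lev α - sdeg L 0 : ℤ) = 0 + lev β - lev α by simp [sdeg]; ring] at h
  exact h

/-- The entries of `T` have degree `1 + β - α`, so parity is minus the twist. The extra minus sign
produces the commutator form of the gauge transformation. -/
theorem parity_bodyT (α β : ι) :
    parity (bodyT P φ α β) = -(sgn (lev α + lev β) • bodyT P φ α β) := by
  have h := ((φ.map_homog (P.T_homog α β)).kill (sdeg_succAbove L)).parity_eq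
  rw [show (1 + lev β - lev α : ℤ) = 1 + (lev α + lev β) + 2 * (-lev α) by ring, sgn_add,
    sgn_of_even (even_two_mul _), mul_one, sgn_add, sgn_of_odd odd_one, neg_one_mul, neg_smul] at h
  exact h

/-- By flatness, `Q` turns `𝑻` into minus a sign-weighted square of `𝑻`. Taking its `θ`-coefficient
by the odd Leibniz rule, `θ` from the left factor gives `twist A * T` and from the right factor `-T
* A`; the de Rham term gives the time derivative. The overall minus is the one caused by exchanging
`θ` and `ε`. -/
theorem leftCoeff_brst_T (α β : ι) :
    -(leftCoeff (φ.brst hab (P.T α β)).1 : FormalFn k (tube a b L) L.deg) =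
      (dtBodyT P hab φ + twist lev (thetaT P φ) * bodyT P φ - bodyT P φ * thetaT P φ) α β := by
  have h1 : (φ.brst hab (P.T α β)).1 =
      -(∑ γ, sgn (lev α + lev γ) • ((φ (P.T α γ)).1 * (φ (P.T γ β)).1)) -
        gen 0 * (dt hab (φ (P.T α β))).1 := by
    change (φ (P.Q (P.T α β))).1 - gen 0 * (dt hab (φ (P.T α β))).1 = _
    rw [P.Q_T, map_neg, map_sum]
    simp only [map_zsmul, map_mul]
    simp
  rw [h1, leftCoeff_sub (sdeg_succAbove L), leftCoeff_gen_mul (sdeg_succAbove L),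
    leftCoeff_neg (sdeg_succAbove L), leftCoeff_sum (sdeg_succAbove L)]
  have h2 : ∀ γ, (leftCoeff (sgn (lev α + lev γ) • ((φ (P.T α γ)).1 * (φ (P.T γ β)).1)) :
      FormalFn k (tube a b L) L.deg) = twist lev (thetaT P φ) α γ * bodyT P φ γ β -
        bodyT P φ α γ * thetaT P φ γ β := by
    intro γ
    have h3 := parity_bodyT P φ α γ
    rw [bodyT, Matrix.of_apply] at h3
    rw [leftCoeff_zsmul (sdeg_succAbove L),
      leftCoeff_mul (sdeg_succAbove L) (sdeg_zero_odd L), h3]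
    simp only [twist, thetaT, bodyT, Matrix.of_apply, smul_add, neg_mul, smul_neg, smul_mul_assoc,
      smul_smul, sgn_mul_self, one_smul, sub_eq_add_neg]
  simp only [h2, Finset.sum_sub_distrib, Matrix.sub_apply, Matrix.add_apply, Matrix.mul_apply]
  simp only [dtBodyT, Matrix.of_apply]
  abel

theorem thetaT_displace : thetaT P (φ.displace hab) =
    (dualMat (thetaT P φ) (dtBodyT P hab φ + twist lev (thetaT P φ) * bodyT P φ -
      bodyT P φ * thetaT P φ) : Matrix ι ι (FormalFn k (tube a b L.eps) L.eps.deg)) := by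
  ext1 α β
  have h1 : (φ.displace hab (P.T α β)).1 = push 1 (φ (P.T α β)).1 +
    gen 1 * push 1 (φ.brst hab (P.T α β)).1 := rfl
  rw [thetaT, Matrix.of_apply, h1, leftCoeff_add (sdeg_succAbove L.eps), leftCoeff_gen_one_mul,
    leftCoeff_push_one, leftCoeff_push_one, dualMat, Matrix.of_apply, ← leftCoeff_brst_T, dual,
    push_neg L.eps_deg, mul_neg]
  rfl

theorem homogMat_wilson : HomogMat lev 0 (wilson P hab φ) :=
  (homogMat_thetaT P φ).orderedExp (Set.right_mem_Icc.2 hab.le)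

/-- The Wilson line of the displaced super-curve. -/
theorem wilson_displace : wilson P hab (φ.displace hab) =
    (dualMat (wilson P hab φ)
      (-((Matrix.of fun α β => (repAt P b (Set.right_mem_Icc.2 hab.le) φ α β).1) *
          wilson P hab φ) +
        twist lev (wilson P hab φ) *
          Matrix.of fun α β => (repAt P a (Set.left_mem_Icc.2 hab.le) φ α β).1) :
      Matrix ι ι (FormalFn k L.eps.body L.eps.deg)) := by
  -- By definition `wilson` is the ordered exponential of `thetaT` at time `b`, and `repAt` is the
  -- time slice of `bodyT`, so the general formula applies verbatim.
  have h := orderedExp_dualMat hab (homogMat_thetaT P φ) (timeCont_thetaT P φ)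
    (hasTimeDerivMat_bodyT P hab φ) (timeCont_dtBodyT P hab φ) (Set.right_mem_Icc.2 hab.le)
  rw [← thetaT_displace] at h
  exact h

theorem summable_wilsonTerm (α β : ι) (e : Fin L.n →₀ ℕ) (v : L.body) :
    Summable (wilsonTerm P hab φ α β e v) :=
  summable_iterInt (timeCont_thetaT P φ) α β e v (Set.right_mem_Icc.2 hab.le)

end Variation

/-! ### Parallel transport and its variation -/

section Transport
variable {k : Type u} [RCLike k] {L : GDomain}
variable {ι : Type*} [Fintype ι] [DecidableEq ι] {lev : ι → ℤ}

/-- The matrix `X`, displaced to `X'`, is of degree `0` and transforms under the displacement as a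
parallel transport between points at which the representation matrices are `T₀` and `T₁`. -/
def IsTransport (lev : ι → ℤ) (T₁ T₀ X : Matrix ι ι (FormalFn k L.body L.deg))
    (X' : Matrix ι ι (FormalFn k L.eps.body L.eps.deg)) : Prop :=
  HomogMat lev 0 X ∧ X' = dualMat X (-(T₁ * X) + twist lev X * T₀)

variable {T₂ T₁ T₀ X Y : Matrix ι ι (FormalFn k L.body L.deg)}
  {X' Y' : Matrix ι ι (FormalFn k L.eps.body L.eps.deg)}

/-- In the product rule the intermediate contributions `twist X * T₁ * Y` occur with opposite signs:
once from the right end of `X`, once from the left end of `Y`. -/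
theorem IsTransport.mul (hX : IsTransport lev T₂ T₁ X X') (hY : IsTransport lev T₁ T₀ Y Y') :
    IsTransport lev T₂ T₀ (X * Y) (X' * Y') := by
  refine ⟨by simpa using hX.1.mul hY.1, ?_⟩
  rw [hX.2, hY.2, dualMat_mul L.eps_deg L.eps_deg_zero_odd, hX.1.map_parity, twist_mul]
  congr 1
  noncomm_ring

theorem IsTransport.leftCoeff_apply (hX : IsTransport lev T₁ T₀ X X') (α β : ι) :
    (leftCoeff (X' α β) : FormalFn k L.body L.deg) =
      -(∑ δ, T₁ α δ * X δ β) + ∑ γ, sgn (lev α + lev γ) • (X α γ * T₀ γ β) := by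
  rw [hX.2, leftCoeff_dualMat L.eps_deg, Matrix.add_apply, Matrix.neg_apply, Matrix.mul_apply,
    Matrix.mul_apply]
  simp only [twist_apply, smul_mul_assoc]

/-- The supertrace of the transport around a closed curve is invariant. -/
theorem IsTransport.leftCoeff_supertrace (hX : IsTransport lev T₀ T₀ X X')
    (hT : HomogMat lev 1 T₀) :
    (leftCoeff (∑ α, sgn (lev α) • X' α α) : FormalFn k L.body L.deg) = 0 := by
  -- With `d = α - γ` the two entries have degrees `d` and `1 - d`; since `d(1 - d)` is even, they
  -- commute without a sign.
  have hc : ∀ α γ, X γ α * T₀ α γ = T₀ α γ * X γ α := fun α γ => by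
    rw [(hX.1 γ α).mul_comm_sgn (hT α γ), sgn_of_even, one_smul]
    have := Int.even_mul_succ_self (lev α - lev γ)
    rw [show (0 + lev α - lev γ) * (1 + lev γ - lev α) =
      -((lev α - lev γ) * (lev α - lev γ + 1)) + 2 * (lev α - lev γ) by ring]
    exact this.neg.add (even_two_mul _)
  have hs : ∀ α γ, sgn (lev α) * sgn (lev α + lev γ) = sgn (lev γ) := fun α γ => by
    rw [sgn_add, ← mul_assoc, sgn_mul_self, one_mul]
  rw [leftCoeff_sum L.eps_deg]
  simp only [leftCoeff_zsmul L.eps_deg, hX.leftCoeff_apply, smul_add, smul_neg, Finset.smul_sum,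
    smul_smul, hs, Finset.sum_add_distrib, Finset.sum_neg_distrib]
  rw [neg_add_eq_zero]
  -- After the signs are simplified, the boundary terms of the two ends differ only by exchanging
  -- the two summation indices and commuting the factors.
  conv_rhs => rw [Finset.sum_comm]
  exact Finset.sum_congr rfl fun α _ => Finset.sum_congr rfl fun γ _ => by rw [hc]

/-- The contraction of a transport with sections at its end points is invariant. -/
theorem IsTransport.leftCoeff_contract (hX : IsTransport lev T₁ T₀ X X')
    {z w : ι → FormalFn k L.body L.deg} (hz : ∀ α, IsHomog (lev α) (z α)) :
    (leftCoeff (∑ α, ∑ β, dual (z α) (∑ γ, sgn (lev γ) • (z γ * T₁ γ α)) * X' α β *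
      dual (w β) (-∑ γ, T₀ β γ * w γ) : FormalFn k L.eps.body L.eps.deg) :
        FormalFn k L.body L.deg) = 0 := by
  -- The `ε`-coefficient consists of two pairs: the variation of `z` against the `T₁` term of `X`,
  -- and the `T₀` term of `X` against the variation of `w`. Each pair cancels only after summation,
  -- by relabelling indices.
  have hterm : ∀ α β, (leftCoeff (dual (z α) (∑ γ, sgn (lev γ) • (z γ * T₁ γ α)) * X' α β *
      dual (w β) (-∑ γ, T₀ β γ * w γ) : FormalFn k L.eps.body L.eps.deg) :
        FormalFn k L.body L.deg) =
      (∑ γ, sgn (lev γ) • (z γ * T₁ γ α * X α β * w β) -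
        ∑ γ, sgn (lev α) • (z α * T₁ α γ * X γ β * w β)) +
      (∑ γ, sgn (lev γ) • (z α * X α γ * T₀ γ β * w β) -
        ∑ γ, sgn (lev β) • (z α * X α β * T₀ β γ * w γ)) := by
    intro α β
    -- The product has degree `α + (β - α) = β`, whence the sign incurred when `ε` in front of the
    -- variation of `w` is moved to the left.
    have hp : parity (z α * X α β) = sgn (lev β) • (z α * X α β) := by
      rw [((hz α).mul (hX.1 α β)).parity_eq]
      congr 2
      ring
    have hs : ∀ γ, sgn (lev α) * sgn (lev α + lev γ) = sgn (lev γ) := fun γ => by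
      rw [sgn_add, ← mul_assoc, sgn_mul_self, one_mul]
    have hx : X' α β = dual (X α β) (leftCoeff (X' α β)) := by
      have := dual_kill_leftCoeff L.eps_deg L.eps_deg_zero_odd (X' α β)
      rwa [show (kill 0 (X' α β) : FormalFn k L.body L.deg) = X α β by
        rw [hX.2, kill_dualMat L.eps_deg], eq_comm] at this
    rw [hx, dual_mul L.eps_deg L.eps_deg_zero_odd, dual_mul L.eps_deg L.eps_deg_zero_odd,
      leftCoeff_dual L.eps_deg, hp, (hz α).parity_eq, hX.leftCoeff_apply]
    simp only [Finset.sum_mul, Finset.mul_sum, add_mul, mul_add, neg_mul, mul_neg,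
      smul_mul_assoc, mul_smul_comm, smul_smul, mul_assoc]
    simp only [mul_comm (sgn (lev α + _)) (sgn (lev α)), hs]
    abel
  rw [leftCoeff_sum L.eps_deg]
  simp only [leftCoeff_sum L.eps_deg, hterm, Finset.sum_add_distrib, Finset.sum_sub_distrib]
  have e1 : ∑ α, ∑ β, ∑ γ, sgn (lev γ) • (z γ * T₁ γ α * X α β * w β) =
      ∑ α, ∑ β, ∑ γ, sgn (lev α) • (z α * T₁ α γ * X γ β * w β) := by
    rw [Finset.sum_comm]
    conv_rhs => rw [Finset.sum_comm]
    exact Finset.sum_congr rfl fun β _ => Finset.sum_comm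
  have e2 : ∑ α, ∑ β, ∑ γ, sgn (lev γ) • (z α * X α γ * T₀ γ β * w β) =
      ∑ α, ∑ β, ∑ γ, sgn (lev β) • (z α * X α β * T₀ β γ * w γ) :=
    Finset.sum_congr rfl fun α _ => Finset.sum_comm
  rw [e1, e2, sub_self, sub_self, add_zero]

/-- Stated for an arbitrary space of fields, so that it serves single-patch and spliced Wilson lines
alike; the displaced end-point coordinates are dual elements of the form treated in
`IsTransport.leftCoeff_contract`. -/
theorem deltaB_contract {S : FieldSpace.{w}} (T₁ T₀ : ∀ L, S.Pt L → ι → ι → L.C k)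
    (h1 : ∀ L p α β, IsHomog (1 + lev β - lev α) (T₁ L p α β).1)
    (h0 : ∀ L p α β, IsHomog (1 + lev β - lev α) (T₀ L p α β).1)
    (U : ∀ L, S.Pt L → Matrix ι ι (FormalFn k L.body L.deg))
    (hU : ∀ L p, IsTransport lev (Matrix.of fun α β => (T₁ L p α β).1)
      (Matrix.of fun α β => (T₀ L p α β).1) (U L p) (U L.eps (S.displace L p))) :
    (endSpace k lev S T₁ T₀ h1 h0).deltaB (contract (X := S) U) = 0 := by
  funext L p
  have h := (hU L p.base).leftCoeff_contract (z := fun α => (p.low α).1)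
    (w := fun α => (p.up α).1) p.low_homog
  refine Eq.trans (congrArg leftCoeff ?_) h
  refine Finset.sum_congr rfl fun α _ => Finset.sum_congr rfl fun β _ => ?_
  congr 1
  · congr 1
    change push 0 _ + gen 0 * push 0 (∑ β, sgn (lev β) • (p.low β * T₁ L p.base β α) : L.C k).1 = _
    simp [dual]
  · change push 0 _ + gen 0 * push 0 (-∑ γ, T₀ L p.base β γ * p.up γ : L.C k).1 = _
    simp [dual]

theorem isTransport_wilson (P : RepChart k lev) {a b : ℝ} (hab : a < b)
    (φ : SuperCurve P.toNQChart a b L) :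
    IsTransport lev (Matrix.of fun α β => (repAt P b (Set.right_mem_Icc.2 hab.le) φ α β).1)
      (Matrix.of fun α β => (repAt P a (Set.left_mem_Icc.2 hab.le) φ α β).1)
      (wilson P hab φ) (wilson P hab (φ.displace hab)) :=
  ⟨homogMat_wilson P hab φ, wilson_displace P hab φ⟩

theorem Transition.Q_Ω {P P' : RepChart k lev} (τ : Transition P P') (γ α : ι) :
    τ.ovl.Q (τ.Ω γ α) = -∑ β, τ.res (P.T γ β) * τ.Ω β α +
      ∑ β, sgn (lev γ + lev β) • (τ.Ω γ β * τ.res' (P'.T β α)) := by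
  have h := τ.gauge γ α
  rw [← eq_sub_iff_add_eq] at h
  rw [← one_smul ℤ (τ.ovl.Q (τ.Ω γ α)), ← sgn_mul_self (lev γ), ← smul_smul, h, smul_sub,
    Finset.smul_sum, Finset.smul_sum]
  simp only [smul_smul, sgn_mul_self, one_smul, sgn_add]
  abel

/-- The compatibility condition, solved for `Q Ω`, has the form of the Wilson line variation: the
later patch acts from the left, the earlier one from the right with a twist. A junction thus behaves
as a transport over no time. -/
theorem isTransport_transition {P P' : RepChart k lev} (τ : Transition P P')
    (ψ : GHom k τ.ovl.body τ.ovl.deg L.body L.deg) :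
    IsTransport lev (Matrix.of fun α β => (ψ (τ.res (P.T α β))).1)
      (Matrix.of fun α β => (ψ (τ.res' (P'.T α β))).1)
      (τ.Ω.map fun f => (ψ f).1) (τ.Ω.map fun f => (displacePt ψ f).1) := by
  constructor
  · intro α β
    have := ψ.map_homog (τ.Ω_homog α β)
    rwa [← zero_add (lev β - lev α), ← add_sub_assoc] at this
  · ext1 α β
    have h1 : (displacePt ψ (τ.Ω α β)).1 =
        dual (ψ (τ.Ω α β)).1 (ψ (τ.ovl.Q (τ.Ω α β))).1 := rfl
    rw [Matrix.map_apply, h1, dualMat, Matrix.of_apply, Matrix.map_apply]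
    congr 1
    rw [τ.Q_Ω, map_add, map_neg, map_sum, map_sum, Matrix.add_apply, Matrix.neg_apply,
      Matrix.mul_apply, Matrix.mul_apply]
    simp only [map_zsmul, map_mul]
    simp [twist_apply, mul_assoc]

theorem isTransport_splicedWilson (c : PatchChain k lev) (x : ChainPt c L) :
    IsTransport lev (Matrix.of fun α β => (chainRep1 c L x α β).1)
      (Matrix.of fun α β => (chainRep0 c L x α β).1)
      (splicedWilson c x) (splicedWilson c x.displace) := by
  -- Induction needs the statement for the partial products, which end at the final time of the
  -- piece in the `j`-th patch.
  have key : ∀ j : Fin (c.N + 1), IsTransport lev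
      (Matrix.of fun α β => (repAt (c.P j) _ (Set.right_mem_Icc.2 (c.lt j).le) (x.piece j) α β).1)
      (Matrix.of fun α β => (chainRep0 c L x α β).1)
      (Fin.induction (motive := fun _ => Matrix ι ι (FormalFn k L.body L.deg))
        (wilson (c.P 0) (c.lt 0) (x.piece 0))
        (fun i U => wilson (c.P i.succ) (c.lt i.succ) (x.piece i.succ) *
          ((c.tr i).Ω.map fun f => (x.junc i f).1) * U) j)
      (Fin.induction (motive := fun _ => Matrix ι ι (FormalFn k L.eps.body L.eps.deg))
        (wilson (c.P 0) (c.lt 0) (x.displace.piece 0))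
        (fun i U => wilson (c.P i.succ) (c.lt i.succ) (x.displace.piece i.succ) *
          ((c.tr i).Ω.map fun f => (x.displace.junc i f).1) * U) j) := by
    intro j
    induction j using Fin.induction with
    | zero => exact isTransport_wilson (c.P 0) (c.lt 0) (x.piece 0)
    | succ i ih =>
      rw [Fin.induction_succ, Fin.induction_succ]
      have h := isTransport_transition (c.tr i) (x.junc i)
      -- The junction conditions identify the representation matrices on the overlap with those at
      -- the ends of the adjacent pieces, so that consecutive transports become composable.
      simp only [x.junc_later, x.junc_earlier] at h
      exact ((isTransport_wilson (c.P i.succ) (c.lt i.succ) (x.piece i.succ)).mul h).mul ih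
  exact key (Fin.last c.N)

theorem homogMat_repAt (P : RepChart k lev) {a b t : ℝ} (ht : t ∈ Set.Icc a b)
    (φ : SuperCurve P.toNQChart a b L) :
    HomogMat lev 1 (Matrix.of fun α β => (repAt P t ht φ α β).1) :=
  fun α β => repAt_homog P t ht φ α β

end Transport

end

end WilsonLine

/-! ### The three claims, deduced from the transport law -/

theorem mainTheorem3 {k : Type*} [RCLike k] {ι : Type*} [Fintype ι] [DecidableEq ι]
    (lev : ι → ℤ) :
    (∀ P : RepChart k lev,
      let S := curveSpace P.toNQChart (zero_lt_one (α := ℝ))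
      let T1 : ι → ι → S.Fn k := fun α β L φ =>
        (repAt P 1 (Set.right_mem_Icc.2 zero_le_one) φ α β).1
      let T0 : ι → ι → S.Fn k := fun α β L φ =>
        (repAt P 0 (Set.left_mem_Icc.2 zero_le_one) φ α β).1
      let U : ι → ι → S.Fn k := fun α β L φ => wilson P zero_lt_one φ α β
      let E := endSpace k lev S
        (fun _ φ => repAt P 1 (Set.right_mem_Icc.2 zero_le_one) φ)
        (fun _ φ => repAt P 0 (Set.left_mem_Icc.2 zero_le_one) φ)
        (fun _ φ => repAt_homog P _ _ φ) (fun _ φ => repAt_homog P _ _ φ)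
      let UC : E.Fn k := contract (X := S) fun _ φ => wilson P zero_lt_one φ
      let O := closedCurveSpace P.toNQChart
      let UO : O.Fn k := fun _ φ => ∑ α, sgn (lev α) • wilson P zero_lt_one φ.1 α α
      (∀ (a b : ℝ) (hab : a < b) (L : GDomain) (φ : SuperCurve P.toNQChart a b L) α β e v,
        Summable (wilsonTerm P hab φ α β e v)) ∧
      (∀ α β, S.deltaB (U α β) =
        -(∑ δ, T1 α δ * U δ β) + ∑ γ, sgn (lev α + lev γ) • (U α γ * T0 γ β)) ∧
      E.deltaB UC = 0 ∧
      O.deltaB UO = 0) ∧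
    (∀ c : PatchChain k lev,
      let S := chainSpace c
      let T1 : ι → ι → S.Fn k := fun α β L x => (chainRep1 c L x α β).1
      let T0 : ι → ι → S.Fn k := fun α β L x => (chainRep0 c L x α β).1
      let U : ι → ι → S.Fn k := fun α β _ x => splicedWilson c x α β
      let E := endSpace k lev S (chainRep1 c) (chainRep0 c)
        (fun _ _ => repAt_homog _ _ _ _) (fun _ _ => repAt_homog _ _ _ _)
      let UC : E.Fn k := contract (X := S) fun _ x => splicedWilson c x
      (∀ α β, S.deltaB (U α β) =
        -(∑ δ, T1 α δ * U δ β) + ∑ γ, sgn (lev α + lev γ) • (U α γ * T0 γ β)) ∧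
      E.deltaB UC = 0) ∧
    ∀ c : ClosedChain k lev,
      let O := closedChainSpace c
      let UO : O.Fn k := fun _ x => ∑ α, sgn (lev α) • closedWilson c x α α
      O.deltaB UO = 0 := by
  refine ⟨fun P => ⟨fun a b hab L φ α β e v => summable_wilsonTerm P hab φ α β e v,
    fun α β => ?_, ?_, ?_⟩, fun c => ⟨fun α β => ?_, ?_⟩, fun c => ?_⟩
  · funext L φ
    refine ((isTransport_wilson P zero_lt_one φ).leftCoeff_apply α β).trans ?_
    simp only [Pi.add_apply, Pi.neg_apply, Finset.sum_apply, Pi.mul_apply, Pi.smul_apply,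
      Matrix.of_apply]
  · exact deltaB_contract _ _ _ _ _ fun L φ => isTransport_wilson P zero_lt_one φ
  · funext L φ
    have h := isTransport_wilson P zero_lt_one φ.1
    -- Closedness of the curve, applied to the entries of `T`, gives the equality of the two end
    -- matrices that the supertrace argument needs.
    have h0 : ∀ α β, repAt P 0 (Set.left_mem_Icc.2 zero_le_one) φ.1 α β =
      repAt P 1 (Set.right_mem_Icc.2 zero_le_one) φ.1 α β := fun α β => φ.2 (P.T α β)
    simp only [h0] at h
    exact h.leftCoeff_supertrace (homogMat_repAt P _ φ.1)
  · funext L x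
    refine ((isTransport_splicedWilson c x).leftCoeff_apply α β).trans ?_
    simp only [Pi.add_apply, Pi.neg_apply, Finset.sum_apply, Pi.mul_apply, Pi.smul_apply,
      Matrix.of_apply]
  · exact deltaB_contract _ _ _ _ _ fun L x => isTransport_splicedWilson c x
  · funext L x
    have h := isTransport_transition c.closing x.base
    -- The closing transition leads from the final point in the last patch to the initial point in
    -- the first patch, so the full product is a transport with the same matrix at both ends.
    simp only [x.base_later, x.base_earlier] at h
    exact (h.mul (isTransport_splicedWilson c.toPatchChain x.toChainPt)).leftCoeff_supertrace
      (homogMat_repAt (c.P 0) _ (x.piece 0))
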